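/- Let $n_1,n_2\ge 0$ be integers, $n=n_1+n_2+1$, and $\delta\in(0,\pi/2)$. Let the group $\mathbb{Z}_2\times\mathbb{Z}_2$ act on $\mathbb{S}^1\times\mathbb{S}^{n_1}\times\mathbb{S}^{n_2}$ (where $\mathbb{S}^{n_i}\subset\mathbb{R}^{n_i+1}$ is the unit sphere) through generators $h_1,h_2$ acting by \[ h_1(e^{is},x,y)=(-e^{is},-x,y),\qquad h_2(e^{is},x,y)=(-e^{is},x,-y). \] This action is free, so the quotient is a smooth compact $n$-manifold, and the formula \[ \overline{(e^{is},x,y)}\longmapsto\big[\big(\cos\delta\, e^{is\sin^2\delta}\,x,\ \sin\delta\, e^{-is\cos^2\delta}\,y\big)\big],\qquad s\in\mathbb{R}, \] is a well-defined Hamiltonian-minimal Lagrangian smooth embedding \[ \frac{\mathbb{S}^1\times\mathbb{S}^{n_1}\times\mathbb{S}^{n_2}}{\mathbb{Z}_2\times\mathbb{Z}_2}\longrightarrow\mathbb{CP}^n . \] Here $\mathbb{CP}^n$ is the space of complex lines of $\mathbb{C}^{n+1}=\mathbb{C}^{n_1+1}\times\mathbb{C}^{n_2+1}$ with the Fubini--Study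 metric of constant holomorphic sectional curvature $4$, complex structure $J$ and Kähler form $\omega$. A map $\psi:M\to\mathbb{CP}^n$ is Lagrangian if $\dim M=n$ and $\psi^*\omega=0$. A Lagrangian immersion $\psi$ of a compact manifold $M$ is Hamiltonian-minimal if, for every $f\in C^\infty(M)$ and every smooth variation $\psi_t$ of $\psi=\psi_0$ with $\frac{d}{dt}\big|_{t=0}\psi_t=J\,d\psi(\nabla f)$, where $\nabla f$ is the gradient with respect to the induced metric, the volume of $M$ in the metric $\psi_t^*g$ is stationary at $t=0$. -/

import Mathlib

open Set MeasureTheory Topology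
open scoped Manifold ContDiff LinearAlgebra.Projectivization

noncomputable section ComplexProjectiveSpace

/-- Complex projective space `ℂPⁿ`: the complex lines of `ℂⁿ⁺¹`. -/
abbrev CP (n : ℕ) : Type := ℙ ℂ (EuclideanSpace ℂ (Fin (n + 1)))

/-- `ℂPⁿ` carries the quotient topology of `ℂⁿ⁺¹ ∖ {0}`. -/
instance CP.instTopologicalSpace (n : ℕ) : TopologicalSpace (CP n) :=
  inferInstanceAs (TopologicalSpace
    (Quotient (projectivizationSetoid ℂ (EuclideanSpace ℂ (Fin (n + 1))))))

/-- The point `(w₀, …, 1, …, wₙ₋₁)` of `ℂⁿ⁺¹`, with `1` in position `i`. -/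
def CP.affineVec {n : ℕ} (i : Fin (n + 1)) (w : EuclideanSpace ℂ (Fin n)) :
    EuclideanSpace ℂ (Fin (n + 1)) :=
  WithLp.toLp 2 (i.insertNth (α := fun _ => ℂ) 1 (fun j => w j))

theorem CP.affineVec_same {n : ℕ} (i : Fin (n + 1)) (w : EuclideanSpace ℂ (Fin n)) :
    CP.affineVec i w i = 1 := by
  simp [CP.affineVec]

theorem CP.affineVec_succAbove {n : ℕ} (i : Fin (n + 1)) (w : EuclideanSpace ℂ (Fin n))
    (j : Fin n) : CP.affineVec i w (i.succAbove j) = w j := by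
  simp [CP.affineVec]

theorem CP.affineVec_ne_zero {n : ℕ} (i : Fin (n + 1)) (w : EuclideanSpace ℂ (Fin n)) :
    CP.affineVec i w ≠ 0 := by
  intro h
  have := CP.affineVec_same i w
  rw [h] at this
  simp at this

theorem CP.contDiff_affineVec {n : ℕ} (i : Fin (n + 1)) :
    ContDiff ℝ ∞ (CP.affineVec (n := n) i) := by
  rw [contDiff_piLp]
  intro k
  refine Fin.succAboveCases i ?_ (fun j => ?_) k
  · simpa only [CP.affineVec_same] using contDiff_const
  · simp only [CP.affineVec_succAbove]
    exact ((EuclideanSpace.proj (𝕜 := ℂ) j).restrictScalars ℝ).contDiff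

/-- The affine coordinates `(zₖ / zᵢ)_{k ≠ i}` of the point `[z]` of `ℂPⁿ`. -/
def CP.affineCoord {n : ℕ} (i : Fin (n + 1)) (p : CP n) : EuclideanSpace ℂ (Fin n) :=
  Projectivization.lift
    (fun v : {v : EuclideanSpace ℂ (Fin (n + 1)) // v ≠ 0} =>
      WithLp.toLp 2 (fun j => v.1 (i.succAbove j) / v.1 i))
    (by
      rintro ⟨a, ha⟩ ⟨b, hb⟩ t h
      simp only at h
      subst h
      have ht : t ≠ 0 := by rintro rfl; simp at ha
      ext j
      simp [mul_div_mul_left _ _ ht]) p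

/-- The set of points `[z]` with `zᵢ ≠ 0`. -/
def CP.affineSource {n : ℕ} (i : Fin (n + 1)) : Set (CP n) := {p | p.rep i ≠ 0}

theorem CP.mk_mem_affineSource {n : ℕ} (i : Fin (n + 1)) (v : EuclideanSpace ℂ (Fin (n + 1)))
    (hv : v ≠ 0) : (Projectivization.mk ℂ v hv ∈ CP.affineSource i) ↔ v i ≠ 0 := by
  obtain ⟨a, ha⟩ := Projectivization.exists_smul_eq_mk_rep ℂ v hv
  simp only [CP.affineSource, mem_ofPred_eq, ← ha]
  simp [Units.smul_def]

theorem CP.continuous_mk {n : ℕ} : Continuous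
    (fun v : {v : EuclideanSpace ℂ (Fin (n + 1)) // v ≠ 0} => Projectivization.mk ℂ v.1 v.2) :=
  continuous_quotient_mk'

theorem CP.isQuotientMap_mk {n : ℕ} : IsQuotientMap
    (fun v : {v : EuclideanSpace ℂ (Fin (n + 1)) // v ≠ 0} => Projectivization.mk ℂ v.1 v.2) :=
  isQuotientMap_quotient_mk'

theorem CP.isOpen_affineSource {n : ℕ} (i : Fin (n + 1)) : IsOpen (CP.affineSource i) := by
  rw [← CP.isQuotientMap_mk.isOpen_preimage]
  have : (fun v : {v : EuclideanSpace ℂ (Fin (n + 1)) // v ≠ 0} =>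
      Projectivization.mk ℂ v.1 v.2) ⁻¹' (CP.affineSource i) = {v | v.1 i ≠ 0} := by
    ext v; exact CP.mk_mem_affineSource i v.1 v.2
  rw [this]
  exact isOpen_ne_fun (by fun_prop) continuous_const

theorem CP.affineCoord_mk {n : ℕ} (i : Fin (n + 1)) (v : EuclideanSpace ℂ (Fin (n + 1)))
    (hv : v ≠ 0) : CP.affineCoord i (Projectivization.mk ℂ v hv) =
      WithLp.toLp 2 (fun j => v (i.succAbove j) / v i) := rfl

theorem CP.continuousOn_affineCoord {n : ℕ} (i : Fin (n + 1)) :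
    ContinuousOn (CP.affineCoord (n := n) i) (CP.affineSource i) := by
  rw [CP.isQuotientMap_mk.continuousOn_isOpen_iff (CP.isOpen_affineSource i)]
  have h : ∀ k, Continuous
      (fun v : {v : EuclideanSpace ℂ (Fin (n + 1)) // v ≠ 0} => v.1 k) := fun k => by fun_prop
  refine (PiLp.continuous_toLp 2 _).comp_continuousOn (continuousOn_pi.2 fun j => ?_)
  exact (h _).continuousOn.div (h _).continuousOn
    fun v hv => (CP.mk_mem_affineSource i v.1 v.2).1 hv

/-- The `i`-th affine chart of `ℂPⁿ`. -/
def CP.affineChart {n : ℕ} (i : Fin (n + 1)) :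
    OpenPartialHomeomorph (CP n) (EuclideanSpace ℂ (Fin n)) where
  toFun := CP.affineCoord i
  invFun w := Projectivization.mk ℂ (CP.affineVec i w) (CP.affineVec_ne_zero i w)
  source := CP.affineSource i
  target := univ
  map_source' _ _ := mem_univ _
  map_target' w _ := by
    rw [CP.mk_mem_affineSource, CP.affineVec_same]; exact one_ne_zero
  left_inv' p hp := by
    induction p using Projectivization.ind with
    | h v hv =>
      rw [CP.mk_mem_affineSource] at hp
      rw [Projectivization.mk_eq_mk_iff']
      refine ⟨(v i)⁻¹, ?_⟩
      ext k
      refine Fin.succAboveCases i ?_ (fun j => ?_) k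
      · simp [CP.affineVec_same, hp]
      · simp [CP.affineVec_succAbove, CP.affineCoord_mk, div_eq_inv_mul]
  right_inv' w _ := by
    ext j
    simp [CP.affineCoord_mk, CP.affineVec_same, CP.affineVec_succAbove]
  open_source := CP.isOpen_affineSource i
  open_target := isOpen_univ
  continuousOn_toFun := CP.continuousOn_affineCoord i
  continuousOn_invFun := by
    apply Continuous.continuousOn
    exact CP.continuous_mk.comp
      (Continuous.subtype_mk (CP.contDiff_affineVec i).continuous (CP.affineVec_ne_zero i))

theorem CP.exists_mem_affineSource {n : ℕ} (p : CP n) : ∃ i, p ∈ CP.affineSource i := by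
  by_contra! h
  apply p.rep_nonzero
  ext i
  simpa [CP.affineSource] using h i

/-- The standard atlas of `ℂPⁿ`. -/
instance CP.instChartedSpace (n : ℕ) : ChartedSpace (EuclideanSpace ℂ (Fin n)) (CP n) where
  atlas := range CP.affineChart
  chartAt p := CP.affineChart (CP.exists_mem_affineSource p).choose
  mem_chart_source p := (CP.exists_mem_affineSource p).choose_spec
  chart_mem_atlas _ := mem_range_self _

/-- `ℂPⁿ` is a smooth (real) manifold of real dimension `2n`. -/
instance CP.instIsManifold (n : ℕ) : IsManifold 𝓘(ℝ, EuclideanSpace ℂ (Fin n)) ∞ (CP n) := by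
  refine isManifold_of_contDiffOn _ _ _ ?_
  rintro _ _ ⟨i, rfl⟩ ⟨k, rfl⟩
  have h : ContDiffOn ℝ ∞ (fun w : EuclideanSpace ℂ (Fin n) =>
      (WithLp.toLp 2 (fun j => CP.affineVec i w (k.succAbove j) / CP.affineVec i w k) :
        EuclideanSpace ℂ (Fin n))) {w | CP.affineVec i w k ≠ 0} := by
    rw [contDiffOn_piLp]
    intro j
    have hc : ∀ l, ContDiff ℝ ∞ (fun w => CP.affineVec (n := n) i w l) := fun l =>
      (contDiff_piLp 2 |>.1 (CP.contDiff_affineVec i)) l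
    simp only [div_eq_mul_inv]
    exact (hc _).contDiffOn.mul ((hc _).contDiffOn.inv (fun w hw => hw))
  refine ContDiffOn.mono h ?_
  rintro w ⟨⟨-, hw⟩, -⟩
  exact (CP.mk_mem_affineSource k _ (CP.affineVec_ne_zero i _)).1 hw

end ComplexProjectiveSpace

noncomputable section KaehlerStructure

variable {n : ℕ}

/-- The Fubini–Study metric of constant holomorphic sectional curvature `4` in affine coordinates:
at the point with affine coordinates `w` it is
`g(u, v) = Re ((1 + |w|²) ⟨u, v⟩ - ⟨u, w⟩ ⟨w, v⟩) / (1 + |w|²)²`. It is the metric for which the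
Hopf fibration `S²ⁿ⁺¹ → ℂPⁿ` is a Riemannian submersion. -/
def fubiniStudyForm (w : EuclideanSpace ℂ (Fin n)) :
    LinearMap.BilinForm ℝ (EuclideanSpace ℂ (Fin n)) :=
  LinearMap.mk₂ ℝ
    (fun u v : EuclideanSpace ℂ (Fin n) =>
      ((1 + ‖w‖ ^ 2) * (inner ℂ u v).re - (inner ℂ u w * inner ℂ w v).re) / (1 + ‖w‖ ^ 2) ^ 2)
    (fun u u' v => by simp only [inner_add_left, add_mul, Complex.add_re]; ring)
    (fun c u v => by
      simp only [inner_smul_left_eq_smul, smul_mul_assoc, Complex.smul_re, smul_eq_mul]; ring)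
    (fun u v v' => by simp only [inner_add_right, mul_add, Complex.add_re]; ring)
    (fun c u v => by
      simp only [inner_smul_right_eq_smul, mul_smul_comm, Complex.smul_re, smul_eq_mul]; ring)

/-- The Fubini–Study metric of `ℂPⁿ`. A tangent vector at `p` is given by its components in the
affine chart at `p`. -/
def fubiniStudy (p : CP n) :
    LinearMap.BilinForm ℝ (TangentSpace 𝓘(ℝ, EuclideanSpace ℂ (Fin n)) p) :=
  fubiniStudyForm (chartAt (EuclideanSpace ℂ (Fin n)) p p)

/-- The complex structure `J` of `ℂPⁿ`: multiplication by `i` in the affine (holomorphic)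
charts. -/
def complexStructure {p : CP n} (u : TangentSpace 𝓘(ℝ, EuclideanSpace ℂ (Fin n)) p) :
    TangentSpace 𝓘(ℝ, EuclideanSpace ℂ (Fin n)) p :=
  let u' : EuclideanSpace ℂ (Fin n) := u
  (Complex.I • u' : EuclideanSpace ℂ (Fin n))

/-- The Kähler form `ω(u, v) = g(J u, v)` of `ℂPⁿ`. -/
def kaehlerForm (p : CP n) (u v : TangentSpace 𝓘(ℝ, EuclideanSpace ℂ (Fin n)) p) : ℝ :=
  fubiniStudy p (complexStructure u) v

end KaehlerStructure

noncomputable section RiemannianVolume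

open scoped Matrix

variable {E : Type*} [NormedAddCommGroup E] [NormedSpace ℝ E] [FiniteDimensional ℝ E]
  {H : Type*} [TopologicalSpace H] (I : ModelWithCorners ℝ E H)
  {M : Type*} [TopologicalSpace M] [ChartedSpace H M]

/-- The Gram matrix of the coordinate vector fields of the chart `e` with respect to the
(semi-)definite metric `h`, at the point with coordinates `y`. The coordinates are the ones with
respect to the basis `Module.finBasis ℝ E` of the model vector space `E`, on which the volume
defined below does not depend. -/
def chartGram (h : ∀ p : M, LinearMap.BilinForm ℝ (TangentSpace I p))
    (e : OpenPartialHomeomorph M H) (y : E) :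
    Matrix (Fin (Module.finrank ℝ E)) (Fin (Module.finrank ℝ E)) ℝ :=
  Matrix.of fun i j =>
    h ((e.extend I).symm y)
      (mfderiv 𝓘(ℝ, E) I (e.extend I).symm y (Module.finBasis ℝ E i))
      (mfderiv 𝓘(ℝ, E) I (e.extend I).symm y (Module.finBasis ℝ E j))

/-- The measure `μ` is the Riemannian volume of the metric `h`: in every chart of the manifold it
is `√(det hᵢⱼ) dy₁ ⋯ dyₘ`. (`Basis.addHaar` is the Lebesgue measure for which the
parallelepiped of the basis has volume one.) -/
def IsRiemannianVolume [MeasurableSpace M] [MeasurableSpace E] [BorelSpace E]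
    (h : ∀ p : M, LinearMap.BilinForm ℝ (TangentSpace I p)) (μ : Measure M) : Prop :=
  ∀ e ∈ IsManifold.maximalAtlas I ∞ M, ∀ A ⊆ e.source, MeasurableSet A →
    μ A = ∫⁻ y in e.extend I '' A, ENNReal.ofReal √((chartGram I h e y).det)
      ∂(Module.finBasis ℝ E).addHaar

theorem gram_det_comp (B : LinearMap.BilinForm ℝ E) (D L : E →L[ℝ] E) :
    (Matrix.of fun i j => B (D (L (Module.finBasis ℝ E i))) (D (L (Module.finBasis ℝ E j)))).det =
      L.det ^ 2 *
        (Matrix.of fun i j => B (D (Module.finBasis ℝ E i)) (D (Module.finBasis ℝ E j))).det := by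
  set b := Module.finBasis ℝ E
  set B' : LinearMap.BilinForm ℝ E := B.compl₁₂ (D : E →ₗ[ℝ] E) (D : E →ₗ[ℝ] E) with hB'
  have h1 : (Matrix.of fun i j => B (D (b i)) (D (b j))) = LinearMap.BilinForm.toMatrix b B' := by
    ext i j; simp [hB', LinearMap.BilinForm.toMatrix_apply]
  have h2 : (Matrix.of fun i j => B (D (L (b i))) (D (L (b j)))) =
      LinearMap.BilinForm.toMatrix b (B'.comp (L : E →ₗ[ℝ] E) (L : E →ₗ[ℝ] E)) := by
    ext i j; simp [hB', LinearMap.BilinForm.toMatrix_apply]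
  rw [h1, h2, LinearMap.BilinForm.toMatrix_comp b b, Matrix.det_mul, Matrix.det_mul,
    Matrix.det_transpose, LinearMap.det_toMatrix]
  simp only [ContinuousLinearMap.det]
  ring

theorem chartGram_det_eq [IsManifold I ∞ M] [I.Boundaryless]
    (h : ∀ p : M, LinearMap.BilinForm ℝ (TangentSpace I p))
    {e e' : OpenPartialHomeomorph M H} (he : e ∈ IsManifold.maximalAtlas I ∞ M)
    (he' : e' ∈ IsManifold.maximalAtlas I ∞ M) {x : M} (hx : x ∈ e.source) (hx' : x ∈ e'.source) :
    ∃ L : E →L[ℝ] E, HasFDerivAt (e'.extend I ∘ (e.extend I).symm) L (e.extend I x) ∧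
      (chartGram I h e (e.extend I x)).det =
        L.det ^ 2 * (chartGram I h e' (e'.extend I x)).det := by
  set y := e.extend I x with hy
  have hxy : (e.extend I).symm y = x := e.extend_left_inv hx
  have hxy' : (e'.extend I).symm (e'.extend I x) = x := e'.extend_left_inv hx'
  have hyt : y ∈ (e.extend I).target := (e.extend I).map_source (by rwa [e.extend_source])
  have hyt' : e'.extend I x ∈ (e'.extend I).target :=
    (e'.extend I).map_source (by rwa [e'.extend_source])
  have key : ∀ (a : OpenPartialHomeomorph M H), a ∈ IsManifold.maximalAtlas I ∞ M →
      x ∈ a.source → MDifferentiableAt 𝓘(ℝ, E) I (a.extend I).symm (a.extend I x) := by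
    intro a ha hxa
    have h1 := contMDiffOn_extend_symm (I := I) ha
    rw [← a.extend_target'] at h1
    exact ((h1.contMDiffAt ((a.isOpen_extend_target (I := I)).mem_nhds
      ((a.extend I).map_source (by rwa [a.extend_source])))).mdifferentiableAt (by simp))
  have hd := key e he hx
  have hd' := key e' he' hx'
  have hc' : MDifferentiableAt I 𝓘(ℝ, E) (e'.extend I) ((e.extend I).symm y) := by
    rw [hxy]
    exact (e'.contMDiffAt_extend he' hx').mdifferentiableAt (by simp)
  have hτ : DifferentiableAt ℝ (e'.extend I ∘ (e.extend I).symm) y :=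
    mdifferentiableAt_iff_differentiableAt.1 (hc'.comp y hd)
  have hτy : (e'.extend I ∘ (e.extend I).symm) y = e'.extend I x := by
    rw [Function.comp_apply, hxy]
  have hev : (e.extend I).symm =ᶠ[𝓝 y]
      (e'.extend I).symm ∘ (e'.extend I ∘ (e.extend I).symm) := by
    have hcont : ContinuousAt (e.extend I).symm y := hd.continuousAt
    have : (e.extend I).symm ⁻¹' e'.source ∈ 𝓝 y :=
      hcont.preimage_mem_nhds (by rw [hxy]; exact e'.open_source.mem_nhds hx')
    filter_upwards [this] with z hz
    exact (e'.extend_left_inv hz).symm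
  refine ⟨fderiv ℝ (e'.extend I ∘ (e.extend I).symm) y, hτ.hasFDerivAt, ?_⟩
  have hD : mfderiv 𝓘(ℝ, E) I (e.extend I).symm y =
      (mfderiv 𝓘(ℝ, E) I (e'.extend I).symm (e'.extend I x) : E →L[ℝ] E).comp
        (fderiv ℝ (e'.extend I ∘ (e.extend I).symm) y) := by
    rw [hev.mfderiv_eq, mfderiv_comp y (by rw [hτy]; exact hd')
      (mdifferentiableAt_iff_differentiableAt.2 hτ), mfderiv_eq_fderiv, hτy]
    rfl
  let B : M → LinearMap.BilinForm ℝ E := fun p => h p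
  let D : E →L[ℝ] E := mfderiv 𝓘(ℝ, E) I (e.extend I).symm y
  let D' : E →L[ℝ] E := mfderiv 𝓘(ℝ, E) I (e'.extend I).symm (e'.extend I x)
  have e1 : chartGram I h e y = Matrix.of fun i j => B ((e.extend I).symm y)
      (D (Module.finBasis ℝ E i)) (D (Module.finBasis ℝ E j)) := rfl
  have e2 : chartGram I h e' (e'.extend I x) = Matrix.of fun i j =>
      B ((e'.extend I).symm (e'.extend I x))
      (D' (Module.finBasis ℝ E i)) (D' (Module.finBasis ℝ E j)) := rfl
  have hD2 : D = D'.comp (fderiv ℝ (e'.extend I ∘ (e.extend I).symm) y) := hD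
  rw [e1, e2, hxy, hxy', hD2]
  exact gram_det_comp _ _ _

theorem measurableSet_chart_image [MeasurableSpace M] [BorelSpace M] [MeasurableSpace E]
    [BorelSpace E] [I.Boundaryless] (e : OpenPartialHomeomorph M H) {A : Set M}
    (hA : MeasurableSet A) (hAe : A ⊆ e.source) : MeasurableSet (e.extend I '' A) := by
  have h1 : e.extend I '' A = (e.extend I).target ∩ (e.extend I).symm ⁻¹' A :=
    (e.extend I).image_eq_target_inter_inv_preimage (by rwa [e.extend_source])
  have ho : MeasurableSet (e.extend I).target := (e.isOpen_extend_target (I := I)).measurableSet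
  rw [h1, ← Subtype.image_preimage_coe]
  refine (MeasurableEmbedding.subtype_coe ho).measurableSet_image.2 ?_
  have : Continuous (fun z : (e.extend I).target => (e.extend I).symm z) :=
    continuousOn_iff_continuous_domRestrict.1 (e.continuousOn_extend_symm (I := I))
  exact this.measurable hA

theorem lintegral_chart_eq [MeasurableSpace M] [BorelSpace M] [MeasurableSpace E] [BorelSpace E]
    [IsManifold I ∞ M] [I.Boundaryless]
    (h : ∀ p : M, LinearMap.BilinForm ℝ (TangentSpace I p))
    {e e' : OpenPartialHomeomorph M H} (he : e ∈ IsManifold.maximalAtlas I ∞ M)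
    (he' : e' ∈ IsManifold.maximalAtlas I ∞ M) {A : Set M} (hA : MeasurableSet A)
    (hAe : A ⊆ e.source) (hAe' : A ⊆ e'.source) :
    ∫⁻ y in e.extend I '' A, ENNReal.ofReal √((chartGram I h e y).det)
      ∂(Module.finBasis ℝ E).addHaar =
    ∫⁻ y in e'.extend I '' A, ENNReal.ofReal √((chartGram I h e' y).det)
      ∂(Module.finBasis ℝ E).addHaar := by
  have hex : ∀ y ∈ e.extend I '' A, ∃ L : E →L[ℝ] E,
      HasFDerivAt (e'.extend I ∘ (e.extend I).symm) L y ∧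
      (chartGram I h e y).det =
        L.det ^ 2 * (chartGram I h e' ((e'.extend I ∘ (e.extend I).symm) y)).det := by
    rintro _ ⟨x, hx, rfl⟩
    obtain ⟨L, hL, hL'⟩ := chartGram_det_eq I h he he' (hAe hx) (hAe' hx)
    refine ⟨L, hL, ?_⟩
    rw [hL', Function.comp_apply, e.extend_left_inv (hAe hx)]
  choose! L hL hL' using hex
  have hm := measurableSet_chart_image I e hA hAe
  have himg : (e'.extend I ∘ (e.extend I).symm) '' (e.extend I '' A) = e'.extend I '' A := by
    rw [image_image]
    refine image_congr fun x hx => ?_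
    rw [Function.comp_apply, e.extend_left_inv (hAe hx)]
  have hinj : InjOn (e'.extend I ∘ (e.extend I).symm) (e.extend I '' A) := by
    rintro _ ⟨x, hx, rfl⟩ _ ⟨x', hx', rfl⟩ hxx
    simp only [Function.comp_apply, e.extend_left_inv (hAe hx), e.extend_left_inv (hAe hx')] at hxx
    rw [(e'.extend I).injOn (by rw [e'.extend_source]; exact hAe' hx)
      (by rw [e'.extend_source]; exact hAe' hx') hxx]
  rw [← himg, lintegral_image_eq_lintegral_abs_det_fderiv_mul _ hm
    (fun y hy => (hL y hy).hasFDerivWithinAt) hinj]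
  refine setLIntegral_congr_fun hm fun y hy => ?_
  rw [hL' y hy, Real.sqrt_mul (sq_nonneg _), Real.sqrt_sq_eq_abs, ENNReal.ofReal_mul (abs_nonneg _)]

theorem exists_isRiemannianVolume [MeasurableSpace M] [BorelSpace M] [MeasurableSpace E]
    [BorelSpace E] [IsManifold I ∞ M] [I.Boundaryless] [SecondCountableTopology M]
    (h : ∀ p : M, LinearMap.BilinForm ℝ (TangentSpace I p)) :
    ∃ μ : Measure M, IsRiemannianVolume I h μ := by
  classical
  rcases isEmpty_or_nonempty M with hM | hM
  · exact ⟨0, fun e _ A _ _ => by simp [Subsingleton.elim A ∅]⟩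
  obtain ⟨S, hSc, hSu⟩ := TopologicalSpace.isOpen_iUnion_countable
    (fun x : M => (chartAt H x).source) (fun x => (chartAt H x).open_source)
  have hSu' : ∀ x : M, ∃ i ∈ S, x ∈ (chartAt H i).source := by
    intro x
    have : x ∈ ⋃ i ∈ S, (chartAt H i).source := by
      rw [hSu]; exact mem_iUnion.2 ⟨x, mem_chart_source H x⟩
    simpa using this
  have hSne : S.Nonempty := by
    obtain ⟨i, hi, -⟩ := hSu' (Classical.arbitrary M)
    exact ⟨i, hi⟩
  obtain ⟨c, hc⟩ := hSc.exists_eq_range hSne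
  let U : ℕ → Set M := disjointed fun k => (chartAt H (c k)).source
  have hUm : ∀ k, MeasurableSet (U k) := fun k =>
    MeasurableSet.disjointed (fun k => (chartAt H (c k)).open_source.measurableSet) k
  have hUs : ∀ k, U k ⊆ (chartAt H (c k)).source := fun k => disjointed_subset _ k
  have hUd : Pairwise (Function.onFun Disjoint U) := disjoint_disjointed _
  have hUu : ⋃ k, U k = univ := by
    rw [iUnion_disjointed]
    refine eq_univ_of_forall fun x => ?_
    obtain ⟨i, hi, hx⟩ := hSu' x
    rw [hc] at hi
    obtain ⟨k, rfl⟩ := hi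
    exact mem_iUnion.2 ⟨k, hx⟩
  let b := (Module.finBasis ℝ E).addHaar
  let J : OpenPartialHomeomorph M H → Set M → ENNReal := fun e A =>
    ∫⁻ y in e.extend I '' A, ENNReal.ofReal √((chartGram I h e y).det) ∂b
  have hJ : ∀ (e : OpenPartialHomeomorph M H) (A : ℕ → Set M), (∀ i, MeasurableSet (A i)) →
      (∀ i, A i ⊆ e.source) → Pairwise (Function.onFun Disjoint A) →
      J e (⋃ i, A i) = ∑' i, J e (A i) := by
    intro e A hA hAs hAd
    simp only [J]
    rw [image_iUnion, lintegral_iUnion (fun i => measurableSet_chart_image I e (hA i) (hAs i))]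
    intro i j hij
    refine disjoint_left.2 ?_
    rintro _ ⟨x, hx, rfl⟩ ⟨x', hx', hxx⟩
    have := (e.extend I).injOn (by rw [e.extend_source]; exact hAs j hx')
      (by rw [e.extend_source]; exact hAs i hx) hxx
    exact disjoint_left.1 (hAd hij) hx (this ▸ hx')
  let μ : Measure M := Measure.ofMeasurable
    (fun A _ => ∑' k, J (chartAt H (c k)) (A ∩ U k))
    (by simp [J])
    (by
      intro A hA hAd
      have : ∀ k, J (chartAt H (c k)) ((⋃ i, A i) ∩ U k) =
          ∑' i, J (chartAt H (c k)) (A i ∩ U k) := by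
        intro k
        rw [iUnion_inter]
        exact hJ _ _ (fun i => (hA i).inter (hUm k)) (fun i => inter_subset_right.trans (hUs k))
          (fun i j hij => (hAd hij).mono inter_subset_left inter_subset_left)
      simp only [this]
      exact ENNReal.tsum_comm)
  refine ⟨μ, fun e he A hAe hA => ?_⟩
  have h1 : μ A = ∑' k, J (chartAt H (c k)) (A ∩ U k) := Measure.ofMeasurable_apply A hA
  have h2 : ∀ k, J (chartAt H (c k)) (A ∩ U k) = J e (A ∩ U k) := fun k =>
    lintegral_chart_eq I h (IsManifold.chart_mem_maximalAtlas _) he (hA.inter (hUm k))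
      (inter_subset_right.trans (hUs k)) (inter_subset_left.trans hAe)
  have h3 : J e A = ∑' k, J e (A ∩ U k) := by
    conv_lhs => rw [← inter_univ A, ← hUu, inter_iUnion]
    exact hJ e _ (fun k => hA.inter (hUm k)) (fun k => inter_subset_left.trans hAe)
      (fun i j hij => (hUd hij).mono inter_subset_right inter_subset_right)
  rw [h1]
  simp only [h2]
  exact h3.symm

/-- The total Riemannian volume of `M` with respect to the metric `h`. (The Riemannian volume measure
on the Borel sets is unique, because `M` is covered by countably many charts.) -/
def totalVolume [MeasurableSpace E] [BorelSpace E] [IsManifold I ∞ M] [I.Boundaryless]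
    [SecondCountableTopology M]
    (h : ∀ p : M, LinearMap.BilinForm ℝ (TangentSpace I p)) : ℝ :=
  letI : MeasurableSpace M := borel M
  haveI : BorelSpace M := ⟨rfl⟩
  ((exists_isRiemannianVolume I h).choose univ).toReal

end RiemannianVolume

noncomputable section Lagrangian

variable {n : ℕ} {E : Type*} [NormedAddCommGroup E] [NormedSpace ℝ E] [FiniteDimensional ℝ E]
  {H : Type*} [TopologicalSpace H] (I : ModelWithCorners ℝ E H)
  {M : Type*} [TopologicalSpace M] [ChartedSpace H M]

/-- The metric `ψ^* g` induced on `M` by a map `ψ : M → ℂPⁿ`. -/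
def inducedMetric (ψ : M → CP n) (p : M) : LinearMap.BilinForm ℝ (TangentSpace I p) :=
  (fubiniStudy (ψ p)).compl₁₂
    (mfderiv I 𝓘(ℝ, EuclideanSpace ℂ (Fin n)) ψ p).toLinearMap
    (mfderiv I 𝓘(ℝ, EuclideanSpace ℂ (Fin n)) ψ p).toLinearMap

/-- A map `ψ` from a manifold `M` to `ℂPⁿ` is Lagrangian: `dim M = n` and `ψ^* ω = 0`. -/
def IsLagrangian (ψ : M → CP n) : Prop :=
  Module.finrank ℝ E = n ∧ ∀ (p : M) (u v : TangentSpace I p),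
    kaehlerForm (ψ p) (mfderiv I 𝓘(ℝ, EuclideanSpace ℂ (Fin n)) ψ p u)
      (mfderiv I 𝓘(ℝ, EuclideanSpace ℂ (Fin n)) ψ p v) = 0

/-- The vector field `X` on `M` is the gradient of `f` with respect to the metric induced
by `ψ`. -/
def IsGradient (ψ : M → CP n) (f : M → ℝ) (X : ∀ p : M, TangentSpace I p) : Prop :=
  ∀ (p : M) (v : TangentSpace I p), inducedMetric I ψ p (X p) v = mfderiv I 𝓘(ℝ, ℝ) f p v

/-- `Ψ` is a smooth variation of `ψ`, defined for times `t ∈ (-ε, ε)`. -/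
def IsVariation (ψ : M → CP n) (ε : ℝ) (Ψ : ℝ → M → CP n) : Prop :=
  0 < ε ∧ Ψ 0 = ψ ∧
    ContMDiffOn (𝓘(ℝ, ℝ).prod I) 𝓘(ℝ, EuclideanSpace ℂ (Fin n)) ∞
      (fun q : ℝ × M => Ψ q.1 q.2) (Ioo (-ε) ε ×ˢ univ)

/-- The velocity of a variation `Ψ` at time `0`, a vector field along `Ψ 0`. -/
def variationField (Ψ : ℝ → M → CP n) (p : M) :
    TangentSpace 𝓘(ℝ, EuclideanSpace ℂ (Fin n)) (Ψ 0 p) :=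
  mfderiv 𝓘(ℝ, ℝ) 𝓘(ℝ, EuclideanSpace ℂ (Fin n)) (fun t => Ψ t p) 0 (1 : ℝ)

/-- An immersion `ψ` of a compact manifold `M` into `ℂPⁿ` is Hamiltonian minimal: the volume is
stationary under all variations of `ψ` whose initial velocity is a Hamiltonian field
`J ∇f`, where `f` is a smooth function on `M` and `∇f` is its gradient with respect to the induced
metric. -/
def IsHamiltonianMinimal [MeasurableSpace E] [BorelSpace E] [IsManifold I ∞ M] [I.Boundaryless]
    [SecondCountableTopology M] [CompactSpace M] (ψ : M → CP n) : Prop :=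
  ∀ (f : M → ℝ) (X : ∀ p : M, TangentSpace I p) (ε : ℝ) (Ψ : ℝ → M → CP n),
    ContMDiff I 𝓘(ℝ, ℝ) ∞ f → IsGradient I ψ f X → IsVariation I ψ ε Ψ →
    (∀ p, variationField Ψ p =
      complexStructure (mfderiv I 𝓘(ℝ, EuclideanSpace ℂ (Fin n)) (Ψ 0) p (X p))) →
    HasDerivAt (fun t => totalVolume I (inducedMetric I (Ψ t))) 0 0

end Lagrangian

noncomputable section QuotientManifold

variable {X : Type*} [TopologicalSpace X] {G : Type*} [Group G] [MulAction G X]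
  [ProperlyDiscontinuousSMul G X] [ContinuousConstSMul G X] [IsCancelSMul G X]
  [T2Space X] [LocallyCompactSpace X]
  {E : Type*} [NormedAddCommGroup E] [NormedSpace ℝ E]
  {H : Type*} [TopologicalSpace H] (I : ModelWithCorners ℝ E H) [I.Boundaryless]
  [ChartedSpace H X]

/-- The quotient of a smooth manifold by a free, properly discontinuous action by diffeomorphisms
is a smooth manifold. -/
theorem isManifold_orbitRel_quotient [IsManifold I ∞ X]
    (hG : ∀ g : G, ContMDiff I I ∞ (fun x : X => g • x)) :
    IsManifold I ∞ (MulAction.orbitRel.Quotient G X) := by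
  have hcov : IsQuotientCoveringMap (Quotient.mk (MulAction.orbitRel G X)) G :=
    isQuotientCoveringMap_quotientMk_of_properlyDiscontinuousSMul
  have hf : IsLocalHomeomorph (Quotient.mk (MulAction.orbitRel G X)) :=
    hcov.isCoveringMap.isLocalHomeomorph
  have hatlas : ∀ e ∈ atlas H (MulAction.orbitRel.Quotient G X), ∃ x : X,
      e = (hf.localInverseAt x).trans (chartAt H x) := by
    rintro _ ⟨q, rfl⟩
    exact ⟨_, rfl⟩
  refine isManifold_of_contDiffOn _ _ _ fun e e' he he' => ?_
  obtain ⟨a, rfl⟩ := hatlas e he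
  obtain ⟨a', rfl⟩ := hatlas e' he'
  set φ := chartAt H a
  set φ' := chartAt H a'
  set π : X → MulAction.orbitRel.Quotient G X := Quotient.mk (MulAction.orbitRel G X) with hπ
  rintro y ⟨hy, -⟩
  apply ContDiffAt.contDiffWithinAt
  simp only [OpenPartialHomeomorph.trans_symm_eq_symm_trans_symm, mem_preimage,
    OpenPartialHomeomorph.trans_source, mem_inter_iff, OpenPartialHomeomorph.symm_source,
    OpenPartialHomeomorph.coe_trans, Function.comp_apply,
    IsLocalHomeomorph.localInverseAt_symm] at hy
  obtain ⟨⟨hy1, -⟩, hy2, hy3⟩ := hy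
  set x : X := φ.symm (I.symm y) with hx
  set x' : X := hf.localInverseAt a' (π x) with hx'
  have hx'π : π x' = π x := hf.apply_localInverseAt_of_mem hy2
  obtain ⟨g, hg⟩ : ∃ g : G, g • x = x' := hcov.apply_eq_iff_mem_orbit.1 hx'π
  have hx't : x' ∈ (hf.localInverseAt a').target := (hf.localInverseAt a').map_source hy2
  have hyt : y ∈ (φ.extend I).target := by
    rw [φ.extend_target, I.range_eq_univ]; exact ⟨hy1, mem_univ _⟩
  have hs : ContMDiffAt 𝓘(ℝ, E) I ∞ (φ.extend I).symm y := by
    have h1 := contMDiffOn_extend_symm (I := I) (n := ∞) (IsManifold.chart_mem_maximalAtlas a)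
    rw [← φ.extend_target'] at h1
    exact h1.contMDiffAt ((φ.isOpen_extend_target (I := I)).mem_nhds hyt)
  have hsx : (φ.extend I).symm y = x := rfl
  have hs' : ContMDiffAt I 𝓘(ℝ, E) ∞ (φ'.extend I) (g • (φ.extend I).symm y) := by
    rw [hsx, hg]
    exact φ'.contMDiffAt_extend (IsManifold.chart_mem_maximalAtlas a') hy3
  have hcomp : ContDiffAt ℝ ∞ (fun z => φ'.extend I (g • (φ.extend I).symm z)) y :=
    contMDiffAt_iff_contDiffAt.1
      (hs'.comp y (((hG g).contMDiffAt (x := (φ.extend I).symm y)).comp y hs))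
  refine hcomp.congr_of_eventuallyEq ?_
  have hcont : ContinuousAt (fun z => g • (φ.extend I).symm z) y :=
    ((continuous_const_smul g).continuousAt).comp hs.continuousAt
  have hn : (fun z => g • (φ.extend I).symm z) ⁻¹' (hf.localInverseAt a').target ∈ 𝓝 y :=
    hcont.preimage_mem_nhds (by
      rw [hsx, hg]; exact (hf.localInverseAt a').open_target.mem_nhds hx't)
  filter_upwards [hn] with z hz
  have h1 : π (φ.symm (I.symm z)) = π (g • (φ.extend I).symm z) :=
    (hcov.map_smul g (e := (φ.extend I).symm z)).symm
  have h2 : hf.localInverseAt a' (π (g • (φ.extend I).symm z)) = g • (φ.extend I).symm z := by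
    have := (hf.localInverseAt a').right_inv hz
    rwa [IsLocalHomeomorph.localInverseAt_symm] at this
  simp only [OpenPartialHomeomorph.trans_symm_eq_symm_trans_symm, Function.comp_apply,
    OpenPartialHomeomorph.coe_trans, IsLocalHomeomorph.localInverseAt_symm,
    OpenPartialHomeomorph.extend_coe]
  exact congrArg (fun q => I (φ' q)) ((congrArg (hf.localInverseAt a') h1).trans h2)

end QuotientManifold

noncomputable section TheQuotient

/-- The unit sphere `Sᵐ` of `ℝᵐ⁺¹`. -/
abbrev UnitSphere (m : ℕ) : Type := Metric.sphere (0 : EuclideanSpace ℝ (Fin (m + 1))) 1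

/-- The product `S¹ × Sᵏ × Sˡ`. -/
abbrev SphereProduct (k l : ℕ) : Type := Circle × UnitSphere k × UnitSphere l

/-- The action of a sign on a space with antipodal map. -/
def signAct {α : Type*} [InvolutiveNeg α] (ε : ℤˣ) (a : α) : α := if ε = 1 then a else -a

/-- The action of `ℤ₂ × ℤ₂ = {±1} × {±1}` on `S¹ × Sᵏ × Sˡ` given by
`(ε₁, ε₂) • (z, x, y) = (ε₁ ε₂ z, ε₁ x, ε₂ y)`. -/
instance SphereProduct.instMulAction (k l : ℕ) : MulAction (ℤˣ × ℤˣ) (SphereProduct k l) where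
  smul ε p := (signAct (ε.1 * ε.2) p.1, signAct ε.1 p.2.1, signAct ε.2 p.2.2)
  one_smul p := rfl
  mul_smul ε ε' p := by
    obtain ⟨a, b⟩ := ε
    obtain ⟨a', b'⟩ := ε'
    change (signAct _ _, signAct _ _, signAct _ _) = (signAct _ (signAct _ _),
      signAct _ (signAct _ _), signAct _ (signAct _ _))
    rcases Int.units_eq_one_or a with rfl | rfl <;> rcases Int.units_eq_one_or b with rfl | rfl <;>
    rcases Int.units_eq_one_or a' with rfl | rfl <;>
    rcases Int.units_eq_one_or b' with rfl | rfl <;> simp [signAct]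

/-- The generator `h₁` of the action. -/
theorem SphereProduct.smul_h₁ {k l : ℕ} (z : Circle) (x : UnitSphere k) (y : UnitSphere l) :
    ((-1, 1) : ℤˣ × ℤˣ) • ((z, x, y) : SphereProduct k l) = (-z, -x, y) := rfl

/-- The generator `h₂` of the action. -/
theorem SphereProduct.smul_h₂ {k l : ℕ} (z : Circle) (x : UnitSphere k) (y : UnitSphere l) :
    ((1, -1) : ℤˣ × ℤˣ) • ((z, x, y) : SphereProduct k l) = (-z, x, -y) := rfl

/-- The model with corners (without boundary) of `S¹ × Sᵏ × Sˡ`. -/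
abbrev sphereModel (k l : ℕ) := (𝓡 1).prod ((𝓡 k).prod (𝓡 l))

theorem SphereProduct.contMDiff_smul {k l : ℕ} (ε : ℤˣ × ℤˣ) :
    ContMDiff (sphereModel k l) (sphereModel k l) ∞ (fun p : SphereProduct k l => ε • p) := by
  have h1 : ∀ e : ℤˣ, ContMDiff (𝓡 1) (𝓡 1) ∞ (fun z : Circle => signAct e z) := by
    intro e
    rcases Int.units_eq_one_or e with rfl | rfl
    · exact contMDiff_id
    · have := finrank_real_complex_fact'
      exact contMDiff_neg_sphere (E := ℂ)
  have h2 : ∀ (m : ℕ) (e : ℤˣ), ContMDiff (𝓡 m) (𝓡 m) ∞ (fun z : UnitSphere m => signAct e z) := by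
    intro m e
    rcases Int.units_eq_one_or e with rfl | rfl
    · exact contMDiff_id
    · have := Fact.mk (@finrank_euclideanSpace_fin ℝ _ (m + 1))
      exact contMDiff_neg_sphere (E := EuclideanSpace ℝ (Fin (m + 1)))
  exact ((h1 _).comp contMDiff_fst).prodMk
    (((h2 k _).comp (contMDiff_fst.comp contMDiff_snd)).prodMk
      ((h2 l _).comp (contMDiff_snd.comp contMDiff_snd)))

instance SphereProduct.instContinuousConstSMul (k l : ℕ) :
    ContinuousConstSMul (ℤˣ × ℤˣ) (SphereProduct k l) where
  continuous_const_smul ε := (SphereProduct.contMDiff_smul ε).continuous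

/-- The action is free. -/
instance SphereProduct.instIsCancelSMul (k l : ℕ) :
    IsCancelSMul (ℤˣ × ℤˣ) (SphereProduct k l) where
  right_cancel' ε ε' p h := by
    have hs : ∀ (m : ℕ) (x : UnitSphere m) (a a' : ℤˣ), signAct a x = signAct a' x → a = a' := by
      intro m x a a' hx
      have hne : x ≠ -x := ne_neg_of_mem_unit_sphere ℝ x
      rcases Int.units_eq_one_or a with rfl | rfl <;>
      rcases Int.units_eq_one_or a' with rfl | rfl
      · rfl
      · exact absurd hx hne
      · exact absurd hx.symm hne
      · rfl
    exact Prod.ext (hs k _ _ _ (congrArg (fun q : SphereProduct k l => q.2.1) h))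
      (hs l _ _ _ (congrArg (fun q : SphereProduct k l => q.2.2) h))

/-- The quotient `(S¹ × Sᵏ × Sˡ) / (ℤ₂ × ℤ₂)`, with the quotient topology and the smooth structure
for which the projection is a local diffeomorphism. -/
abbrev SphereQuotient (k l : ℕ) : Type := MulAction.orbitRel.Quotient (ℤˣ × ℤˣ) (SphereProduct k l)

instance SphereQuotient.instIsManifold (k l : ℕ) :
    IsManifold (sphereModel k l) ∞ (SphereQuotient k l) :=
  isManifold_orbitRel_quotient (sphereModel k l) SphereProduct.contMDiff_smul

instance SphereQuotient.instSecondCountableTopology (k l : ℕ) :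
    SecondCountableTopology (SphereQuotient k l) :=
  ContinuousConstSMul.secondCountableTopology

/-- The projection `S¹ × Sᵏ × Sˡ → (S¹ × Sᵏ × Sˡ) / (ℤ₂ × ℤ₂)`. -/
def SphereQuotient.proj {k l : ℕ} (p : SphereProduct k l) : SphereQuotient k l :=
  Quotient.mk (MulAction.orbitRel (ℤˣ × ℤˣ) (SphereProduct k l)) p

/-- The vector `(cos δ · exp(i s sin² δ) x, sin δ · exp(-i s cos² δ) y)` of
`ℂᵏ⁺¹ × ℂˡ⁺¹ = ℂⁿ⁺¹`, where `n = k + l + 1`. -/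
def hopfLift {k l : ℕ} (δ s : ℝ) (x : UnitSphere k) (y : UnitSphere l) :
    EuclideanSpace ℂ (Fin (k + l + 1 + 1)) :=
  WithLp.toLp 2 fun j =>
    Fin.append
      (fun a =>
        (Real.cos δ : ℂ) * Complex.exp (Complex.I * s * (Real.sin δ : ℂ) ^ 2) * (x.1 a : ℂ))
      (fun b =>
        (Real.sin δ : ℂ) * Complex.exp (-Complex.I * s * (Real.cos δ : ℂ) ^ 2) * (y.1 b : ℂ))
      (Fin.cast (by omega : k + l + 1 + 1 = (k + 1) + (l + 1)) j)

theorem hopfLift_ne_zero {k l : ℕ} (δ s : ℝ) (x : UnitSphere k) (y : UnitSphere l) :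
    hopfLift δ s x y ≠ 0 := by
  intro h
  have hx : ∃ a, x.1 a ≠ 0 := by
    by_contra! hx
    exact ne_zero_of_mem_unit_sphere x (by ext a; simpa using hx a)
  have hy : ∃ b, y.1 b ≠ 0 := by
    by_contra! hy
    exact ne_zero_of_mem_unit_sphere y (by ext b; simpa using hy b)
  obtain ⟨a, ha⟩ := hx
  obtain ⟨b, hb⟩ := hy
  have h1 := congrArg (fun v : EuclideanSpace ℂ (Fin (k + l + 1 + 1)) =>
    v (Fin.cast (by omega) (Fin.castAdd (l + 1) a))) h
  have h2 := congrArg (fun v : EuclideanSpace ℂ (Fin (k + l + 1 + 1)) =>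
    v (Fin.cast (by omega) (Fin.natAdd (k + 1) b))) h
  simp [hopfLift, ha, hb, Complex.exp_ne_zero] at h1 h2
  have := Complex.cos_sq_add_sin_sq (δ : ℂ)
  simp [h1, h2] at this

end TheQuotient

noncomputable section HomogeneousCoordinates

variable {n : ℕ}

/-- The point `[z]` of `ℂPⁿ` with homogeneous coordinates `z ≠ 0` (and a junk point for `z = 0`). -/
def CP.ofVec (z : EuclideanSpace ℂ (Fin (n + 1))) : CP n :=
  if h : z ≠ 0 then Projectivization.mk ℂ z h
  else Projectivization.mk ℂ (CP.affineVec 0 0) (CP.affineVec_ne_zero 0 0)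

theorem CP.ofVec_of_ne {z : EuclideanSpace ℂ (Fin (n + 1))} (h : z ≠ 0) :
    CP.ofVec z = Projectivization.mk ℂ z h := dif_pos h

theorem CP.ofVec_smul {z : EuclideanSpace ℂ (Fin (n + 1))} {c : ℂ} (hc : c ≠ 0) :
    CP.ofVec (c • z) = CP.ofVec z := by
  by_cases hz : z = 0
  · simp [hz]
  · rw [CP.ofVec_of_ne hz, CP.ofVec_of_ne (smul_ne_zero hc hz), Projectivization.mk_eq_mk_iff']
    exact ⟨c, rfl⟩

theorem CP.ofVec_eq_iff {z w : EuclideanSpace ℂ (Fin (n + 1))} (hz : z ≠ 0) (hw : w ≠ 0) :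
    CP.ofVec z = CP.ofVec w ↔ ∃ c : ℂ, c • w = z := by
  rw [CP.ofVec_of_ne hz, CP.ofVec_of_ne hw, Projectivization.mk_eq_mk_iff']

/-- The affine coordinates of `[z]` as a function of `z`. -/
def CP.affineOfVec (i : Fin (n + 1)) (z : EuclideanSpace ℂ (Fin (n + 1))) :
    EuclideanSpace ℂ (Fin n) :=
  WithLp.toLp 2 (fun j => z (i.succAbove j) / z i)

theorem CP.affineCoord_ofVec (i : Fin (n + 1)) {z : EuclideanSpace ℂ (Fin (n + 1))} (hz : z ≠ 0) :
    CP.affineCoord i (CP.ofVec z) = CP.affineOfVec i z := by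
  rw [CP.ofVec_of_ne hz, CP.affineCoord_mk]; rfl

theorem CP.ofVec_mem_affineSource (i : Fin (n + 1)) {z : EuclideanSpace ℂ (Fin (n + 1))}
    (hz : z ≠ 0) : CP.ofVec z ∈ CP.affineSource i ↔ z i ≠ 0 := by
  rw [CP.ofVec_of_ne hz, CP.mk_mem_affineSource]

theorem CP.ofVec_affineVec (i : Fin (n + 1)) {p : CP n} (hp : p ∈ CP.affineSource i) :
    CP.ofVec (CP.affineVec i (CP.affineCoord i p)) = p := by
  rw [CP.ofVec_of_ne (CP.affineVec_ne_zero i _)]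
  exact (CP.affineChart i).left_inv hp

theorem CP.ofVec_eq_affine {i : Fin (n + 1)} {z : EuclideanSpace ℂ (Fin (n + 1))} (hz : z i ≠ 0) :
    z = z i • CP.affineVec i (CP.affineOfVec i z) := by
  ext k
  refine Fin.succAboveCases i ?_ (fun j => ?_) k
  · simp [CP.affineVec_same]
  · simp [CP.affineVec_succAbove, CP.affineOfVec, mul_div_cancel₀, hz]

theorem CP.contDiffAt_affineOfVec {i : Fin (n + 1)} {z : EuclideanSpace ℂ (Fin (n + 1))}
    (hz : z i ≠ 0) : ContDiffAt ℝ ∞ (CP.affineOfVec i) z := by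
  rw [contDiffAt_piLp]
  intro j
  have hc : ∀ l, ContDiff ℝ ∞ (fun w : EuclideanSpace ℂ (Fin (n + 1)) => w l) := fun l =>
    ((EuclideanSpace.proj (𝕜 := ℂ) l).restrictScalars ℝ).contDiff
  simp only [CP.affineOfVec, div_eq_mul_inv]
  exact (hc _).contDiffAt.mul ((hc _).contDiffAt.inv hz)

theorem CP.fderiv_affineOfVec_apply {i : Fin (n + 1)} {z : EuclideanSpace ℂ (Fin (n + 1))}
    (hz : z i ≠ 0) (a : EuclideanSpace ℂ (Fin (n + 1))) (j : Fin n) :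
    fderiv ℝ (CP.affineOfVec i) z a j =
      (a (i.succAbove j) * z i - z (i.succAbove j) * a i) / z i ^ 2 := by
  have h1 := ((CP.contDiffAt_affineOfVec hz).differentiableAt (by simp)).hasFDerivAt
  have hl : HasDerivAt (fun r : ℝ => z + r • a) a 0 := by
    simpa using ((hasDerivAt_id (0 : ℝ)).smul_const a).const_add z
  have h2 : HasDerivAt (fun r : ℝ => CP.affineOfVec i (z + r • a))
      (fderiv ℝ (CP.affineOfVec i) z a) 0 :=
    HasFDerivAt.comp_hasDerivAt_of_eq (f := fun r : ℝ => z + r • a) 0 h1 hl (by simp)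
  have hp : ∀ l, HasDerivAt (fun r : ℝ => (z + r • a) l) (a l) 0 := fun l =>
    ((EuclideanSpace.proj (𝕜 := ℂ) l).restrictScalars ℝ :
      EuclideanSpace ℂ (Fin (n + 1)) →L[ℝ] ℂ).hasFDerivAt.comp_hasDerivAt 0 hl
  have h3 : HasDerivAt (fun r : ℝ => CP.affineOfVec i (z + r • a) j)
      (fderiv ℝ (CP.affineOfVec i) z a j) 0 :=
    ((EuclideanSpace.proj (𝕜 := ℂ) j).restrictScalars ℝ :
      EuclideanSpace ℂ (Fin n) →L[ℝ] ℂ).hasFDerivAt.comp_hasDerivAt 0 h2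
  have h4 := (hp (i.succAbove j)).div (hp i) (by simpa using hz)
  simpa using h3.unique h4

theorem CP.continuousAt_ofVec {z : EuclideanSpace ℂ (Fin (n + 1))} (hz : z ≠ 0) :
    ContinuousAt CP.ofVec z := by
  have ho : IsOpen {v : EuclideanSpace ℂ (Fin (n + 1)) | v ≠ 0} := isOpen_ne
  refine ContinuousOn.continuousAt (s := {v | v ≠ 0}) ?_ (ho.mem_nhds hz)
  rw [continuousOn_iff_continuous_domRestrict]
  have : Set.domRestrict {v : EuclideanSpace ℂ (Fin (n + 1)) | v ≠ 0} CP.ofVec =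
      fun v : {v : EuclideanSpace ℂ (Fin (n + 1)) // v ≠ 0} => Projectivization.mk ℂ v.1 v.2 := by
    funext v
    exact CP.ofVec_of_ne v.2
  rw [this]
  exact CP.continuous_mk

/-- The index of the affine chart at `p`. -/
def CP.chartIndex (p : CP n) : Fin (n + 1) := (CP.exists_mem_affineSource p).choose

theorem CP.mem_affineSource_chartIndex (p : CP n) : p ∈ CP.affineSource (CP.chartIndex p) :=
  (CP.exists_mem_affineSource p).choose_spec

theorem CP.apply_chartIndex_ofVec {z : EuclideanSpace ℂ (Fin (n + 1))} (hz : z ≠ 0) :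
    z (CP.chartIndex (CP.ofVec z)) ≠ 0 :=
  (CP.ofVec_mem_affineSource _ hz).1 (CP.mem_affineSource_chartIndex _)

theorem CP.eventually_extChartAt_ofVec {z : EuclideanSpace ℂ (Fin (n + 1))} (hz : z ≠ 0) :
    (fun v => extChartAt 𝓘(ℝ, EuclideanSpace ℂ (Fin n)) (CP.ofVec z) (CP.ofVec v)) =ᶠ[𝓝 z]
      CP.affineOfVec (CP.chartIndex (CP.ofVec z)) := by
  filter_upwards [isOpen_ne.mem_nhds hz] with v hv
  rw [← CP.affineCoord_ofVec _ hv]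
  rfl

theorem CP.contMDiffAt_ofVec {z : EuclideanSpace ℂ (Fin (n + 1))} (hz : z ≠ 0) :
    ContMDiffAt 𝓘(ℝ, EuclideanSpace ℂ (Fin (n + 1))) 𝓘(ℝ, EuclideanSpace ℂ (Fin n)) ∞
      CP.ofVec z := by
  rw [contMDiffAt_iff_target]
  refine ⟨CP.continuousAt_ofVec hz, contMDiffAt_iff_contDiffAt.2 ?_⟩
  exact (CP.contDiffAt_affineOfVec (CP.apply_chartIndex_ofVec hz)).congr_of_eventuallyEq
    (CP.eventually_extChartAt_ofVec hz)

/-- The differential of `z ↦ [z]`, in the affine chart at `[z]`. -/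
def CP.dofVec (z : EuclideanSpace ℂ (Fin (n + 1))) :
    EuclideanSpace ℂ (Fin (n + 1)) →L[ℝ] EuclideanSpace ℂ (Fin n) :=
  fderiv ℝ (CP.affineOfVec (CP.chartIndex (CP.ofVec z))) z

theorem CP.hasMFDerivAt_ofVec {z : EuclideanSpace ℂ (Fin (n + 1))} (hz : z ≠ 0) :
    HasMFDerivAt 𝓘(ℝ, EuclideanSpace ℂ (Fin (n + 1))) 𝓘(ℝ, EuclideanSpace ℂ (Fin n))
      CP.ofVec z (CP.dofVec z) := by
  refine ⟨CP.continuousAt_ofVec hz, ?_⟩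
  have h := ((CP.contDiffAt_affineOfVec (CP.apply_chartIndex_ofVec hz)).differentiableAt
    (by simp)).hasFDerivAt.congr_of_eventuallyEq (CP.eventually_extChartAt_ofVec hz)
  exact h.hasFDerivWithinAt

/-- The Hermitian form on `ℂⁿ⁺¹` whose real part is the pull-back of the Fubini–Study metric by
`z ↦ [z]`. -/
def hopfForm (z a b : EuclideanSpace ℂ (Fin (n + 1))) : ℂ :=
  (inner ℂ a b * ((‖z‖ ^ 2 : ℝ) : ℂ) - inner ℂ a z * inner ℂ z b) / ((‖z‖ ^ 2 : ℝ) : ℂ) ^ 2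

theorem hopfForm_affine (i : Fin (n + 1)) (w u v : EuclideanSpace ℂ (Fin n)) :
    hopfForm (CP.affineVec i w) (CP.affineVec i u - CP.affineVec i 0)
      (CP.affineVec i v - CP.affineVec i 0) =
      (inner ℂ u v * ((1 + ‖w‖ ^ 2 : ℝ) : ℂ) - inner ℂ u w * inner ℂ w v) /
        ((1 + ‖w‖ ^ 2 : ℝ) : ℂ) ^ 2 := by
  have h1 : ‖CP.affineVec i w‖ ^ 2 = 1 + ‖w‖ ^ 2 := by
    simp [EuclideanSpace.norm_sq_eq, Fin.sum_univ_succAbove _ i, CP.affineVec_same,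
      CP.affineVec_succAbove]
  simp only [hopfForm, h1]
  have h0 : CP.affineVec i (0 : EuclideanSpace ℂ (Fin n)) = EuclideanSpace.single i 1 := by
    ext k
    refine Fin.succAboveCases i ?_ (fun j => ?_) k <;>
    simp [CP.affineVec_same, CP.affineVec_succAbove]
  congr 2 <;> [congr 1; congr 1] <;>
  simp [h0, PiLp.inner_apply, Fin.sum_univ_succAbove _ i, CP.affineVec_same, CP.affineVec_succAbove]

theorem hopfForm_smul_add {z : EuclideanSpace ℂ (Fin (n + 1))} (hz : z ≠ 0)
    (a b : EuclideanSpace ℂ (Fin (n + 1))) {c : ℂ} (hc : c ≠ 0) (α β : ℂ) :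
    hopfForm (c • z) (c • a + α • z) (c • b + β • z) = hopfForm z a b := by
  have hz' : (‖z‖ : ℂ) ≠ 0 := by simpa using hz
  have hcc : (‖c‖ : ℂ) ≠ 0 := by simpa using hc
  have hzz : inner ℂ z z = (‖z‖ : ℂ) ^ 2 := inner_self_eq_norm_sq_to_K z
  have h2 : (starRingEnd ℂ) c * c = (‖c‖ : ℂ) ^ 2 := by
    rw [mul_comm, Complex.mul_conj, Complex.normSq_eq_norm_sq]; push_cast; rfl
  simp only [hopfForm, inner_add_left, inner_add_right, inner_smul_left, inner_smul_right, hzz,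
    norm_smul, mul_pow]
  push_cast
  rw [div_eq_div_iff (by positivity) (by positivity)]
  simp only [← h2]
  ring

theorem CP.dofVec_eq {z : EuclideanSpace ℂ (Fin (n + 1))} (hz : z ≠ 0)
    (a : EuclideanSpace ℂ (Fin (n + 1))) :
    CP.affineVec (CP.chartIndex (CP.ofVec z)) (CP.dofVec z a) -
      CP.affineVec (CP.chartIndex (CP.ofVec z)) 0 =
    (z (CP.chartIndex (CP.ofVec z)))⁻¹ • a +
      (-a (CP.chartIndex (CP.ofVec z)) / z (CP.chartIndex (CP.ofVec z)) ^ 2) • z := by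
  have h := CP.apply_chartIndex_ofVec hz
  ext k
  refine Fin.succAboveCases (CP.chartIndex (CP.ofVec z)) ?_ (fun j => ?_) k
  · simp [CP.affineVec_same]; field_simp; ring
  · simp [CP.affineVec_succAbove, CP.dofVec, CP.fderiv_affineOfVec_apply h]; field_simp; ring

theorem CP.chartAt_ofVec {z : EuclideanSpace ℂ (Fin (n + 1))} (hz : z ≠ 0) :
    chartAt (EuclideanSpace ℂ (Fin n)) (CP.ofVec z) (CP.ofVec z) =
      CP.affineOfVec (CP.chartIndex (CP.ofVec z)) z :=
  CP.affineCoord_ofVec _ hz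

theorem fubiniStudy_dofVec {z : EuclideanSpace ℂ (Fin (n + 1))} (hz : z ≠ 0)
    (a b : EuclideanSpace ℂ (Fin (n + 1))) :
    fubiniStudy (CP.ofVec z) (CP.dofVec z a) (CP.dofVec z b) = (hopfForm z a b).re := by
  have h := CP.apply_chartIndex_ofVec hz
  rw [← hopfForm_smul_add hz a b (inv_ne_zero h)
    (-a (CP.chartIndex (CP.ofVec z)) / z (CP.chartIndex (CP.ofVec z)) ^ 2)
    (-b (CP.chartIndex (CP.ofVec z)) / z (CP.chartIndex (CP.ofVec z)) ^ 2),
    ← CP.dofVec_eq hz, ← CP.dofVec_eq hz]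
  have hz2 : (z (CP.chartIndex (CP.ofVec z)))⁻¹ • z =
      CP.affineVec (CP.chartIndex (CP.ofVec z))
        (chartAt (EuclideanSpace ℂ (Fin n)) (CP.ofVec z) (CP.ofVec z)) := by
    rw [CP.chartAt_ofVec hz]
    conv_rhs => rw [← one_smul ℂ (CP.affineVec _ _), ← inv_mul_cancel₀ h, ← smul_smul,
      ← CP.ofVec_eq_affine h]
  rw [hz2, hopfForm_affine]
  set w := chartAt (EuclideanSpace ℂ (Fin n)) (CP.ofVec z) (CP.ofVec z) with hw
  change ((1 + ‖w‖ ^ 2) * (inner ℂ (CP.dofVec z a) (CP.dofVec z b)).re -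
    (inner ℂ (CP.dofVec z a) w * inner ℂ w (CP.dofVec z b)).re) / (1 + ‖w‖ ^ 2) ^ 2 = _
  rw [← Complex.ofReal_pow, Complex.div_ofReal_re, Complex.sub_re, Complex.re_mul_ofReal,
    mul_comm (1 + ‖w‖ ^ 2)]

theorem complexStructure_dofVec {z : EuclideanSpace ℂ (Fin (n + 1))} (hz : z ≠ 0)
    (a : EuclideanSpace ℂ (Fin (n + 1))) :
    complexStructure (p := CP.ofVec z) (CP.dofVec z a) = CP.dofVec z (Complex.I • a) := by
  have h := CP.apply_chartIndex_ofVec hz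
  change (Complex.I • CP.dofVec z a : EuclideanSpace ℂ (Fin n)) = _
  ext j
  simp only [CP.dofVec, PiLp.smul_apply, CP.fderiv_affineOfVec_apply h, smul_eq_mul]
  ring

instance CP.instT2Space : T2Space (CP n) := by
  let φ : CP n → Fin (n + 1) → Fin (n + 1) → ℂ := fun p i j =>
    p.rep i * (starRingEnd ℂ) (p.rep j) / ((‖p.rep‖ ^ 2 : ℝ) : ℂ)
  have hφ : ∀ z : EuclideanSpace ℂ (Fin (n + 1)), ∀ hz : z ≠ 0, φ (Projectivization.mk ℂ z hz) =
      fun i j => z i * (starRingEnd ℂ) (z j) / ((‖z‖ ^ 2 : ℝ) : ℂ) := by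
    intro z hz
    funext i j
    obtain ⟨a, ha⟩ := Projectivization.exists_smul_eq_mk_rep ℂ z hz
    simp only [φ, ← ha]
    have hz' : (‖z‖ : ℂ) ≠ 0 := by simpa using hz
    have hcc : (‖(a : ℂ)‖ : ℂ) ≠ 0 := by simp
    have h2 : (a : ℂ) * (starRingEnd ℂ) (a : ℂ) = (‖(a : ℂ)‖ : ℂ) ^ 2 := by
      rw [Complex.mul_conj, Complex.normSq_eq_norm_sq]; push_cast; rfl
    simp only [Units.smul_def, PiLp.smul_apply, smul_eq_mul, map_mul, norm_smul, mul_pow]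
    push_cast
    rw [div_eq_div_iff (by positivity) (by positivity), ← h2]
    ring
  have hc : Continuous φ := by
    rw [CP.isQuotientMap_mk.continuous_iff]
    have : (φ ∘ fun v : {v : EuclideanSpace ℂ (Fin (n + 1)) // v ≠ 0} =>
        Projectivization.mk ℂ v.1 v.2) =
        fun v i j => v.1 i * (starRingEnd ℂ) (v.1 j) / ((‖v.1‖ ^ 2 : ℝ) : ℂ) := by
      funext v
      exact hφ v.1 v.2
    rw [this]
    refine continuous_pi fun i => continuous_pi fun j => ?_
    refine Continuous.div ?_ ?_ ?_
    · have := Complex.continuous_conj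
      fun_prop
    · fun_prop
    · intro v
      have := v.2
      simpa using this
  refine T2Space.of_injective_continuous (f := φ) ?_ hc
  intro p q hpq
  induction p using Projectivization.ind with
  | h v hv =>
  induction q using Projectivization.ind with
  | h w hw =>
  rw [hφ, hφ] at hpq
  obtain ⟨j, hj⟩ : ∃ j, v j ≠ 0 := by
    by_contra! h
    exact hv (by ext j; simpa using h j)
  rw [Projectivization.mk_eq_mk_iff']
  have hv' : (‖v‖ : ℂ) ≠ 0 := by simpa using hv
  refine ⟨(starRingEnd ℂ) (w j) / ((‖w‖ ^ 2 : ℝ) : ℂ) * ((‖v‖ ^ 2 : ℝ) : ℂ) /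
    (starRingEnd ℂ) (v j), ?_⟩
  ext i
  have h1 := congrFun (congrFun hpq i) j
  have hj' : (starRingEnd ℂ) (v j) ≠ 0 := by simpa using hj
  have hv2 : ((‖v‖ ^ 2 : ℝ) : ℂ) ≠ 0 := by push_cast; positivity
  have h3 : v i = v i * (starRingEnd ℂ) (v j) / ((‖v‖ ^ 2 : ℝ) : ℂ) * ((‖v‖ ^ 2 : ℝ) : ℂ) /
    (starRingEnd ℂ) (v j) := by field_simp
  rw [h3]
  simp only at h1
  rw [h1]
  simp only [PiLp.smul_apply, smul_eq_mul]
  ring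

end HomogeneousCoordinates

noncomputable section VolumeDensity

variable {E : Type*} [NormedAddCommGroup E] [NormedSpace ℝ E] [FiniteDimensional ℝ E]
  {H : Type*} [TopologicalSpace H] (I : ModelWithCorners ℝ E H)
  {M : Type*} [TopologicalSpace M] [ChartedSpace H M]

/-- The determinant of the Gram matrix of a family of vectors with respect to a bilinear form. -/
def gramDet {F ι : Type*} [AddCommGroup F] [Module ℝ F] [Fintype ι] [DecidableEq ι]
    (B : LinearMap.BilinForm ℝ F) (v : ι → F) : ℝ :=
  (Matrix.of fun i j => B (v i) (v j)).det

theorem gramDet_basis {ι κ : Type*} [Fintype ι] [DecidableEq ι] [Fintype κ] [DecidableEq κ]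
    (b : Module.Basis ι ℝ E) (b' : Module.Basis κ ℝ E) :
    ∃ c : ℝ, c ≠ 0 ∧ ∀ B : LinearMap.BilinForm ℝ E, gramDet B b' = c ^ 2 * gramDet B b := by
  let σ : κ ≃ ι := b'.indexEquiv b
  let L : E →ₗ[ℝ] E := (b.equiv (b'.reindex σ) (Equiv.refl ι)).toLinearMap
  refine ⟨LinearMap.det L, (LinearEquiv.isUnit_det' _).ne_zero, fun B => ?_⟩
  have h1 : gramDet B b' = (LinearMap.BilinForm.toMatrix b (B.comp L L)).det := by
    rw [gramDet, ← Matrix.det_submatrix_equiv_self σ]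
    congr 1
    ext i j
    simp [LinearMap.BilinForm.toMatrix_apply, L]
  have h2 : gramDet B b = (LinearMap.BilinForm.toMatrix b B).det := by
    rw [gramDet]
    congr 1
    ext i j
    simp [LinearMap.BilinForm.toMatrix_apply]
  rw [h1, h2, LinearMap.BilinForm.toMatrix_comp b b, Matrix.det_mul, Matrix.det_mul,
    Matrix.det_transpose, LinearMap.det_toMatrix]
  ring

/-- The bilinear form `h p`, regarded as a form on the model vector space. -/
def metricAt (h : ∀ p : M, LinearMap.BilinForm ℝ (TangentSpace I p)) (p : M) :
    LinearMap.BilinForm ℝ E := h p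

/-- The square of the density of the Riemannian volume of `h'` with respect to the one of `h`. -/
def volumeRatio (h h' : ∀ p : M, LinearMap.BilinForm ℝ (TangentSpace I p)) (p : M) : ℝ :=
  gramDet (metricAt I h' p) (Module.finBasis ℝ E) / gramDet (metricAt I h p) (Module.finBasis ℝ E)

theorem volumeRatio_eq {κ : Type*} [Fintype κ] [DecidableEq κ]
    (h h' : ∀ p : M, LinearMap.BilinForm ℝ (TangentSpace I p)) (p : M)
    (b : Module.Basis κ ℝ E) :
    volumeRatio I h h' p = gramDet (metricAt I h' p) b / gramDet (metricAt I h p) b := by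
  obtain ⟨c, hc, hB⟩ := gramDet_basis (Module.finBasis ℝ E) b
  rw [volumeRatio, hB, hB, mul_div_mul_left _ _ (pow_ne_zero 2 hc)]

theorem exists_chartGram_det_eq [IsManifold I ∞ M] [I.Boundaryless]
    {e : OpenPartialHomeomorph M H} (he : e ∈ IsManifold.maximalAtlas I ∞ M) {y : E}
    (hy : y ∈ (e.extend I).target) :
    ∃ c : ℝ, c ≠ 0 ∧ ∀ h : ∀ p : M, LinearMap.BilinForm ℝ (TangentSpace I p),
      (chartGram I h e y).det =
        c ^ 2 * gramDet (metricAt I h ((e.extend I).symm y)) (Module.finBasis ℝ E) := by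
  let L : E →L[ℝ] E := mfderiv 𝓘(ℝ, E) I (e.extend I).symm y
  have hσ : MDifferentiableAt 𝓘(ℝ, E) I (e.extend I).symm y := by
    have h1 := contMDiffOn_extend_symm (I := I) he
    rw [← e.extend_target'] at h1
    exact (h1.contMDiffAt ((e.isOpen_extend_target (I := I)).mem_nhds hy)).mdifferentiableAt
      (by simp)
  have hx : (e.extend I).symm y ∈ e.source := by
    rw [← e.extend_source (I := I)]; exact (e.extend I).map_target hy
  have hτ : MDifferentiableAt I 𝓘(ℝ, E) (e.extend I) ((e.extend I).symm y) :=
    (e.contMDiffAt_extend he hx).mdifferentiableAt (by simp)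
  let L' : E →L[ℝ] E := mfderiv I 𝓘(ℝ, E) (e.extend I) ((e.extend I).symm y)
  have hc : L'.comp L = ContinuousLinearMap.id ℝ E := by
    have h1 := mfderiv_comp y hτ hσ
    have h2 : (e.extend I) ∘ (e.extend I).symm =ᶠ[𝓝 y] id := by
      filter_upwards [(e.isOpen_extend_target (I := I)).mem_nhds hy] with z hz
      exact (e.extend I).right_inv hz
    rw [h2.mfderiv_eq, mfderiv_id] at h1
    exact h1.symm
  refine ⟨L.det, ?_, fun h => ?_⟩
  · intro h0
    have h3 := congrArg (fun f : E →L[ℝ] E => LinearMap.det (f : E →ₗ[ℝ] E)) hc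
    simp only [ContinuousLinearMap.toLinearMap_comp, LinearMap.det_comp] at h3
    have h4 : LinearMap.det (L : E →ₗ[ℝ] E) = 0 := h0
    rw [h4] at h3
    simp at h3
  · exact gram_det_comp (metricAt I h ((e.extend I).symm y)) (ContinuousLinearMap.id ℝ E) L

theorem volumeRatio_eq_chartGram [IsManifold I ∞ M] [I.Boundaryless]
    {e : OpenPartialHomeomorph M H} (he : e ∈ IsManifold.maximalAtlas I ∞ M) {p : M}
    (hp : p ∈ e.source) (h h' : ∀ p : M, LinearMap.BilinForm ℝ (TangentSpace I p)) :
    volumeRatio I h h' p =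
      (chartGram I h' e (e.extend I p)).det / (chartGram I h e (e.extend I p)).det := by
  have hy : e.extend I p ∈ (e.extend I).target :=
    (e.extend I).map_source (by rwa [e.extend_source])
  obtain ⟨c, hc, hB⟩ := exists_chartGram_det_eq I he hy
  rw [hB, hB, mul_div_mul_left _ _ (pow_ne_zero 2 hc), e.extend_left_inv hp]
  rfl

section RiemannianMeasure

variable [MeasurableSpace M] [BorelSpace M] [MeasurableSpace E] [BorelSpace E]
  [IsManifold I ∞ M] [I.Boundaryless]

theorem IsRiemannianVolume.ext [SecondCountableTopology M]
    {h : ∀ p : M, LinearMap.BilinForm ℝ (TangentSpace I p)} {μ ν : Measure M}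
    (hμ : IsRiemannianVolume I h μ) (hν : IsRiemannianVolume I h ν) : μ = ν := by
  obtain ⟨S, hSc, hSu⟩ := TopologicalSpace.isOpen_iUnion_countable
    (fun x : M => (chartAt H x).source) (fun x => (chartAt H x).open_source)
  refine Measure.ext_of_biUnion_eq_univ (s := fun x : M => (chartAt H x).source) hSc
    (by rw [hSu]; exact eq_univ_of_forall fun x => mem_iUnion.2 ⟨x, mem_chart_source H x⟩) ?_
  intro x _
  refine Measure.ext fun A hA => ?_
  have hm : MeasurableSet (A ∩ (chartAt H x).source) :=
    hA.inter (chartAt H x).open_source.measurableSet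
  rw [Measure.restrict_apply hA, Measure.restrict_apply hA,
    hμ _ (IsManifold.chart_mem_maximalAtlas x) _ inter_subset_right hm,
    hν _ (IsManifold.chart_mem_maximalAtlas x) _ inter_subset_right hm]

omit [IsManifold I ∞ M] in
theorem IsRiemannianVolume.restrict_source
    {h : ∀ p : M, LinearMap.BilinForm ℝ (TangentSpace I p)} {μ : Measure M}
    (hμ : IsRiemannianVolume I h μ) {e : OpenPartialHomeomorph M H}
    (he : e ∈ IsManifold.maximalAtlas I ∞ M) :
    μ.restrict e.source =
      (((Module.finBasis ℝ E).addHaar.restrict (e.extend I).target).withDensity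
        fun y => ENNReal.ofReal √((chartGram I h e y).det)).map (e.extend I).symm := by
  have ho : MeasurableSet (e.extend I).target := (e.isOpen_extend_target (I := I)).measurableSet
  have hσ : AEMeasurable (e.extend I).symm
      ((Module.finBasis ℝ E).addHaar.restrict (e.extend I).target) :=
    (e.continuousOn_extend_symm (I := I)).aemeasurable ho
  refine Measure.ext fun A hA => ?_
  rw [Measure.restrict_apply hA, Measure.map_apply_of_aemeasurable
    (hσ.mono_ac (withDensity_absolutelyContinuous _ _)) hA, withDensity_apply',
    hμ e he _ inter_subset_right (hA.inter e.open_source.measurableSet),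
    Measure.restrict_restrict' ho]
  congr 2
  rw [(e.extend I).image_eq_target_inter_inv_preimage
    (inter_subset_right.trans (by rw [e.extend_source])), inter_comm]
  ext y
  simp only [mem_inter_iff, mem_preimage, and_congr_left_iff, and_iff_left_iff_imp]
  intro hy _
  rw [← e.extend_source (I := I)]
  exact (e.extend I).map_target hy

omit [IsManifold I ∞ M] in
theorem IsRiemannianVolume.setLIntegral
    {h : ∀ p : M, LinearMap.BilinForm ℝ (TangentSpace I p)} {μ : Measure M}
    (hμ : IsRiemannianVolume I h μ) {e : OpenPartialHomeomorph M H}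
    (he : e ∈ IsManifold.maximalAtlas I ∞ M)
    (hc : ContinuousOn (fun y => (chartGram I h e y).det) (e.extend I).target)
    {g : M → ENNReal} (hg : Measurable g) {A : Set M} (hA : MeasurableSet A)
    (hAe : A ⊆ e.source) :
    ∫⁻ p in A, g p ∂μ = ∫⁻ y in e.extend I '' A,
      ENNReal.ofReal √((chartGram I h e y).det) * g ((e.extend I).symm y)
        ∂(Module.finBasis ℝ E).addHaar := by
  have ho : MeasurableSet (e.extend I).target := (e.isOpen_extend_target (I := I)).measurableSet
  have hσ : AEMeasurable (e.extend I).symm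
      ((Module.finBasis ℝ E).addHaar.restrict (e.extend I).target) :=
    (e.continuousOn_extend_symm (I := I)).aemeasurable ho
  have hw : AEMeasurable (fun y => ENNReal.ofReal √((chartGram I h e y).det))
      ((Module.finBasis ℝ E).addHaar.restrict (e.extend I).target) :=
    (ENNReal.continuous_ofReal.comp_continuousOn
      (Real.continuous_sqrt.comp_continuousOn hc)).aemeasurable ho
  have hσ' := hσ.mono_ac (withDensity_absolutelyContinuous
    ((Module.finBasis ℝ E).addHaar.restrict (e.extend I).target)
    (fun y => ENNReal.ofReal √((chartGram I h e y).det)))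
  have him : e.extend I '' A = (e.extend I).symm ⁻¹' A ∩ (e.extend I).target := by
    rw [(e.extend I).image_eq_target_inter_inv_preimage (by rwa [e.extend_source]), inter_comm]
  rw [← Measure.restrict_restrict_of_subset hAe, hμ.restrict_source I he,
    ← lintegral_indicator hA, lintegral_map' (hg.indicator hA).aemeasurable hσ',
    lintegral_withDensity_eq_lintegral_mul₀ (g := fun y => A.indicator g ((e.extend I).symm y)) hw
      ((hg.indicator hA).comp_aemeasurable hσ),
    him, ← Measure.restrict_restrict' ho, ← lintegral_indicator₀ (hσ.nullMeasurableSet_preimage hA)]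
  refine lintegral_congr fun y => ?_
  by_cases hy : (e.extend I).symm y ∈ A
  · rw [Pi.mul_apply, indicator_of_mem hy, indicator_of_mem (mem_preimage.2 hy)]
  · rw [Pi.mul_apply, indicator_of_notMem hy, indicator_of_notMem (by exact hy), mul_zero]

omit [IsManifold I ∞ M] in
/-- If `chartGram` of `h` is continuous and positive, then the Riemannian volume of `h'` has the
density `√ (volumeRatio h h')` with respect to the one of `h`. -/
theorem IsRiemannianVolume.withDensity [IsManifold I ∞ M]
    {h h' : ∀ p : M, LinearMap.BilinForm ℝ (TangentSpace I p)} {μ : Measure M}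
    (hμ : IsRiemannianVolume I h μ)
    (hc : ∀ e ∈ IsManifold.maximalAtlas I ∞ M,
      ContinuousOn (fun y => (chartGram I h e y).det) (e.extend I).target)
    (hpos : ∀ e ∈ IsManifold.maximalAtlas I ∞ M, ∀ y ∈ (e.extend I).target,
      0 < (chartGram I h e y).det)
    (hm : Measurable fun p => ENNReal.ofReal √(volumeRatio I h h' p)) :
    IsRiemannianVolume I h' (μ.withDensity fun p => ENNReal.ofReal √(volumeRatio I h h' p)) := by
  intro e he A hAe hA
  rw [withDensity_apply _ hA, hμ.setLIntegral I he (hc e he) hm hA hAe]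
  refine setLIntegral_congr_fun (measurableSet_chart_image I e hA hAe) ?_
  rintro _ ⟨p, hp, rfl⟩
  have hpos' := hpos e he (e.extend I p) ((e.extend I).map_source
    (by rw [e.extend_source]; exact hAe hp))
  simp only
  rw [e.extend_left_inv (hAe hp), volumeRatio_eq_chartGram I he (hAe hp),
    ← ENNReal.ofReal_mul (Real.sqrt_nonneg _), ← Real.sqrt_mul hpos'.le, mul_div_cancel₀ _ hpos'.ne']

theorem IsRiemannianVolume.isFiniteMeasure [CompactSpace M]
    {h : ∀ p : M, LinearMap.BilinForm ℝ (TangentSpace I p)} {μ : Measure M}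
    (hμ : IsRiemannianVolume I h μ)
    (hc : ∀ e ∈ IsManifold.maximalAtlas I ∞ M,
      ContinuousOn (fun y => (chartGram I h e y).det) (e.extend I).target) :
    IsFiniteMeasure μ := by
  have hloc : ∀ x ∈ (univ : Set M), μ.FiniteAtFilter (𝓝[univ] x) := by
    intro x _
    rw [nhdsWithin_univ]
    set e := chartAt H x
    have he : e ∈ IsManifold.maximalAtlas I ∞ M := IsManifold.chart_mem_maximalAtlas x
    have hx : x ∈ e.source := mem_chart_source H x
    have hxt : e.extend I x ∈ (e.extend I).target :=
      (e.extend I).map_source (by rwa [e.extend_source])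
    have hcont : ContinuousAt (fun y => ENNReal.ofReal √((chartGram I h e y).det))
        (e.extend I x) :=
      ((ENNReal.continuous_ofReal.comp_continuousOn
        (Real.continuous_sqrt.comp_continuousOn (hc e he))).continuousAt
          ((e.isOpen_extend_target (I := I)).mem_nhds hxt))
    obtain ⟨C, hC⟩ : ∃ C : ENNReal, ENNReal.ofReal √((chartGram I h e (e.extend I x)).det) < C ∧
        C < ⊤ := exists_between ENNReal.ofReal_lt_top
    have h1 : ∀ᶠ y in 𝓝 (e.extend I x), ENNReal.ofReal √((chartGram I h e y).det) < C :=
      hcont.eventually_lt_const hC.1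
    obtain ⟨V, hV, hVo⟩ := (Module.finBasis ℝ E).addHaar.finiteAt_nhds (e.extend I x)
    obtain ⟨U, hU, hUo, hxU⟩ := mem_nhds_iff.1 (Filter.inter_mem h1 hV)
    have hec : ContinuousOn (e.extend I) e.source := by
      simpa only [e.extend_source] using e.continuousOn_extend (I := I)
    have hUm : IsOpen (e.source ∩ e.extend I ⁻¹' U) := hec.isOpen_inter_preimage e.open_source hUo
    refine ⟨_, hUm.mem_nhds ⟨hx, hxU⟩, ?_⟩
    have him : e.extend I '' (e.source ∩ e.extend I ⁻¹' U) ⊆ U := by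
      rintro _ ⟨z, hz, rfl⟩; exact hz.2
    rw [hμ e he _ inter_subset_left hUm.measurableSet]
    calc _ ≤ ∫⁻ y in U, ENNReal.ofReal √((chartGram I h e y).det)
            ∂(Module.finBasis ℝ E).addHaar := lintegral_mono_set him
      _ ≤ ∫⁻ y in U, C ∂(Module.finBasis ℝ E).addHaar :=
          setLIntegral_mono measurable_const fun y hy => (hU hy).1.le
      _ = C * (Module.finBasis ℝ E).addHaar U := by rw [setLIntegral_const]
      _ < ⊤ := ENNReal.mul_lt_top hC.2
          ((measure_mono (hU.trans inter_subset_right)).trans_lt hVo)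
  exact ⟨isCompact_univ.measure_lt_top_of_nhdsWithin hloc⟩

/-- An isometric diffeomorphism preserves the Riemannian volume. -/
theorem IsRiemannianVolume.map_diffeomorph
    {h : ∀ p : M, LinearMap.BilinForm ℝ (TangentSpace I p)} {μ : Measure M}
    (hμ : IsRiemannianVolume I h μ) (φ : Diffeomorph I I M M ∞)
    (hφ : ∀ (p : M) (u v : E), metricAt I h (φ.symm p) (mfderiv I I φ.symm p u)
      (mfderiv I I φ.symm p v) = metricAt I h p u v) :
    IsRiemannianVolume I h (μ.map φ) := by
  intro e he A hAe hA
  let e' : OpenPartialHomeomorph M H := φ.toHomeomorph.toOpenPartialHomeomorph.trans e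
  have hes : e'.source = φ ⁻¹' e.source := by simp [e']
  have het : e'.target = e.target := by simp [e']
  have he1 : (e' : M → H) = e ∘ φ := rfl
  have he2 : (e'.symm : H → M) = φ.symm ∘ e.symm := rfl
  have he' : e' ∈ IsManifold.maximalAtlas I ∞ M := by
    refine e'.mem_maximalAtlas_of_contMDiffOn ?_ ?_
    · rw [hes, he1]
      exact (contMDiffOn_of_mem_maximalAtlas he).comp φ.contMDiff.contMDiffOn (fun x hx => hx)
    · rw [het, he2]
      exact φ.symm.contMDiff.comp_contMDiffOn (contMDiffOn_symm_of_mem_maximalAtlas he)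
  have hx2 : (e'.extend I).symm = φ.symm ∘ (e.extend I).symm := rfl
  have him : e'.extend I '' (φ ⁻¹' A) = e.extend I '' A := by
    ext y
    constructor
    · rintro ⟨p, hp, rfl⟩
      exact ⟨φ p, hp, rfl⟩
    · rintro ⟨p, hp, rfl⟩
      refine ⟨φ.symm p, by simpa using hp, ?_⟩
      change I (e (φ (φ.symm p))) = I (e p)
      rw [φ.apply_symm_apply]
  rw [Measure.map_apply φ.contMDiff.continuous.measurable hA,
    hμ e' he' _ (by rw [hes]; exact preimage_mono hAe) (φ.contMDiff.continuous.measurable hA), him]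
  refine setLIntegral_congr_fun (measurableSet_chart_image I e hA hAe) ?_
  rintro _ ⟨p, hp, rfl⟩
  simp only
  suffices hG : chartGram I h e' (e.extend I p) = chartGram I h e (e.extend I p) by rw [hG]
  ext i j
  have hσ : MDifferentiableAt 𝓘(ℝ, E) I (e.extend I).symm (e.extend I p) := by
    have h1 := contMDiffOn_extend_symm (I := I) he
    rw [← e.extend_target'] at h1
    exact (h1.contMDiffAt ((e.isOpen_extend_target (I := I)).mem_nhds ((e.extend I).map_source
      (by rw [e.extend_source]; exact hAe hp)))).mdifferentiableAt (by simp)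
  have hc := mfderiv_comp (e.extend I p) (φ.symm.contMDiff.mdifferentiableAt (by simp)) hσ
  rw [← hx2] at hc
  have := hφ ((e.extend I).symm (e.extend I p))
    (mfderiv 𝓘(ℝ, E) I (e.extend I).symm (e.extend I p) (Module.finBasis ℝ E i))
    (mfderiv 𝓘(ℝ, E) I (e.extend I).symm (e.extend I p) (Module.finBasis ℝ E j))
  refine Eq.trans ?_ this
  change metricAt I h _ (mfderiv 𝓘(ℝ, E) I (e'.extend I).symm (e.extend I p) _)
    (mfderiv 𝓘(ℝ, E) I (e'.extend I).symm (e.extend I p) _) = _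
  rw [hc]
  rfl

end RiemannianMeasure

theorem totalVolume_eq [MeasurableSpace E] [BorelSpace E]
    [IsManifold I ∞ M] [I.Boundaryless] [m : MeasurableSpace M] [hm : BorelSpace M]
    [SecondCountableTopology M]
    {h : ∀ p : M, LinearMap.BilinForm ℝ (TangentSpace I p)} {μ : Measure M}
    (hμ : IsRiemannianVolume I h μ) : totalVolume I h = (μ univ).toReal := by
  obtain rfl : m = borel M := hm.measurable_eq
  let m' : MeasurableSpace M := borel M
  rw [totalVolume]
  congr 2
  exact ((exists_isRiemannianVolume I h).choose_spec).ext I hμ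

end VolumeDensity

noncomputable section VolumeVariation

theorem hasDerivAt_det_of_isDiag {ι : Type*} [Fintype ι] [DecidableEq ι]
    {A : ℝ → Matrix ι ι ℝ} {A' : Matrix ι ι ℝ} {t : ℝ} {d : ι → ℝ}
    (hA : ∀ i j, HasDerivAt (fun s => A s i j) (A' i j) t) (hd : A t = Matrix.diagonal d) :
    HasDerivAt (fun s => (A s).det) (∑ i, (∏ j ∈ Finset.univ.erase i, d j) * A' i i) t := by
  simp only [Matrix.det_apply']
  have h1 : ∀ σ : Equiv.Perm ι, HasDerivAt (fun s => (Equiv.Perm.sign σ : ℝ) * ∏ i, A s (σ i) i)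
      ((Equiv.Perm.sign σ : ℝ) *
        ∑ i, (∏ j ∈ Finset.univ.erase i, A t (σ j) j) • A' (σ i) i) t := fun σ =>
    (HasDerivAt.fun_finsetProd fun i _ => hA (σ i) i).const_mul _
  have h2 := HasDerivAt.fun_sum fun (σ : Equiv.Perm ι) (_ : σ ∈ Finset.univ) => h1 σ
  refine h2.congr_deriv (Eq.symm ?_)
  rw [Finset.sum_eq_single (1 : Equiv.Perm ι)]
  · simp [hd]
  · intro σ _ hσ
    obtain ⟨i, hi⟩ : ∃ i, σ i ≠ i := by
      by_contra! h
      exact hσ (Equiv.ext h)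
    have hi' : σ (σ i) ≠ σ i := fun h => hi (σ.injective h)
    rw [Finset.sum_eq_zero, mul_zero]
    intro k _
    rcases ne_or_eq k i with hk | rfl
    · rw [Finset.prod_eq_zero (i := i) (by simp [hk.symm]) (by simp [hd, hi]), zero_smul]
    · rw [Finset.prod_eq_zero (i := σ k) (by simp [hi]) (by simp [hd, hi']), zero_smul]
  · simp

theorem gramDet_of_orthogonal {F ι : Type*} [AddCommGroup F] [Module ℝ F] [Fintype ι]
    [DecidableEq ι] {B : LinearMap.BilinForm ℝ F} {v : ι → F}
    (hv : ∀ i j, i ≠ j → B (v i) (v j) = 0) : gramDet B v = ∏ i, B (v i) (v i) := by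
  rw [gramDet, ← Matrix.det_diagonal]
  congr 1
  ext i j
  rcases eq_or_ne i j with rfl | hij
  · simp
  · simp [hv i j hij, hij]

variable {E : Type*} [NormedAddCommGroup E] [NormedSpace ℝ E] [FiniteDimensional ℝ E]
  {H : Type*} [TopologicalSpace H] (I : ModelWithCorners ℝ E H)
  {M : Type*} [TopologicalSpace M] [ChartedSpace H M]

theorem hasDerivAt_volumeRatio {ι : Type*} [Fintype ι] [DecidableEq ι]
    {h : ℝ → ∀ p : M, LinearMap.BilinForm ℝ (TangentSpace I p)} {p : M}
    (b : Module.Basis ι ℝ E)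
    (hb : ∀ i j, i ≠ j → metricAt I (h 0) p (b i) (b j) = 0)
    (hb' : ∀ i, metricAt I (h 0) p (b i) (b i) ≠ 0)
    (hd : ∀ i j, DifferentiableAt ℝ (fun t => metricAt I (h t) p (b i) (b j)) 0)
    {G' : ι → ℝ} (hG : ∀ i, HasDerivAt (fun t => metricAt I (h t) p (b i) (b i)) (G' i) 0) :
    HasDerivAt (fun t => volumeRatio I (h 0) (h t) p)
      (∑ i, G' i / metricAt I (h 0) p (b i) (b i)) 0 := by
  have hprod := gramDet_of_orthogonal hb
  have hne : ∏ i, metricAt I (h 0) p (b i) (b i) ≠ 0 := Finset.prod_ne_zero_iff.2 fun i _ => hb' i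
  have h1 := hasDerivAt_det_of_isDiag
    (A := fun t => Matrix.of fun i j => metricAt I (h t) p (b i) (b j))
    (A' := Matrix.of fun i j => deriv (fun t => metricAt I (h t) p (b i) (b j)) 0)
    (d := fun i => metricAt I (h 0) p (b i) (b i)) (t := 0)
    (fun i j => (hd i j).hasDerivAt) (by
      ext i j
      rcases eq_or_ne i j with rfl | hij
      · simp
      · simp [hb i j hij, hij])
  have h2 := h1.div_const (∏ i, metricAt I (h 0) p (b i) (b i))
  have h3 : (fun t => volumeRatio I (h 0) (h t) p) = fun t =>
      (Matrix.of fun i j => metricAt I (h t) p (b i) (b j)).det /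
        ∏ i, metricAt I (h 0) p (b i) (b i) := by
    funext t
    rw [volumeRatio_eq I _ _ p b, hprod]
    rfl
  rw [h3]
  refine h2.congr_deriv (Eq.symm ?_)
  · rw [Finset.sum_div]
    refine Finset.sum_congr rfl fun i _ => ?_
    rw [Matrix.of_apply, (hG i).deriv, ← Finset.mul_prod_erase _ _ (Finset.mem_univ i)]
    have h3 := hb' i
    have h4 : ∏ j ∈ Finset.univ.erase i, metricAt I (h 0) p (b j) (b j) ≠ 0 :=
      Finset.prod_ne_zero_iff.2 fun j _ => hb' j
    field_simp

variable [IsManifold I ∞ M] [I.Boundaryless]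

theorem chartGram_det_pos {h : ∀ p : M, LinearMap.BilinForm ℝ (TangentSpace I p)}
    (hpos : ∀ p, 0 < gramDet (metricAt I h p) (Module.finBasis ℝ E))
    {e : OpenPartialHomeomorph M H} (he : e ∈ IsManifold.maximalAtlas I ∞ M) {y : E}
    (hy : y ∈ (e.extend I).target) : 0 < (chartGram I h e y).det := by
  obtain ⟨c, hc, hB⟩ := exists_chartGram_det_eq I he hy
  rw [hB]
  have := hpos ((e.extend I).symm y)
  positivity

theorem exists_nhds_volumeDensity_bound
    {h : ℝ → ∀ p : M, LinearMap.BilinForm ℝ (TangentSpace I p)}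
    (hsm : ∀ e ∈ IsManifold.maximalAtlas I ∞ M, ∀ p ∈ e.source,
      ContDiffAt ℝ 1 (fun q : ℝ × E => (chartGram I (h q.1) e q.2).det) (0, e.extend I p))
    (hpos : ∀ p, 0 < gramDet (metricAt I (h 0) p) (Module.finBasis ℝ E)) (p₀ : M) :
    ∃ U ∈ 𝓝 p₀, ∃ δ > 0, ∃ C : ℝ, ∀ p ∈ U, ∀ t : ℝ, |t| < δ →
      DifferentiableAt ℝ (fun s => √(volumeRatio I (h 0) (h s) p)) t ∧
      |deriv (fun s => √(volumeRatio I (h 0) (h s) p)) t| ≤ C ∧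
      ContinuousAt (fun p => √(volumeRatio I (h 0) (h t) p)) p := by
  set e := chartAt H p₀
  have he : e ∈ IsManifold.maximalAtlas I ∞ M := IsManifold.chart_mem_maximalAtlas p₀
  have hp₀ : p₀ ∈ e.source := mem_chart_source H p₀
  have hd := hsm e he p₀ hp₀
  set d : ℝ × E → ℝ := fun q => (chartGram I (h q.1) e q.2).det with hd_def
  set y₀ := e.extend I p₀ with hy₀
  have hd0 : ContDiffAt ℝ 1 (fun q : ℝ × E => d (0, q.2)) (0, y₀) :=
    ContDiffAt.comp (g := d) (f := fun q : ℝ × E => ((0 : ℝ), q.2)) (0, y₀) hd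
      (contDiff_const.prodMk contDiff_snd).contDiffAt
  have hdpos : 0 < d (0, y₀) := chartGram_det_pos I hpos he
    ((e.extend I).map_source (by rwa [e.extend_source]))
  let R : ℝ × E → ℝ := fun q => √(d q / d (0, q.2))
  have hR : ContDiffAt ℝ 1 R (0, y₀) :=
    ((hd.div hd0 hdpos.ne').sqrt (by simp [div_self hdpos.ne']))
  have hRev : ∀ᶠ q in 𝓝 ((0 : ℝ), y₀), ContDiffAt ℝ 1 R q := hR.eventually (by simp)
  have hRb : ∀ᶠ q in 𝓝 ((0 : ℝ), y₀), ‖fderiv ℝ R q‖ < ‖fderiv ℝ R (0, y₀)‖ + 1 :=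
    (hR.fderiv_right (m := 0) (by simp)).continuousAt.norm.eventually_lt_const (lt_add_one _)
  have hall := hRev.and hRb
  rw [nhds_prod_eq, Filter.eventually_prod_iff] at hall
  obtain ⟨P, hP, Q, hQ, hPQ⟩ := hall
  obtain ⟨δ, hδ, hδP⟩ := Metric.eventually_nhds_iff.1 hP
  have hcont : ∀ p ∈ e.source, ContinuousAt (e.extend I) p := fun p hp =>
    e.continuousAt_extend (I := I) hp
  refine ⟨e.source ∩ e.extend I ⁻¹' {y | Q y}, Filter.inter_mem (e.open_source.mem_nhds hp₀)
    ((hcont p₀ hp₀).preimage_mem_nhds hQ), δ, hδ, ‖fderiv ℝ R (0, y₀)‖ + 1, ?_⟩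
  rintro p ⟨hp, hpQ⟩ t ht
  have heq : ∀ s : ℝ, ∀ p ∈ e.source, √(volumeRatio I (h 0) (h s) p) = R (s, e.extend I p) := by
    intro s p hp
    rw [volumeRatio_eq_chartGram I he hp]
  obtain ⟨hq1, hq2⟩ := hPQ (hδP (by simpa using ht)) hpQ
  have hder : HasDerivAt (fun s => R (s, e.extend I p)) (fderiv ℝ R (t, e.extend I p) (1, 0)) t :=
    HasFDerivAt.comp_hasDerivAt (f := fun s : ℝ => (s, e.extend I p)) t
      (hq1.differentiableAt (by simp)).hasFDerivAt
      ((hasDerivAt_id t).prodMk (hasDerivAt_const t _))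
  simp only [heq _ p hp]
  refine ⟨hder.differentiableAt, ?_, ?_⟩
  · rw [hder.deriv]
    refine ((fderiv ℝ R (t, e.extend I p)).le_opNorm _).trans ?_
    simpa using hq2.le
  · refine ContinuousAt.congr (f := fun p => R (t, e.extend I p)) ?_ ?_
    · exact ContinuousAt.comp (g := R) (f := fun p => (t, e.extend I p)) hq1.continuousAt
        (continuousAt_const.prodMk (hcont p hp))
    · filter_upwards [e.open_source.mem_nhds hp] with p' hp'
      exact (heq t p' hp').symm

theorem exists_volumeDensity_bound [CompactSpace M]
    {h : ℝ → ∀ p : M, LinearMap.BilinForm ℝ (TangentSpace I p)}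
    (hsm : ∀ e ∈ IsManifold.maximalAtlas I ∞ M, ∀ p ∈ e.source,
      ContDiffAt ℝ 1 (fun q : ℝ × E => (chartGram I (h q.1) e q.2).det) (0, e.extend I p))
    (hpos : ∀ p, 0 < gramDet (metricAt I (h 0) p) (Module.finBasis ℝ E)) :
    ∃ δ > 0, ∃ C : ℝ, ∀ p : M, ∀ t : ℝ, |t| < δ →
      DifferentiableAt ℝ (fun s => √(volumeRatio I (h 0) (h s) p)) t ∧
      |deriv (fun s => √(volumeRatio I (h 0) (h s) p)) t| ≤ C ∧
      ContinuousAt (fun p => √(volumeRatio I (h 0) (h t) p)) p := by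
  suffices ∃ δ > 0, ∃ C : ℝ, ∀ p ∈ (univ : Set M), ∀ t : ℝ, |t| < δ →
      DifferentiableAt ℝ (fun s => √(volumeRatio I (h 0) (h s) p)) t ∧
      |deriv (fun s => √(volumeRatio I (h 0) (h s) p)) t| ≤ C ∧
      ContinuousAt (fun p => √(volumeRatio I (h 0) (h t) p)) p by simpa using this
  refine isCompact_univ.induction_on (p := fun S => ∃ δ > 0, ∃ C : ℝ, ∀ p ∈ S, ∀ t : ℝ, |t| < δ →
      DifferentiableAt ℝ (fun s => √(volumeRatio I (h 0) (h s) p)) t ∧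
      |deriv (fun s => √(volumeRatio I (h 0) (h s) p)) t| ≤ C ∧
      ContinuousAt (fun p => √(volumeRatio I (h 0) (h t) p)) p) ?_ ?_ ?_ ?_
  · exact ⟨1, one_pos, 0, by simp⟩
  · rintro S T hST ⟨δ, hδ, C, hC⟩
    exact ⟨δ, hδ, C, fun p hp => hC p (hST hp)⟩
  · rintro S T ⟨δ, hδ, C, hC⟩ ⟨δ', hδ', C', hC'⟩
    refine ⟨min δ δ', lt_min hδ hδ', max C C', ?_⟩
    rintro p (hp | hp) t ht
    · obtain ⟨h1, h2, h3⟩ := hC p hp t (ht.trans_le (min_le_left _ _))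
      exact ⟨h1, h2.trans (le_max_left _ _), h3⟩
    · obtain ⟨h1, h2, h3⟩ := hC' p hp t (ht.trans_le (min_le_right _ _))
      exact ⟨h1, h2.trans (le_max_right _ _), h3⟩
  · intro p₀ _
    obtain ⟨U, hU, hr⟩ := exists_nhds_volumeDensity_bound I hsm hpos p₀
    exact ⟨U, mem_nhdsWithin_of_mem_nhds hU, hr⟩

/-- The first variation of the total volume of a compact manifold under a variation `h t` of the
metric, in terms of the derivative `2 D` of the ratio of the Gram determinants. -/
theorem hasDerivAt_totalVolume [CompactSpace M] [SecondCountableTopology M]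
    [MeasurableSpace M] [BorelSpace M] [MeasurableSpace E] [BorelSpace E]
    {h : ℝ → ∀ p : M, LinearMap.BilinForm ℝ (TangentSpace I p)}
    (hsm : ∀ e ∈ IsManifold.maximalAtlas I ∞ M, ∀ p ∈ e.source,
      ContDiffAt ℝ 1 (fun q : ℝ × E => (chartGram I (h q.1) e q.2).det) (0, e.extend I p))
    (hpos : ∀ p, 0 < gramDet (metricAt I (h 0) p) (Module.finBasis ℝ E))
    {μ : Measure M} (hμ : IsRiemannianVolume I (h 0) μ) [IsFiniteMeasure μ] {D : M → ℝ}
    (hDc : Measurable D)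
    (hD : ∀ p, HasDerivAt (fun t => volumeRatio I (h 0) (h t) p) (2 * D p) 0) :
    HasDerivAt (fun t => totalVolume I (h t)) (∫ p, D p ∂μ) 0 := by
  obtain ⟨δ, hδ, C, hC⟩ := exists_volumeDensity_bound I hsm hpos
  set r : ℝ → M → ℝ := fun t p => √(volumeRatio I (h 0) (h t) p) with hr
  have hr0 : ∀ p, volumeRatio I (h 0) (h 0) p = 1 := fun p => div_self (hpos p).ne'
  have hcont : ∀ t, |t| < δ → Continuous (r t) := fun t ht =>
    continuous_iff_continuousAt.2 fun p => (hC p t ht).2.2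
  have hc0 : ∀ e ∈ IsManifold.maximalAtlas I ∞ M,
      ContinuousOn (fun y => (chartGram I (h 0) e y).det) (e.extend I).target := by
    intro e he y hy
    have hx : (e.extend I).symm y ∈ e.source := by
      rw [← e.extend_source (I := I)]; exact (e.extend I).map_target hy
    have h1 := (hsm e he _ hx).continuousAt
    rw [(e.extend I).right_inv hy] at h1
    exact (ContinuousAt.comp (f := fun y : E => ((0 : ℝ), y)) h1
      (continuousAt_const.prodMk continuousAt_id)).continuousWithinAt
  have hvol : ∀ t, |t| < δ → totalVolume I (h t) = ∫ p, r t p ∂μ := by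
    intro t ht
    have hm : Measurable fun p => ENNReal.ofReal (r t p) := (hcont t ht).measurable.ennreal_ofReal
    have h1 := hμ.withDensity I (h' := h t) hc0 (fun e he y hy => chartGram_det_pos I hpos he hy) hm
    rw [totalVolume_eq I h1, withDensity_apply _ MeasurableSet.univ, Measure.restrict_univ,
      integral_eq_lintegral_of_nonneg_ae (Filter.Eventually.of_forall fun p => Real.sqrt_nonneg _)
        (hcont t ht).measurable.aestronglyMeasurable]
  have hev : (fun t => totalVolume I (h t)) =ᶠ[𝓝 0] fun t => ∫ p, r t p ∂μ := by
    filter_upwards [Metric.ball_mem_nhds (0 : ℝ) hδ] with t ht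
    exact hvol t (by simpa using ht)
  have hder0 : ∀ p, deriv (fun s => r s p) 0 = D p := by
    intro p
    have h1 := (hD p).sqrt (by rw [hr0]; exact one_ne_zero)
    rw [h1.deriv, hr0]
    simp
  refine HasDerivAt.congr_of_eventuallyEq ?_ hev
  have h2 := hasDerivAt_integral_of_dominated_loc_of_deriv_le (μ := μ) (F := r)
    (F' := fun t p => deriv (fun s => r s p) t) (x₀ := (0 : ℝ)) (s := Metric.ball 0 δ)
    (bound := fun _ => C) (Metric.ball_mem_nhds _ hδ) ?_ ?_ ?_ ?_ (integrable_const C) ?_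
  · simpa only [hder0] using h2.2
  · filter_upwards [Metric.ball_mem_nhds (0 : ℝ) hδ] with t ht
    exact (hcont t (by simpa using ht)).measurable.aestronglyMeasurable
  · have : r 0 = fun _ => 1 := by funext p; simp [hr, hr0]
    rw [this]
    exact integrable_const _
  · simp only [hder0]
    exact hDc.aestronglyMeasurable
  · exact Filter.Eventually.of_forall fun p t ht => (hC p t (by simpa using ht)).2.1
  · exact Filter.Eventually.of_forall fun p t ht => (hC p t (by simpa using ht)).1.hasDerivAt

end VolumeVariation

noncomputable section Lifts

variable {n : ℕ} {E : Type*} [NormedAddCommGroup E] [NormedSpace ℝ E]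
  {H : Type*} [TopologicalSpace H] (I : ModelWithCorners ℝ E H)
  {M : Type*} [TopologicalSpace M] [ChartedSpace H M]
  {X : Type*} [NormedAddCommGroup X] [NormedSpace ℝ X]

/-- A smooth map to `ℂPⁿ` locally has a smooth lift to `ℂⁿ⁺¹ ∖ {0}`. -/
theorem CP.exists_lift {ψ : X → CP n} {q₀ : X}
    (hψ : ContMDiffAt 𝓘(ℝ, X) 𝓘(ℝ, EuclideanSpace ℂ (Fin n)) ∞ ψ q₀) :
    ∃ B : X → EuclideanSpace ℂ (Fin (n + 1)), ContDiffAt ℝ ∞ B q₀ ∧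
      ∀ᶠ q in 𝓝 q₀, B q ≠ 0 ∧ CP.ofVec (B q) = ψ q := by
  set i := CP.chartIndex (ψ q₀)
  refine ⟨fun q => CP.affineVec i (CP.affineCoord i (ψ q)), ?_, ?_⟩
  · have h1 := (contMDiffAt_iff_target.1 hψ).2
    exact (CP.contDiff_affineVec i).contDiffAt.comp q₀ (contMDiffAt_iff_contDiffAt.1 h1)
  · filter_upwards [hψ.continuousAt.preimage_mem_nhds ((CP.isOpen_affineSource i).mem_nhds
      (CP.mem_affineSource_chartIndex (ψ q₀)))] with q hq
    exact ⟨CP.affineVec_ne_zero _ _, CP.ofVec_affineVec i hq⟩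

theorem fubiniStudy_of_eq_ofVec {p : CP n} {z : EuclideanSpace ℂ (Fin (n + 1))} (hz : z ≠ 0)
    (hp : p = CP.ofVec z) (a b : EuclideanSpace ℂ (Fin (n + 1))) :
    fubiniStudy p (CP.dofVec z a) (CP.dofVec z b) = (hopfForm z a b).re := by
  subst hp
  exact fubiniStudy_dofVec hz a b

theorem complexStructure_of_eq_ofVec {p : CP n} {z : EuclideanSpace ℂ (Fin (n + 1))} (hz : z ≠ 0)
    (hp : p = CP.ofVec z) (a : EuclideanSpace ℂ (Fin (n + 1))) :
    complexStructure (p := p) (CP.dofVec z a) = CP.dofVec z (Complex.I • a) := by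
  subst hp
  exact complexStructure_dofVec hz a

theorem CP.hasMFDerivAt_of_lift {ψ : X → CP n} {B : X → EuclideanSpace ℂ (Fin (n + 1))} {y : X}
    {B' : X →L[ℝ] EuclideanSpace ℂ (Fin (n + 1))} (hB : HasFDerivAt B B' y) (hB0 : B y ≠ 0)
    (heq : ∀ᶠ x in 𝓝 y, CP.ofVec (B x) = ψ x) :
    HasMFDerivAt 𝓘(ℝ, X) 𝓘(ℝ, EuclideanSpace ℂ (Fin n)) ψ y
      ((CP.dofVec (B y)).comp B' : X →L[ℝ] EuclideanSpace ℂ (Fin n)) :=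
  ((CP.hasMFDerivAt_ofVec hB0).comp y hB.hasMFDerivAt).congr_of_eventuallyEq
    (heq.mono fun _ h => h.symm)

theorem CP.mfderiv_apply_of_lift {ψ : M → CP n} {σ : X → M}
    {B : X → EuclideanSpace ℂ (Fin (n + 1))} {y : X}
    (hψ : MDifferentiableAt I 𝓘(ℝ, EuclideanSpace ℂ (Fin n)) ψ (σ y))
    (hσ : MDifferentiableAt 𝓘(ℝ, X) I σ y) (hB : DifferentiableAt ℝ B y) (hB0 : B y ≠ 0)
    (heq : ∀ᶠ x in 𝓝 y, CP.ofVec (B x) = ψ (σ x)) (v : X) :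
    mfderiv I 𝓘(ℝ, EuclideanSpace ℂ (Fin n)) ψ (σ y) (mfderiv 𝓘(ℝ, X) I σ y v) =
      CP.dofVec (B y) (fderiv ℝ B y v) := by
  have h1 := (CP.hasMFDerivAt_of_lift (ψ := ψ ∘ σ) hB.hasFDerivAt hB0 heq).mfderiv
  have h2 := mfderiv_comp y hψ hσ
  have h3 := congrArg (fun L : X →L[ℝ] EuclideanSpace ℂ (Fin n) => L v) (h2.symm.trans h1)
  exact h3

theorem inducedMetric_apply_of_lift {ψ : M → CP n} {σ : X → M}
    {B : X → EuclideanSpace ℂ (Fin (n + 1))} {y : X}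
    (hψ : MDifferentiableAt I 𝓘(ℝ, EuclideanSpace ℂ (Fin n)) ψ (σ y))
    (hσ : MDifferentiableAt 𝓘(ℝ, X) I σ y) (hB : DifferentiableAt ℝ B y) (hB0 : B y ≠ 0)
    (heq : ∀ᶠ x in 𝓝 y, CP.ofVec (B x) = ψ (σ x)) (v w : X) :
    inducedMetric I ψ (σ y) (mfderiv 𝓘(ℝ, X) I σ y v) (mfderiv 𝓘(ℝ, X) I σ y w) =
      (hopfForm (B y) (fderiv ℝ B y v) (fderiv ℝ B y w)).re := by
  have h1 := CP.mfderiv_apply_of_lift I hψ hσ hB hB0 heq v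
  have h2 := CP.mfderiv_apply_of_lift I hψ hσ hB hB0 heq w
  change fubiniStudy (ψ (σ y))
    (mfderiv I 𝓘(ℝ, EuclideanSpace ℂ (Fin n)) ψ (σ y) (mfderiv 𝓘(ℝ, X) I σ y v))
    (mfderiv I 𝓘(ℝ, EuclideanSpace ℂ (Fin n)) ψ (σ y) (mfderiv 𝓘(ℝ, X) I σ y w)) = _
  rw [h1, h2]
  exact fubiniStudy_of_eq_ofVec hB0 heq.self_of_nhds.symm _ _

theorem ContDiffAt.hopfForm {m : ℕ∞ω} {z a b : X → EuclideanSpace ℂ (Fin (n + 1))} {q : X}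
    (hz : ContDiffAt ℝ m z q) (ha : ContDiffAt ℝ m a q) (hb : ContDiffAt ℝ m b q)
    (hz0 : z q ≠ 0) : ContDiffAt ℝ m (fun x => hopfForm (z x) (a x) (b x)) q := by
  have hn : ContDiffAt ℝ m (fun x => ((‖z x‖ ^ 2 : ℝ) : ℂ)) q :=
    (Complex.ofRealCLM.contDiff.contDiffAt (x := ‖z q‖ ^ 2)).comp q (hz.norm_sq ℂ)
  have hne : ((‖z q‖ ^ 2 : ℝ) : ℂ) ^ 2 ≠ 0 := by
    have : ‖z q‖ ≠ 0 := by simpa using hz0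
    exact_mod_cast pow_ne_zero 2 (pow_ne_zero 2 this)
  simp only [_root_.hopfForm, div_eq_mul_inv]
  exact (((ha.inner ℂ hb).mul hn).sub ((ha.inner ℂ hz).mul (hz.inner ℂ hb))).mul
    ((hn.pow 2).inv hne)

section Variation

variable {I} {ψ : M → CP n} {ε : ℝ} {Ψ : ℝ → M → CP n}

theorem IsVariation.contMDiffAt (hΨ : IsVariation I ψ ε Ψ) {t : ℝ} (ht : |t| < ε) (p : M) :
    ContMDiffAt (𝓘(ℝ, ℝ).prod I) 𝓘(ℝ, EuclideanSpace ℂ (Fin n)) ∞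
      (fun q : ℝ × M => Ψ q.1 q.2) (t, p) :=
  hΨ.2.2.contMDiffAt (prod_mem_nhds (isOpen_Ioo.mem_nhds (abs_lt.1 ht)) Filter.univ_mem)

theorem IsVariation.contMDiff_slice (hΨ : IsVariation I ψ ε Ψ) {t : ℝ} (ht : |t| < ε) :
    ContMDiff I 𝓘(ℝ, EuclideanSpace ℂ (Fin n)) ∞ (Ψ t) := fun p =>
  ContMDiffAt.comp (f := fun p : M => (t, p)) p (hΨ.contMDiffAt ht p)
    (contMDiffAt_const.prodMk contMDiffAt_id)

theorem IsVariation.exists_lift (hΨ : IsVariation I ψ ε Ψ) {σ : X → M} {y₀ : X}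
    (hσ : ContMDiffAt 𝓘(ℝ, X) I ∞ σ y₀) :
    ∃ B : ℝ × X → EuclideanSpace ℂ (Fin (n + 1)), ContDiffAt ℝ ∞ B (0, y₀) ∧
      ∀ᶠ q in 𝓝 ((0 : ℝ), y₀), B q ≠ 0 ∧ CP.ofVec (B q) = Ψ q.1 (σ q.2) := by
  refine CP.exists_lift ?_
  have h1 : ContMDiffAt 𝓘(ℝ, ℝ × X) (𝓘(ℝ, ℝ).prod I) ∞ (fun q : ℝ × X => (q.1, σ q.2)) (0, y₀) :=
    (contMDiffAt_iff_contDiffAt.2 contDiffAt_fst).prodMk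
      (ContMDiffAt.comp (g := σ) (f := Prod.snd) (0, y₀) hσ
        (contMDiffAt_iff_contDiffAt.2 contDiffAt_snd))
  exact ContMDiffAt.comp (g := fun q : ℝ × M => Ψ q.1 q.2) (0, y₀)
    (hΨ.contMDiffAt (by simpa using hΨ.1) (σ y₀)) h1

/-- In terms of a lift `B` of `Ψ t (σ y)`, the metric induced by `Ψ t` is given by `hopfForm`. -/
theorem IsVariation.eventually_inducedMetric (hΨ : IsVariation I ψ ε Ψ) {σ : X → M} {y₀ : X}
    (hσ : ∀ᶠ y in 𝓝 y₀, MDifferentiableAt 𝓘(ℝ, X) I σ y)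
    {B : ℝ × X → EuclideanSpace ℂ (Fin (n + 1))} (hB : ContDiffAt ℝ 1 B (0, y₀))
    (heq : ∀ᶠ q in 𝓝 ((0 : ℝ), y₀), B q ≠ 0 ∧ CP.ofVec (B q) = Ψ q.1 (σ q.2)) :
    ∀ᶠ q in 𝓝 ((0 : ℝ), y₀), ∀ v w : X,
      inducedMetric I (Ψ q.1) (σ q.2) (mfderiv 𝓘(ℝ, X) I σ q.2 v) (mfderiv 𝓘(ℝ, X) I σ q.2 w) =
        (hopfForm (B q) (fderiv ℝ B q (0, v)) (fderiv ℝ B q (0, w))).re := by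
  have hσ' : ∀ᶠ q in 𝓝 ((0 : ℝ), y₀), MDifferentiableAt 𝓘(ℝ, X) I σ q.2 :=
    continuousAt_snd.eventually (p := fun y => MDifferentiableAt 𝓘(ℝ, X) I σ y) hσ
  have ht : ∀ᶠ q in 𝓝 ((0 : ℝ), y₀), |q.1| < ε :=
    continuousAt_fst.abs.eventually_lt_const (by simpa using hΨ.1)
  filter_upwards [hσ', ht, hB.eventually (by simp), heq.eventually_nhds] with q h1 h2 h3 h4 v w
  obtain ⟨t, y⟩ := q
  have hs : HasFDerivAt (fun x : X => B (t, x))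
      ((fderiv ℝ B (t, y)).comp (ContinuousLinearMap.inr ℝ ℝ X)) y :=
    HasFDerivAt.comp (g := B) (f := fun x : X => (t, x)) y
      (h3.differentiableAt (by simp)).hasFDerivAt (hasFDerivAt_prodMk_right t y)
  have hev : ∀ᶠ x in 𝓝 y, CP.ofVec (B (t, x)) = Ψ t (σ x) := by
    have hc : ContinuousAt (fun x : X => (t, x)) y := by fun_prop
    exact (hc.eventually h4).mono fun x hx => hx.2
  have h5 := inducedMetric_apply_of_lift I (B := fun x : X => B (t, x))
    ((hΨ.contMDiff_slice h2).mdifferentiableAt (by simp) (x := σ y)) h1 hs.differentiableAt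
    h4.self_of_nhds.1 hev v w
  rw [hs.fderiv] at h5
  exact h5

theorem IsVariation.contDiffAt_inducedMetric (hΨ : IsVariation I ψ ε Ψ) {σ : X → M} {y₀ : X}
    (hσ : ContMDiffAt 𝓘(ℝ, X) I ∞ σ y₀)
    (hσ' : ∀ᶠ y in 𝓝 y₀, MDifferentiableAt 𝓘(ℝ, X) I σ y) (v w : X) :
    ContDiffAt ℝ 1 (fun q : ℝ × X => inducedMetric I (Ψ q.1) (σ q.2)
      (mfderiv 𝓘(ℝ, X) I σ q.2 v) (mfderiv 𝓘(ℝ, X) I σ q.2 w)) (0, y₀) := by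
  obtain ⟨B, hB, heq⟩ := hΨ.exists_lift hσ
  have h1 : ∀ u : X, ContDiffAt ℝ 1 (fun q => fderiv ℝ B q ((0 : ℝ), u)) (0, y₀) := fun u =>
    (hB.fderiv_right (m := 1) (by norm_cast)).clm_apply contDiffAt_const
  have h2 : ContDiffAt ℝ 1
      (fun q => (hopfForm (B q) (fderiv ℝ B q (0, v)) (fderiv ℝ B q (0, w))).re) (0, y₀) :=
    (Complex.reCLM.contDiff.contDiffAt).comp ((0 : ℝ), y₀)
      ((hB.of_le (by norm_cast)).hopfForm (h1 v) (h1 w) heq.self_of_nhds.1)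
  refine h2.congr_of_eventuallyEq ?_
  filter_upwards [hΨ.eventually_inducedMetric hσ' (hB.of_le (by norm_cast)) heq] with q hq
  exact hq v w

theorem IsVariation.contDiffAt_chartGram_det [FiniteDimensional ℝ E] [I.Boundaryless]
    (hΨ : IsVariation I ψ ε Ψ) {e : OpenPartialHomeomorph M H}
    (he : e ∈ IsManifold.maximalAtlas I ∞ M) {p : M} (hp : p ∈ e.source) :
    ContDiffAt ℝ 1 (fun q : ℝ × E => (chartGram I (inducedMetric I (Ψ q.1)) e q.2).det)
      (0, e.extend I p) := by
  have hσ : ∀ y ∈ (e.extend I).target, ContMDiffAt 𝓘(ℝ, E) I ∞ (e.extend I).symm y := by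
    intro y hy
    have h1 := contMDiffOn_extend_symm (I := I) he
    rw [← e.extend_target'] at h1
    exact h1.contMDiffAt ((e.isOpen_extend_target (I := I)).mem_nhds hy)
  have hy : e.extend I p ∈ (e.extend I).target :=
    (e.extend I).map_source (by rwa [e.extend_source])
  simp only [Matrix.det_apply']
  refine ContDiffAt.sum fun s _ => contDiffAt_const.mul (contDiffAt_prod fun i _ => ?_)
  refine hΨ.contDiffAt_inducedMetric (hσ _ hy) ?_ _ _
  filter_upwards [(e.isOpen_extend_target (I := I)).mem_nhds hy] with y hy'
  exact (hσ y hy').mdifferentiableAt (by simp)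

theorem IsVariation.differentiableAt_inducedMetric [FiniteDimensional ℝ E] [I.Boundaryless]
    [IsManifold I ∞ M] (hΨ : IsVariation I ψ ε Ψ) (p : M) (u v : E) :
    DifferentiableAt ℝ (fun t => metricAt I (inducedMetric I (Ψ t)) p u v) 0 := by
  set e := chartAt H p
  have he : e ∈ IsManifold.maximalAtlas I ∞ M := IsManifold.chart_mem_maximalAtlas p
  have hp : p ∈ e.source := mem_chart_source H p
  have hy : e.extend I p ∈ (e.extend I).target :=
    (e.extend I).map_source (by rwa [e.extend_source])
  have hσ : ∀ y ∈ (e.extend I).target, ContMDiffAt 𝓘(ℝ, E) I ∞ (e.extend I).symm y := by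
    intro y hy
    have h1 := contMDiffOn_extend_symm (I := I) he
    rw [← e.extend_target'] at h1
    exact h1.contMDiffAt ((e.isOpen_extend_target (I := I)).mem_nhds hy)
  have hσy : (e.extend I).symm (e.extend I p) = p := e.extend_left_inv hp
  let L : E →L[ℝ] E := mfderiv 𝓘(ℝ, E) I (e.extend I).symm (e.extend I p)
  let L' : E →L[ℝ] E := mfderiv I 𝓘(ℝ, E) (e.extend I) p
  have hc : L.comp L' = ContinuousLinearMap.id ℝ E := by
    have h1 := mfderiv_comp p ((hσ _ hy).mdifferentiableAt (by simp))
      ((e.contMDiffAt_extend he hp).mdifferentiableAt (by simp))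
    have h2 : (e.extend I).symm ∘ (e.extend I) =ᶠ[𝓝 p] id := by
      filter_upwards [e.open_source.mem_nhds hp] with z hz
      exact e.extend_left_inv hz
    rw [h2.mfderiv_eq, mfderiv_id] at h1
    exact h1.symm
  have hL : ∀ w : E, L (L' w) = w := fun w => congrArg (fun T : E →L[ℝ] E => T w) hc
  have h1 := hΨ.contDiffAt_inducedMetric (hσ _ hy) (by
    filter_upwards [(e.isOpen_extend_target (I := I)).mem_nhds hy] with y hy'
    exact (hσ y hy').mdifferentiableAt (by simp)) (L' u) (L' v)
  have h2 : DifferentiableAt ℝ (fun t : ℝ => metricAt I (inducedMetric I (Ψ t))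
      ((e.extend I).symm (e.extend I p)) (L (L' u)) (L (L' v))) 0 :=
    DifferentiableAt.comp (f := fun t : ℝ => (t, e.extend I p)) 0
      (h1.differentiableAt (by simp)) (differentiableAt_id.prodMk (differentiableAt_const _))
  rw [hσy] at h2
  simpa only [hL] using h2

end Variation

end Lifts

noncomputable section FirstVariation

variable {n : ℕ}

theorem hopfForm_of_orthogonal {z a b : EuclideanSpace ℂ (Fin (n + 1))} (hz : ‖z‖ = 1)
    (hb : inner ℂ z b = 0) : hopfForm z a b = inner ℂ a b := by
  simp [hopfForm, hz, hb]

theorem hopfForm_eq_inner (z a b : EuclideanSpace ℂ (Fin (n + 1))) :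
    hopfForm z a b = (inner ℂ a b * inner ℂ z z - inner ℂ a z * inner ℂ z b) / inner ℂ z z ^ 2 := by
  have hzz : inner ℂ z z = (‖z‖ : ℂ) ^ 2 := inner_self_eq_norm_sq_to_K z
  rw [hopfForm, hzz]
  push_cast
  rfl

/-- The first variation of the squared length of the horizontal part of `∂B/∂r`. -/
theorem hasDerivAt_hopfForm_partial {B : ℝ × ℝ → EuclideanSpace ℂ (Fin (n + 1))}
    (hB : ContDiffAt ℝ 2 B (0, 0)) {c c' : ℝ → EuclideanSpace ℂ (Fin (n + 1))}
    {c'' : EuclideanSpace ℂ (Fin (n + 1))}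
    (hc : ∀ r, HasDerivAt c (c' r) r) (hc' : HasDerivAt c' c'' 0)
    (hBc : ∀ᶠ r in 𝓝 (0 : ℝ), B (0, r) = c r) (hnorm : ‖c 0‖ = 1) (horth : inner ℂ (c 0) (c' 0) = 0)
    (hW : ∀ᶠ r in 𝓝 (0 : ℝ), (inner ℂ (fderiv ℝ B (0, r) (1, 0)) (c' r)).re = 0) :
    HasDerivAt (fun t : ℝ => (hopfForm (B (t, 0)) (fderiv ℝ B (t, 0) (0, 1))
        (fderiv ℝ B (t, 0) (0, 1))).re)
      (-2 * (inner ℂ (fderiv ℝ B (0, 0) (1, 0)) c'').re -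
        2 * ‖c' 0‖ ^ 2 * (inner ℂ (fderiv ℝ B (0, 0) (1, 0)) (c 0)).re) 0 := by
  set w := fderiv ℝ B (0, 0) (1, 0) with hw
  have hline1 : HasDerivAt (fun t : ℝ => (t, (0 : ℝ))) (1, 0) 0 :=
    (hasDerivAt_id 0).prodMk (hasDerivAt_const 0 0)
  have hline2 : HasDerivAt (fun r : ℝ => ((0 : ℝ), r)) (0, 1) 0 :=
    (hasDerivAt_const 0 0).prodMk (hasDerivAt_id 0)
  have hB1 : HasFDerivAt B (fderiv ℝ B (0, 0)) (0, 0) :=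
    (hB.differentiableAt (by simp)).hasFDerivAt
  have hB2 : HasFDerivAt (fderiv ℝ B) (fderiv ℝ (fderiv ℝ B) (0, 0)) (0, 0) :=
    ((hB.fderiv_right (m := 1) (by norm_cast)).differentiableAt (by simp)).hasFDerivAt
  have hsymm : fderiv ℝ (fderiv ℝ B) (0, 0) (1, 0) (0, 1) =
      fderiv ℝ (fderiv ℝ B) (0, 0) (0, 1) (1, 0) :=
    (hB.isSymmSndFDerivAt (by simp)).eq _ _
  set Y' := fderiv ℝ (fderiv ℝ B) (0, 0) (1, 0) (0, 1) with hY'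
  have hZ : HasDerivAt (fun t : ℝ => B (t, 0)) w 0 :=
    hB1.comp_hasDerivAt (f := fun t : ℝ => (t, (0 : ℝ))) 0 hline1
  have hY : HasDerivAt (fun t : ℝ => fderiv ℝ B (t, 0) (0, 1)) Y' 0 := by
    have h1 := hB2.comp_hasDerivAt (f := fun t : ℝ => (t, (0 : ℝ))) 0 hline1
    simpa using h1.clm_apply (hasDerivAt_const 0 ((0 : ℝ), (1 : ℝ)))
  have hWr : HasDerivAt (fun r : ℝ => fderiv ℝ B (0, r) (1, 0)) Y' 0 := by
    have h1 := hB2.comp_hasDerivAt (f := fun r : ℝ => ((0 : ℝ), r)) 0 hline2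
    rw [hsymm]
    simpa using h1.clm_apply (hasDerivAt_const 0 ((1 : ℝ), (0 : ℝ)))
  have hZ0 : B (0, 0) = c 0 := hBc.self_of_nhds
  have hY0 : fderiv ℝ B (0, 0) (0, 1) = c' 0 := by
    have h1 : HasDerivAt (fun r : ℝ => B (0, r)) (fderiv ℝ B (0, 0) (0, 1)) 0 :=
      hB1.comp_hasDerivAt 0 hline2
    exact h1.unique ((hc 0).congr_of_eventuallyEq hBc)
  have hWc : (inner ℂ Y' (c' 0)).re + (inner ℂ w c'').re = 0 := by
    have h1 := hWr.inner ℂ hc'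
    have h2 : HasDerivAt (fun r : ℝ => (inner ℂ (fderiv ℝ B (0, r) (1, 0)) (c' r)).re)
        ((inner ℂ w c'' + inner ℂ Y' (c' 0)).re) 0 :=
      Complex.reCLM.hasFDerivAt.comp_hasDerivAt 0 h1
    have h3 := (h2.congr_of_eventuallyEq (f₁ := fun _ => 0) (hW.mono fun r hr => hr.symm)).unique
      (hasDerivAt_const (0 : ℝ) (0 : ℝ))
    rw [Complex.add_re] at h3
    linarith
  have hzz : inner ℂ (c 0) (c 0) = (1 : ℂ) := by
    rw [inner_self_eq_norm_sq_to_K, hnorm]; simp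
  have horth' : inner ℂ (c' 0) (c 0) = (0 : ℂ) := by
    rw [← inner_conj_symm, horth, map_zero]
  have hyy : inner ℂ (c' 0) (c' 0) = ((‖c' 0‖ ^ 2 : ℝ) : ℂ) := by
    rw [inner_self_eq_norm_sq_to_K]; push_cast; rfl
  have key := ((((hY.inner ℂ hY).mul (hZ.inner ℂ hZ)).sub ((hY.inner ℂ hZ).mul (hZ.inner ℂ hY))).div
    ((hZ.inner ℂ hZ).pow 2) (by
      have hc0 : c 0 ≠ 0 := fun h => by simp [h] at hnorm
      simp [hZ0, hc0]))
  have key2 := Complex.reCLM.hasFDerivAt.comp_hasDerivAt 0 key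
  simp only [hopfForm_eq_inner]
  refine HasDerivAt.congr_deriv key2 ?_
  simp only [Pi.mul_apply, Pi.sub_apply, Pi.pow_apply, hZ0, hY0, hzz, horth, horth']
  have e1 : (inner ℂ (c' 0) Y').re = (inner ℂ Y' (c' 0)).re := inner_re_symm (𝕜 := ℂ) _ _
  have e2 : (inner ℂ (c 0) w).re = (inner ℂ w (c 0)).re := inner_re_symm (𝕜 := ℂ) _ _
  rw [hyy]
  simp only [Complex.reCLM_apply]
  simp [e1, e2, -Complex.ofReal_pow]
  linarith

/-- A smooth family of vectors can be rescaled so that it takes given values on the lines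
`ℂ B(0, r)`. -/
theorem exists_rescaled_lift {B : ℝ × ℝ → EuclideanSpace ℂ (Fin (n + 1))}
    (hB : ContDiffAt ℝ ∞ B (0, 0)) (hB0 : ∀ᶠ q in 𝓝 ((0 : ℝ), (0 : ℝ)), B q ≠ 0)
    {c : ℝ → EuclideanSpace ℂ (Fin (n + 1))} (hc : ContDiff ℝ ∞ c) (hc0 : ∀ r, c r ≠ 0)
    (hBc : ∀ᶠ r in 𝓝 (0 : ℝ), CP.ofVec (c r) = CP.ofVec (B (0, r))) :
    ∃ A : ℝ × ℝ → EuclideanSpace ℂ (Fin (n + 1)), ContDiffAt ℝ ∞ A (0, 0) ∧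
      (∀ᶠ q in 𝓝 ((0 : ℝ), (0 : ℝ)), A q ≠ 0 ∧ CP.ofVec (A q) = CP.ofVec (B q)) ∧
      ∀ᶠ r in 𝓝 (0 : ℝ), A (0, r) = c r := by
  let l : ℝ × ℝ → ℂ := fun q =>
    inner ℂ (B (0, q.2)) (c q.2) / inner ℂ (B (0, q.2)) (B (0, q.2))
  have hBr : ContDiffAt ℝ ∞ (fun q : ℝ × ℝ => B (0, q.2)) (0, 0) :=
    ContDiffAt.comp (g := B) (f := fun q : ℝ × ℝ => ((0 : ℝ), q.2)) (0, 0) hB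
      (contDiff_const.prodMk contDiff_snd).contDiffAt
  have hl : ContDiffAt ℝ ∞ l (0, 0) := by
    simp only [l, div_eq_mul_inv]
    exact (hBr.inner ℂ (hc.comp contDiff_snd).contDiffAt).mul ((hBr.inner ℂ hBr).inv
      (by simpa using hB0.self_of_nhds))
  have hcr : ContinuousAt (fun r : ℝ => ((0 : ℝ), r)) 0 := by fun_prop
  have hlc : ∀ᶠ r in 𝓝 (0 : ℝ), l (0, r) • B (0, r) = c r := by
    filter_upwards [hBc, hcr.eventually hB0] with r h1 h2
    obtain ⟨a, ha⟩ := (CP.ofVec_eq_iff (hc0 r) h2).1 h1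
    have h3 : inner ℂ (B (0, r)) (B (0, r)) ≠ (0 : ℂ) := by simpa using h2
    simp only [l]
    rw [← ha, inner_smul_right, mul_div_assoc, div_self h3, mul_one]
  have hl0 : l (0, 0) ≠ 0 := by
    intro h
    have := hlc.self_of_nhds
    rw [h, zero_smul] at this
    exact hc0 0 this.symm
  refine ⟨fun q => l q • B q, hl.smul hB, ?_, hlc⟩
  filter_upwards [hB0, hl.continuousAt.eventually_ne hl0] with q h1 h2
  exact ⟨smul_ne_zero h2 h1, CP.ofVec_smul h2⟩

variable {E : Type*} [NormedAddCommGroup E] [NormedSpace ℝ E]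
  {H : Type*} [TopologicalSpace H] {I : ModelWithCorners ℝ E H}
  {M : Type*} [TopologicalSpace M] [ChartedSpace H M]

/-- The derivative of the squared length of `γ'` in the metrics induced by a Hamiltonian variation
of a Lagrangian map `ψ`, for a curve `γ` with a horizontal unit lift `c`. -/
theorem IsVariation.hasDerivAt_inducedMetric {ψ : M → CP n} {ε : ℝ} {Ψ : ℝ → M → CP n}
    (hΨ : IsVariation I ψ ε Ψ) (hL : IsLagrangian I ψ) {X : ∀ p : M, TangentSpace I p}
    (hV : ∀ p, variationField Ψ p =
      complexStructure (mfderiv I 𝓘(ℝ, EuclideanSpace ℂ (Fin n)) (Ψ 0) p (X p)))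
    {γ : ℝ → M} (hγ : ContMDiff 𝓘(ℝ, ℝ) I ∞ γ) {c c' : ℝ → EuclideanSpace ℂ (Fin (n + 1))}
    {c'' : EuclideanSpace ℂ (Fin (n + 1))} (hcs : ContDiff ℝ ∞ c)
    (hc : ∀ r, HasDerivAt c (c' r) r) (hc' : HasDerivAt c' c'' 0)
    (hψ : ∀ r, CP.ofVec (c r) = ψ (γ r)) (hnorm : ∀ r, ‖c r‖ = 1)
    (horth : ∀ r, inner ℂ (c r) (c' r) = 0) :
    HasDerivAt (fun t => inducedMetric I (Ψ t) (γ 0) (mfderiv 𝓘(ℝ, ℝ) I γ 0 (1 : ℝ))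
        (mfderiv 𝓘(ℝ, ℝ) I γ 0 (1 : ℝ)))
      (-2 * fubiniStudy (Ψ 0 (γ 0)) (variationField Ψ (γ 0))
        (CP.dofVec (c 0) (c'' + ((‖c' 0‖ ^ 2 : ℝ) : ℂ) • c 0))) 0 := by
  obtain rfl : Ψ 0 = ψ := hΨ.2.1
  have hc0 : ∀ r, c r ≠ 0 := fun r h => by simpa [h] using hnorm r
  obtain ⟨B₀, hB₀, hB₀Ψ⟩ := hΨ.exists_lift hγ.contMDiffAt (y₀ := 0)
  have hcr : ContinuousAt (fun r : ℝ => ((0 : ℝ), r)) 0 := by fun_prop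
  have hct : ContinuousAt (fun t : ℝ => (t, (0 : ℝ))) 0 := by fun_prop
  obtain ⟨B, hB, hBB₀, hBc⟩ := exists_rescaled_lift hB₀ (hB₀Ψ.mono fun _ h => h.1) hcs hc0
    ((hcr.eventually hB₀Ψ).mono fun r h => by rw [hψ, h.2])
  have hBΨ : ∀ᶠ q in 𝓝 ((0 : ℝ), (0 : ℝ)), B q ≠ 0 ∧ CP.ofVec (B q) = Ψ q.1 (γ q.2) := by
    filter_upwards [hBB₀, hB₀Ψ] with q h1 h2
    exact ⟨h1.1, h1.2.trans h2.2⟩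
  have hγd : ∀ r, MDifferentiableAt 𝓘(ℝ, ℝ) I γ r := fun r =>
    hγ.contMDiffAt.mdifferentiableAt (by simp)
  have hψd : ∀ p, MDifferentiableAt I 𝓘(ℝ, EuclideanSpace ℂ (Fin n)) (Ψ 0) p := fun p =>
    (hΨ.contMDiff_slice (by simpa using hΨ.1)).contMDiffAt.mdifferentiableAt (by simp)
  have hB2 : ContDiffAt ℝ 2 B (0, 0) := hB.of_le (by norm_cast)
  have hB1 : ContDiffAt ℝ 1 B (0, 0) := hB.of_le (by norm_cast)
  -- the velocity of the variation in terms of the lift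
  have hvel : ∀ᶠ r in 𝓝 (0 : ℝ), variationField Ψ (γ r) =
      CP.dofVec (c r) (fderiv ℝ B (0, r) (1, 0)) := by
    filter_upwards [hcr.eventually (hB1.eventually (by simp)), hcr.eventually hBΨ.eventually_nhds,
      hBc] with r h1 h2 h3
    have hs : HasFDerivAt (fun t : ℝ => B (t, r))
        ((fderiv ℝ B (0, r)).comp (ContinuousLinearMap.inl ℝ ℝ ℝ)) 0 :=
      HasFDerivAt.comp (g := B) (f := fun t : ℝ => (t, r)) 0
        (h1.differentiableAt (by simp)).hasFDerivAt (hasFDerivAt_prodMk_left 0 r)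
    have hcr' : ContinuousAt (fun t : ℝ => (t, r)) 0 := by fun_prop
    have h4 := (CP.hasMFDerivAt_of_lift (ψ := fun t => Ψ t (γ r)) hs h2.self_of_nhds.1
      ((hcr'.eventually h2).mono fun t ht => ht.2)).mfderiv
    have h5 := congrArg (fun L : ℝ →L[ℝ] EuclideanSpace ℂ (Fin n) => L (1 : ℝ)) h4
    rw [← h3]
    exact h5
  have hW : ∀ᶠ r in 𝓝 (0 : ℝ), (inner ℂ (fderiv ℝ B (0, r) (1, 0)) (c' r)).re = 0 := by
    filter_upwards [hvel] with r hr
    have h1 := CP.mfderiv_apply_of_lift I (ψ := Ψ 0) (σ := γ) (B := c) (y := r) (hψd _) (hγd r)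
      (hc r).differentiableAt (hc0 r) (Filter.Eventually.of_forall hψ) 1
    rw [(hc r).hasFDerivAt.fderiv] at h1
    have h2 := hL.2 (γ r) (X (γ r)) (mfderiv 𝓘(ℝ, ℝ) I γ r (1 : ℝ))
    rw [kaehlerForm, ← hV] at h2
    rw [h1] at h2
    rw [hr] at h2
    rw [fubiniStudy_of_eq_ofVec (hc0 r) (hψ r).symm] at h2
    rw [hopfForm_of_orthogonal (hnorm r) (by simpa using horth r)] at h2
    simpa using h2
  have hmain := hasDerivAt_hopfForm_partial hB2 hc hc' hBc (hnorm 0) (horth 0) hW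
  have hev : (fun t => inducedMetric I (Ψ t) (γ 0) (mfderiv 𝓘(ℝ, ℝ) I γ 0 (1 : ℝ))
      (mfderiv 𝓘(ℝ, ℝ) I γ 0 (1 : ℝ))) =ᶠ[𝓝 0] fun t : ℝ =>
      (hopfForm (B (t, 0)) (fderiv ℝ B (t, 0) (0, 1)) (fderiv ℝ B (t, 0) (0, 1))).re := by
    filter_upwards [hct.eventually (hΨ.eventually_inducedMetric
      (Filter.Eventually.of_forall hγd) hB1 hBΨ)] with t ht
    exact ht 1 1
  refine (hmain.congr_of_eventuallyEq hev).congr_deriv ?_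
  have hcc : inner ℂ (c 0) (c 0) = (1 : ℂ) := by
    rw [inner_self_eq_norm_sq_to_K, hnorm]; simp
  have hcc'' : inner ℂ (c 0) c'' = -((‖c' 0‖ ^ 2 : ℝ) : ℂ) := by
    have h1 := ((hc 0).inner ℂ hc').congr_of_eventuallyEq (f₁ := fun _ => (0 : ℂ))
      (Filter.Eventually.of_forall fun r => (horth r).symm)
    have h2 := h1.unique (hasDerivAt_const (0 : ℝ) (0 : ℂ))
    rw [inner_self_eq_norm_sq_to_K] at h2
    rw [eq_neg_iff_add_eq_zero, ← h2]
    push_cast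
    rfl
  have hη : inner ℂ (c 0) (c'' + ((‖c' 0‖ ^ 2 : ℝ) : ℂ) • c 0) = 0 := by
    rw [inner_add_right, inner_smul_right, hcc, hcc'']; ring
  rw [hvel.self_of_nhds, fubiniStudy_of_eq_ofVec (hc0 0) (hψ 0).symm,
    hopfForm_of_orthogonal (hnorm 0) hη, inner_add_right, inner_smul_right, Complex.add_re,
    Complex.re_ofReal_mul]
  ring

end FirstVariation

noncomputable section QuotientMaps

variable {X : Type*} [TopologicalSpace X] {G : Type*} [Group G] [MulAction G X]
  [ProperlyDiscontinuousSMul G X] [ContinuousConstSMul G X] [IsCancelSMul G X]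
  [T2Space X] [LocallyCompactSpace X]
  {E : Type*} [NormedAddCommGroup E] [NormedSpace ℝ E]
  {H : Type*} [TopologicalSpace H] (I : ModelWithCorners ℝ E H) [I.Boundaryless]
  [ChartedSpace H X] [IsManifold I ∞ X] [IsManifold I ∞ (MulAction.orbitRel.Quotient G X)]

theorem isLocalHomeomorph_quotientMk :
    IsLocalHomeomorph (Quotient.mk (MulAction.orbitRel G X)) :=
  (isQuotientCoveringMap_quotientMk_of_properlyDiscontinuousSMul (G := G)
    (E := X)).isCoveringMap.isLocalHomeomorph

theorem contMDiff_quotientMk (hG : ∀ g : G, ContMDiff I I ∞ (fun x : X => g • x)) :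
    ContMDiff I I ∞ (Quotient.mk (MulAction.orbitRel G X)) := by
  set π := Quotient.mk (MulAction.orbitRel G X) with hπ
  have hf : IsLocalHomeomorph π := isLocalHomeomorph_quotientMk
  have hbase : ∀ q : MulAction.orbitRel.Quotient G X, ∃ a, π a = q ∧ ContMDiffAt I I ∞ π a := by
    intro q
    set a := (Quotient.mk_surjective (s := MulAction.orbitRel G X)).hasRightInverse.choose q with ha
    have haq : π a = q :=
    (Quotient.mk_surjective (s := MulAction.orbitRel G X)).hasRightInverse.choose_spec q
    refine ⟨a, haq, ?_⟩
    have hchart : chartAt H q = (hf.localInverseAt a).trans (chartAt H a) := rfl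
    have h1 : ContMDiffAt I I ∞ (chartAt H q).symm (chartAt H a a) := by
      refine contMDiffAt_symm_of_mem_maximalAtlas (IsManifold.chart_mem_maximalAtlas q) ?_
      rw [hchart, OpenPartialHomeomorph.trans_target]
      refine ⟨mem_chart_target H a, ?_⟩
      rw [mem_preimage, (chartAt H a).left_inv (mem_chart_source H a)]
      exact hf.self_mem_localInverseAt_target
    refine (h1.comp a (contMDiffAt_of_mem_maximalAtlas (IsManifold.chart_mem_maximalAtlas a)
      (mem_chart_source H a))).congr_of_eventuallyEq ?_
    filter_upwards [(chartAt H a).open_source.mem_nhds (mem_chart_source H a)] with z hz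
    rw [hchart]
    simp only [OpenPartialHomeomorph.trans_symm_eq_symm_trans_symm, Function.comp_apply,
      OpenPartialHomeomorph.coe_trans, IsLocalHomeomorph.localInverseAt_symm]
    rw [(chartAt H a).left_inv hz]
  intro x
  obtain ⟨a, haq, ha⟩ := hbase (π x)
  obtain ⟨g, hg⟩ : ∃ g : G, g • x = a := Quotient.exact haq
  have hπg : π = π ∘ fun z => g • z := by
    funext z
    exact Quotient.sound ⟨g⁻¹, inv_smul_smul g z⟩
  rw [hπg]
  exact ContMDiffAt.comp x (by rw [hg]; exact ha) (hG g).contMDiffAt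

theorem contMDiff_of_comp_quotientMk {E' : Type*} [NormedAddCommGroup E'] [NormedSpace ℝ E']
    {H' : Type*} [TopologicalSpace H'] {J : ModelWithCorners ℝ E' H'} {N : Type*}
    [TopologicalSpace N] [ChartedSpace H' N] {f : MulAction.orbitRel.Quotient G X → N}
    (hfs : ContMDiff I J ∞ (f ∘ Quotient.mk (MulAction.orbitRel G X))) : ContMDiff I J ∞ f := by
  set π := Quotient.mk (MulAction.orbitRel G X) with hπ
  have hf : IsLocalHomeomorph π := isLocalHomeomorph_quotientMk
  intro q
  set a := (Quotient.mk_surjective (s := MulAction.orbitRel G X)).hasRightInverse.choose q with ha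
  have haq : π a = q :=
    (Quotient.mk_surjective (s := MulAction.orbitRel G X)).hasRightInverse.choose_spec q
  have hchart : chartAt H q = (hf.localInverseAt a).trans (chartAt H a) := rfl
  have hqa : hf.localInverseAt a q = a := by
    conv_lhs => rw [← haq]
    exact hf.localInverseAt_apply_self
  have hval : chartAt H q q = chartAt H a a := by
    rw [hchart, OpenPartialHomeomorph.coe_trans, Function.comp_apply, hqa]
  have h1 : ContMDiffAt I I ∞ ((chartAt H a).symm ∘ chartAt H q) q := by
    refine ContMDiffAt.comp q ?_ (contMDiffAt_of_mem_maximalAtlas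
      (IsManifold.chart_mem_maximalAtlas q) (mem_chart_source H q))
    rw [hval]
    exact contMDiffAt_symm_of_mem_maximalAtlas (IsManifold.chart_mem_maximalAtlas a)
      (mem_chart_target H a)
  refine (ContMDiffAt.comp q (hfs.contMDiffAt
    (x := ((chartAt H a).symm ∘ chartAt H q) q)) h1).congr_of_eventuallyEq ?_
  filter_upwards [(chartAt H q).open_source.mem_nhds (mem_chart_source H q)] with z hz
  have hz' := hz
  rw [hchart, OpenPartialHomeomorph.trans_source] at hz'
  have h2 : (chartAt H a).symm (chartAt H q z) = hf.localInverseAt a z :=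
    (chartAt H a).left_inv hz'.2
  rw [Function.comp_apply, Function.comp_apply, Function.comp_apply, h2]
  rw [hf.apply_localInverseAt_of_mem hz'.1]

end QuotientMaps

noncomputable section TheEmbedding

variable {k l : ℕ}

/-- The inclusion of `ℝᵏ⁺¹` into the first factor of `ℂᵏ⁺¹ × ℂˡ⁺¹`. -/
def inclLeft (k l : ℕ) :
    EuclideanSpace ℝ (Fin (k + 1)) →L[ℝ] EuclideanSpace ℂ (Fin (k + l + 1 + 1)) :=
  LinearMap.toContinuousLinearMap
    { toFun := fun u => WithLp.toLp 2 fun j =>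
        Fin.append (fun a => (u a : ℂ)) (fun _ : Fin (l + 1) => 0)
          (Fin.cast (by omega : k + l + 1 + 1 = (k + 1) + (l + 1)) j)
      map_add' := fun u v => by
        ext j
        simp only [PiLp.add_apply]
        refine Fin.addCases (fun a => ?_) (fun b => ?_)
          (Fin.cast (by omega : k + l + 1 + 1 = (k + 1) + (l + 1)) j) <;> simp
      map_smul' := fun c u => by
        ext j
        simp only [PiLp.smul_apply]
        refine Fin.addCases (fun a => ?_) (fun b => ?_)
          (Fin.cast (by omega : k + l + 1 + 1 = (k + 1) + (l + 1)) j) <;> simp }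

/-- The inclusion of `ℝˡ⁺¹` into the second factor of `ℂᵏ⁺¹ × ℂˡ⁺¹`. -/
def inclRight (k l : ℕ) :
    EuclideanSpace ℝ (Fin (l + 1)) →L[ℝ] EuclideanSpace ℂ (Fin (k + l + 1 + 1)) :=
  LinearMap.toContinuousLinearMap
    { toFun := fun u => WithLp.toLp 2 fun j =>
        Fin.append (fun _ : Fin (k + 1) => 0) (fun b => (u b : ℂ))
          (Fin.cast (by omega : k + l + 1 + 1 = (k + 1) + (l + 1)) j)
      map_add' := fun u v => by
        ext j
        simp only [PiLp.add_apply]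
        refine Fin.addCases (fun a => ?_) (fun b => ?_)
          (Fin.cast (by omega : k + l + 1 + 1 = (k + 1) + (l + 1)) j) <;> simp
      map_smul' := fun c u => by
        ext j
        simp only [PiLp.smul_apply]
        refine Fin.addCases (fun a => ?_) (fun b => ?_)
          (Fin.cast (by omega : k + l + 1 + 1 = (k + 1) + (l + 1)) j) <;> simp }

theorem inclLeft_apply (u : EuclideanSpace ℝ (Fin (k + 1))) (j : Fin (k + l + 1 + 1)) :
    inclLeft k l u j = Fin.append (fun a => (u a : ℂ)) (fun _ : Fin (l + 1) => 0)
      (Fin.cast (by omega : k + l + 1 + 1 = (k + 1) + (l + 1)) j) := rfl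

theorem inclRight_apply (v : EuclideanSpace ℝ (Fin (l + 1))) (j : Fin (k + l + 1 + 1)) :
    inclRight k l v j = Fin.append (fun _ : Fin (k + 1) => 0) (fun b => (v b : ℂ))
      (Fin.cast (by omega : k + l + 1 + 1 = (k + 1) + (l + 1)) j) := rfl

theorem inner_eq_sum_append (z w : EuclideanSpace ℂ (Fin (k + l + 1 + 1))) :
    inner ℂ z w = ∑ j : Fin ((k + 1) + (l + 1)),
      inner ℂ (z (Fin.cast (by omega) j)) (w (Fin.cast (by omega) j)) := by
  rw [PiLp.inner_apply]
  exact (Equiv.sum_comp (finCongr (by omega : (k + 1) + (l + 1) = k + l + 1 + 1))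
    (fun j => inner ℂ (z j) (w j))).symm

theorem inner_inclLeft_inclLeft (u v : EuclideanSpace ℝ (Fin (k + 1))) :
    inner ℂ (inclLeft k l u) (inclLeft k l v) = ((inner ℝ u v : ℝ) : ℂ) := by
  rw [inner_eq_sum_append, Fin.sum_univ_add]
  simp [inclLeft_apply, PiLp.inner_apply]

theorem inner_inclRight_inclRight (u v : EuclideanSpace ℝ (Fin (l + 1))) :
    inner ℂ (inclRight k l u) (inclRight k l v) = ((inner ℝ u v : ℝ) : ℂ) := by
  rw [inner_eq_sum_append, Fin.sum_univ_add]
  simp [inclRight_apply, PiLp.inner_apply]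

theorem inner_inclLeft_inclRight (u : EuclideanSpace ℝ (Fin (k + 1)))
    (v : EuclideanSpace ℝ (Fin (l + 1))) : inner ℂ (inclLeft k l u) (inclRight k l v) = 0 := by
  rw [inner_eq_sum_append, Fin.sum_univ_add]
  simp [inclLeft_apply, inclRight_apply]

theorem inner_inclRight_inclLeft (u : EuclideanSpace ℝ (Fin (k + 1)))
    (v : EuclideanSpace ℝ (Fin (l + 1))) : inner ℂ (inclRight k l v) (inclLeft k l u) = 0 := by
  rw [← inner_conj_symm, inner_inclLeft_inclRight, map_zero]

/-- The vector `α u + β v` of `ℂᵏ⁺¹ × ℂˡ⁺¹`, for `u ∈ ℝᵏ⁺¹` and `v ∈ ℝˡ⁺¹`. -/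
def joinVec (α β : ℂ) (u : EuclideanSpace ℝ (Fin (k + 1))) (v : EuclideanSpace ℝ (Fin (l + 1))) :
    EuclideanSpace ℂ (Fin (k + l + 1 + 1)) :=
  α • inclLeft k l u + β • inclRight k l v

theorem inner_joinVec (α β α' β' : ℂ) (u u' : EuclideanSpace ℝ (Fin (k + 1)))
    (v v' : EuclideanSpace ℝ (Fin (l + 1))) :
    inner ℂ (joinVec α β u v) (joinVec α' β' u' v') =
      (starRingEnd ℂ) α * α' * ((inner ℝ u u' : ℝ) : ℂ) +
        (starRingEnd ℂ) β * β' * ((inner ℝ v v' : ℝ) : ℂ) := by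
  simp only [joinVec, inner_add_left, inner_add_right, inner_smul_left, inner_smul_right,
    inner_inclLeft_inclLeft, inner_inclLeft_inclRight, inner_inclRight_inclLeft,
    inner_inclRight_inclRight]
  ring

theorem smul_joinVec (c α β : ℂ) (u : EuclideanSpace ℝ (Fin (k + 1)))
    (v : EuclideanSpace ℝ (Fin (l + 1))) :
    c • joinVec α β u v = joinVec (c * α) (c * β) u v := by
  simp only [joinVec, smul_add, smul_smul]

/-- The unit complex number `exp (i t)`. -/
def phase (t : ℝ) : ℂ := Complex.exp (t * Complex.I)

theorem conj_phase_mul_phase (t : ℝ) : (starRingEnd ℂ) (phase t) * phase t = 1 := by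
  rw [Complex.conj_mul', phase, Complex.norm_exp_ofReal_mul_I]; simp

theorem phase_ne_zero (t : ℝ) : phase t ≠ 0 := Complex.exp_ne_zero _

theorem phase_add (s t : ℝ) : phase (s + t) = phase s * phase t := by
  rw [phase, phase, phase, ← Complex.exp_add]; push_cast; ring_nf

theorem hopfLift_eq_joinVec (δ s : ℝ) (x : UnitSphere k) (y : UnitSphere l) :
    hopfLift δ s x y = joinVec (Real.cos δ * phase (s * Real.sin δ ^ 2))
      (Real.sin δ * phase (-(s * Real.cos δ ^ 2))) x.1 y.1 := by
  ext j
  simp only [hopfLift, joinVec, PiLp.add_apply, PiLp.smul_apply, inclLeft_apply, inclRight_apply,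
    smul_eq_mul, phase]
  refine Fin.addCases (fun a => ?_) (fun b => ?_)
    (Fin.cast (by omega : k + l + 1 + 1 = (k + 1) + (l + 1)) j)
  · simp only [Fin.append_left]
    push_cast
    ring_nf
  · simp only [Fin.append_right]
    push_cast
    ring_nf

/-- The lift `(z, x, y) ↦ (cos δ z x, sin δ y)` to `ℂᵏ⁺¹ × ℂˡ⁺¹` of the embedding. -/
def productLift (δ : ℝ) (p : SphereProduct k l) : EuclideanSpace ℂ (Fin (k + l + 1 + 1)) :=
  joinVec (Real.cos δ * (p.1 : ℂ)) (Real.sin δ) p.2.1.1 p.2.2.1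

theorem hopfLift_eq_smul_productLift (δ s : ℝ) (x : UnitSphere k) (y : UnitSphere l) :
    hopfLift δ s x y = phase (-(s * Real.cos δ ^ 2)) • productLift δ (Circle.exp s, x, y) := by
  have h1 : (Circle.exp s : ℂ) = phase s := Circle.coe_exp s
  have h2 : phase (s * Real.sin δ ^ 2) = phase (-(s * Real.cos δ ^ 2)) * phase s := by
    rw [← phase_add]
    congr 1
    have := Real.sin_sq_add_cos_sq δ
    linear_combination s * this
  rw [hopfLift_eq_joinVec, productLift, smul_joinVec, h1, h2]
  congr 1 <;> ring

theorem inner_self_unitSphere {m : ℕ} (x : UnitSphere m) : inner ℝ x.1 x.1 = (1 : ℝ) := by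
  rw [real_inner_self_eq_norm_sq, norm_eq_of_mem_sphere]; simp

theorem inner_productLift_self (δ : ℝ) (p : SphereProduct k l) :
    inner ℂ (productLift δ p) (productLift δ p) = 1 := by
  have h := Real.cos_sq_add_sin_sq δ
  have hp : (starRingEnd ℂ) (p.1 : ℂ) * (p.1 : ℂ) = 1 := by
    rw [Complex.conj_mul', Circle.norm_coe]; simp
  rw [productLift, inner_joinVec, inner_self_unitSphere, inner_self_unitSphere, map_mul,
    Complex.conj_ofReal, Complex.conj_ofReal]
  have h' : ((Real.cos δ : ℝ) : ℂ) ^ 2 + ((Real.sin δ : ℝ) : ℂ) ^ 2 = 1 := by exact_mod_cast h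
  push_cast at h' ⊢
  linear_combination h' + (Complex.cos δ) ^ 2 * hp

theorem productLift_ne_zero (δ : ℝ) (p : SphereProduct k l) : productLift δ p ≠ 0 := by
  intro h
  have := inner_productLift_self δ p
  simp [h] at this

theorem coe_signAct_unitSphere {m : ℕ} (ε : ℤˣ) (x : UnitSphere m) :
    (signAct ε x).1 = ((ε : ℤ) : ℝ) • x.1 := by
  rcases Int.units_eq_one_or ε with rfl | rfl <;> simp [signAct]

theorem coe_signAct_circle (ε : ℤˣ) (z : Circle) : ((signAct ε z : Circle) : ℂ) = ((ε : ℤ) : ℂ) * z := by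
  rcases Int.units_eq_one_or ε with rfl | rfl <;> simp [signAct]

theorem joinVec_smul_smul (α β : ℂ) (a b : ℝ) (u : EuclideanSpace ℝ (Fin (k + 1)))
    (v : EuclideanSpace ℝ (Fin (l + 1))) :
    joinVec α β (a • u) (b • v) = joinVec (α * a) (β * b) u v := by
  simp only [joinVec, map_smul, ← Complex.coe_smul, smul_smul]

theorem productLift_smul (δ : ℝ) (ε : ℤˣ × ℤˣ) (p : SphereProduct k l) :
    productLift δ (ε • p) = ((ε.2 : ℤ) : ℂ) • productLift δ p := by
  have h : ε • p = (signAct (ε.1 * ε.2) p.1, signAct ε.1 p.2.1, signAct ε.2 p.2.2) := rfl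
  rw [h, productLift, productLift, smul_joinVec]
  simp only
  rw [coe_signAct_unitSphere, coe_signAct_unitSphere, coe_signAct_circle, joinVec_smul_smul]
  have h1 : (((ε.1 : ℤ) : ℂ)) ^ 2 = 1 := by
    rcases Int.units_eq_one_or ε.1 with h | h <;> simp [h]
  congr 1
  · push_cast
    linear_combination (Complex.cos δ * (ε.2 : ℤ) * p.1) * h1
  · push_cast
    ring

/-- The embedding of `(S¹ × Sᵏ × Sˡ) / (ℤ₂ × ℤ₂)` into `ℂPᵏ⁺ˡ⁺¹`. -/
def quotientEmbedding (k l : ℕ) (δ : ℝ) : SphereQuotient k l → CP (k + l + 1) :=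
  Quotient.lift (fun p : SphereProduct k l => CP.ofVec (productLift δ p)) (by
    rintro p q ⟨ε, rfl⟩
    simp only [productLift_smul]
    refine CP.ofVec_smul ?_
    simp)

theorem quotientEmbedding_proj (δ : ℝ) (p : SphereProduct k l) :
    quotientEmbedding k l δ (SphereQuotient.proj p) = CP.ofVec (productLift δ p) := rfl

theorem quotientEmbedding_proj_exp (δ s : ℝ) (x : UnitSphere k) (y : UnitSphere l) :
    quotientEmbedding k l δ (SphereQuotient.proj (Circle.exp s, x, y)) =
      CP.ofVec (hopfLift δ s x y) := by
  rw [quotientEmbedding_proj, hopfLift_eq_smul_productLift, CP.ofVec_smul (phase_ne_zero _)]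

theorem SphereQuotient.contMDiff_proj :
    ContMDiff (sphereModel k l) (sphereModel k l) ∞ (SphereQuotient.proj (k := k) (l := l)) :=
  contMDiff_quotientMk (sphereModel k l) SphereProduct.contMDiff_smul

theorem contMDiff_coe_unitSphere (m : ℕ) :
    ContMDiff (𝓡 m) 𝓘(ℝ, EuclideanSpace ℝ (Fin (m + 1))) ∞ (fun x : UnitSphere m => x.1) := by
  have := Fact.mk (@finrank_euclideanSpace_fin ℝ _ (m + 1))
  exact contMDiff_coe_sphere

theorem contMDiff_coe_circle : ContMDiff (𝓡 1) 𝓘(ℝ, ℂ) ∞ (fun z : Circle => (z : ℂ)) := by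
  have := finrank_real_complex_fact'
  exact contMDiff_coe_sphere (E := ℂ)

theorem contDiff_joinVec : ContDiff ℝ ∞ (fun q : (ℂ × ℂ) ×
    EuclideanSpace ℝ (Fin (k + 1)) × EuclideanSpace ℝ (Fin (l + 1)) =>
    joinVec q.1.1 q.1.2 q.2.1 q.2.2) := by
  unfold joinVec
  exact (contDiff_fst.fst.smul ((inclLeft k l).contDiff.comp contDiff_snd.fst)).add
    (contDiff_fst.snd.smul ((inclRight k l).contDiff.comp contDiff_snd.snd))

theorem contMDiff_productLift (δ : ℝ) :
    ContMDiff (sphereModel k l) 𝓘(ℝ, EuclideanSpace ℂ (Fin (k + l + 1 + 1))) ∞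
      (productLift (k := k) (l := l) δ) := by
  have h1 : ContMDiff (sphereModel k l) 𝓘(ℝ, ℂ) ∞ (fun p : SphereProduct k l => (p.1 : ℂ)) :=
    contMDiff_coe_circle.comp contMDiff_fst
  have h2 : ContMDiff (sphereModel k l) 𝓘(ℝ, EuclideanSpace ℝ (Fin (k + 1))) ∞
      (fun p : SphereProduct k l => p.2.1.1) :=
    (contMDiff_coe_unitSphere k).comp (contMDiff_fst.comp contMDiff_snd)
  have h3 : ContMDiff (sphereModel k l) 𝓘(ℝ, EuclideanSpace ℝ (Fin (l + 1))) ∞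
      (fun p : SphereProduct k l => p.2.2.1) :=
    (contMDiff_coe_unitSphere l).comp (contMDiff_snd.comp contMDiff_snd)
  have h4 : ContMDiff (sphereModel k l) 𝓘(ℝ, ℂ × ℂ) ∞ (fun p : SphereProduct k l =>
      ((Real.cos δ : ℂ) * (p.1 : ℂ), (Real.sin δ : ℂ))) :=
    ((contDiff_const.mul contDiff_id).comp_contMDiff h1).prodMk_space contMDiff_const
  exact contDiff_joinVec.comp_contMDiff (h4.prodMk_space (h2.prodMk_space h3))

theorem contMDiff_quotientEmbedding (δ : ℝ) :
    ContMDiff (sphereModel k l) 𝓘(ℝ, EuclideanSpace ℂ (Fin (k + l + 1))) ∞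
      (quotientEmbedding k l δ) := by
  refine contMDiff_of_comp_quotientMk (sphereModel k l) fun p => ?_
  exact ContMDiffAt.comp (g := CP.ofVec) (f := productLift δ) p
    (CP.contMDiffAt_ofVec (productLift_ne_zero δ p))
    (contMDiff_productLift δ p)

theorem eq_units_of_sq {c : ℝ} (hc : c ^ 2 = 1) : ∃ ε : ℤˣ, c = ((ε : ℤ) : ℝ) := by
  rcases mul_self_eq_one_iff.1 ((sq c).symm.trans hc) with h | h
  · exact ⟨1, by simp [h]⟩
  · exact ⟨-1, by simp [h]⟩

theorem quotientEmbedding_injective {δ : ℝ} (hδ : δ ∈ Ioo 0 (Real.pi / 2)) :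
    Function.Injective (quotientEmbedding k l δ) := by
  have hcos : (Real.cos δ : ℂ) ≠ 0 := by
    exact_mod_cast (Real.cos_pos_of_mem_Ioo ⟨by linarith [hδ.1, Real.pi_pos], hδ.2⟩).ne'
  have hsin : (Real.sin δ : ℂ) ≠ 0 := by
    exact_mod_cast (Real.sin_pos_of_pos_of_lt_pi hδ.1 (by linarith [hδ.2, Real.pi_pos])).ne'
  -- proportional real unit vectors
  have real : ∀ (m : ℕ) (u v : UnitSphere m) (c : ℂ), (∀ a, (u.1 a : ℂ) = c * (v.1 a : ℂ)) →
      ∃ ε : ℤˣ, c = ((ε : ℤ) : ℂ) ∧ u = signAct ε v := by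
    intro m u v c h
    have h1 : c = ((inner ℝ v.1 u.1 : ℝ) : ℂ) := by
      have h2 := inner_self_unitSphere v
      rw [PiLp.inner_apply] at h2 ⊢
      have h3 : c = c * (((∑ i, inner ℝ (v.1 i) (v.1 i) : ℝ)) : ℂ) := by rw [h2]; simp
      rw [h3]
      push_cast
      rw [Finset.mul_sum]
      refine Finset.sum_congr rfl fun a _ => ?_
      simp only [RCLike.inner_apply, conj_trivial, Complex.ofReal_mul]
      rw [h a]; ring
    set r : ℝ := inner ℝ v.1 u.1
    have h4 : u.1 = r • v.1 := by
      ext a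
      have := h a
      rw [h1] at this
      simpa using (by exact_mod_cast this : u.1 a = r * v.1 a)
    have h5 : r ^ 2 = 1 := by
      have h6 := inner_self_unitSphere u
      rw [h4, inner_smul_left, inner_smul_right, inner_self_unitSphere] at h6
      simpa [sq] using h6
    obtain ⟨ε, hε⟩ := eq_units_of_sq h5
    refine ⟨ε, by rw [h1, hε]; simp, Subtype.ext ?_⟩
    rw [coe_signAct_unitSphere, h4, hε]
  intro p q hpq
  induction p using Quotient.ind with | _ p =>
  induction q using Quotient.ind with | _ q =>
  obtain ⟨c, hc⟩ := (CP.ofVec_eq_iff (productLift_ne_zero δ p) (productLift_ne_zero δ q)).1 hpq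
  have hz : ∀ z : Circle, (z : ℂ) ≠ 0 := fun z => z.coe_ne_zero
  have hx : ∀ a, (p.2.1.1 a : ℂ) = (c * q.1 / p.1) * (q.2.1.1 a : ℂ) := by
    intro a
    have := congrArg (fun v : EuclideanSpace ℂ (Fin (k + l + 1 + 1)) =>
      v (Fin.cast (by omega) (Fin.castAdd (l + 1) a))) hc
    simp [productLift, joinVec, inclLeft_apply, inclRight_apply] at this
    have hp := hz p.1
    field_simp
    have h2 : Complex.cos δ ≠ 0 := by simpa using hcos
    apply mul_left_cancel₀ h2
    linear_combination -this
  have hy : ∀ b, (p.2.2.1 b : ℂ) = c * (q.2.2.1 b : ℂ) := by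
    intro b
    have := congrArg (fun v : EuclideanSpace ℂ (Fin (k + l + 1 + 1)) =>
      v (Fin.cast (by omega) (Fin.natAdd (k + 1) b))) hc
    simp [productLift, joinVec, inclLeft_apply, inclRight_apply] at this
    have h2 : Complex.sin δ ≠ 0 := by simpa using hsin
    apply mul_left_cancel₀ h2
    linear_combination -this
  obtain ⟨ε₁, h1, h1'⟩ := real k _ _ _ hx
  obtain ⟨ε₂, h2, h2'⟩ := real l _ _ _ hy
  refine Quotient.sound ⟨(ε₁, ε₂), ?_⟩
  refine Prod.ext ?_ (Prod.ext h1'.symm h2'.symm)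
  refine Subtype.ext ?_
  change ((signAct (ε₁ * ε₂) q.1 : Circle) : ℂ) = p.1
  rw [coe_signAct_circle]
  have hp := hz p.1
  rw [div_eq_iff hp, h2] at h1
  have h3 : (((ε₁ : ℤ) : ℂ)) ^ 2 = 1 := by
    rcases Int.units_eq_one_or ε₁ with h | h <;> simp [h]
  push_cast
  linear_combination ((ε₁ : ℤ) : ℂ) * h1 + (p.1 : ℂ) * h3

theorem quotientEmbedding_isEmbedding {δ : ℝ} (hδ : δ ∈ Ioo 0 (Real.pi / 2)) :
    IsEmbedding (quotientEmbedding k l δ) :=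
  ((contMDiff_quotientEmbedding δ).continuous.isClosedEmbedding
    (quotientEmbedding_injective hδ)).isEmbedding

end TheEmbedding

noncomputable section Frame

theorem exists_orthonormal_perp {m : ℕ} (x : UnitSphere m) :
    ∃ a : Fin m → EuclideanSpace ℝ (Fin (m + 1)), Orthonormal ℝ a ∧ ∀ i, inner ℝ x.1 (a i) = 0 := by
  have := Fact.mk (@finrank_euclideanSpace_fin ℝ _ (m + 1))
  let b := OrthonormalBasis.fromOrthogonalSpanSingleton (𝕜 := ℝ) m (ne_zero_of_mem_unit_sphere x)
  refine ⟨fun i => (b i).1, ?_, fun i => ?_⟩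
  · exact b.orthonormal.comp_linearIsometry (Submodule.subtypeₗᵢ _)
  · exact Submodule.mem_orthogonal_singleton_iff_inner_right.1 (b i).2

/-- An orthonormal basis of the tangent space of the sphere `Sᵐ` at `x`. -/
def sphereFrame {m : ℕ} (x : UnitSphere m) : Fin m → EuclideanSpace ℝ (Fin (m + 1)) :=
  (exists_orthonormal_perp x).choose

theorem inner_sphereFrame {m : ℕ} (x : UnitSphere m) (i j : Fin m) :
    inner ℝ (sphereFrame x i) (sphereFrame x j) = if i = j then (1 : ℝ) else 0 :=
  (orthonormal_iff_ite.1 (exists_orthonormal_perp x).choose_spec.1) i j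

theorem inner_coe_sphereFrame {m : ℕ} (x : UnitSphere m) (i : Fin m) :
    inner ℝ x.1 (sphereFrame x i) = (0 : ℝ) :=
  (exists_orthonormal_perp x).choose_spec.2 i

theorem inner_sphereFrame_coe {m : ℕ} (x : UnitSphere m) (i : Fin m) :
    inner ℝ (sphereFrame x i) x.1 = (0 : ℝ) := by
  rw [real_inner_comm, inner_coe_sphereFrame]

/-- The great circle through `x` with velocity `sphereFrame x i`. -/
def greatCircle {m : ℕ} (x : UnitSphere m) (i : Fin m) (r : ℝ) : UnitSphere m :=
  ⟨Real.cos r • x.1 + Real.sin r • sphereFrame x i, by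
    rw [mem_sphere_zero_iff_norm, ← sq_eq_sq₀ (norm_nonneg _) zero_le_one,
      ← real_inner_self_eq_norm_sq]
    simp only [inner_add_left, inner_add_right, inner_smul_left, inner_smul_right,
      inner_self_unitSphere, inner_sphereFrame, inner_coe_sphereFrame, inner_sphereFrame_coe]
    simp [← sq]⟩

theorem greatCircle_zero {m : ℕ} (x : UnitSphere m) (i : Fin m) : greatCircle x i 0 = x :=
  Subtype.ext (by simp [greatCircle])

theorem contMDiff_greatCircle {m : ℕ} (x : UnitSphere m) (i : Fin m) :
    ContMDiff 𝓘(ℝ, ℝ) (𝓡 m) ∞ (greatCircle x i) := by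
  have := Fact.mk (@finrank_euclideanSpace_fin ℝ _ (m + 1))
  refine ContMDiff.codRestrict_sphere (f := fun r : ℝ =>
    Real.cos r • x.1 + Real.sin r • sphereFrame x i) ?_ fun r => (greatCircle x i r).2
  have h : ContDiff ℝ ∞ fun r : ℝ => Real.cos r • x.1 + Real.sin r • sphereFrame x i :=
    (Real.contDiff_cos.smul contDiff_const).add (Real.contDiff_sin.smul contDiff_const)
  exact h.contMDiff

variable {k l : ℕ}

/-- Curves through the point `proj (exp (i s), x, y)` of the quotient with orthogonal
velocities. -/
def frameCurve (s : ℝ) (x : UnitSphere k) (y : UnitSphere l) :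
    Unit ⊕ Fin k ⊕ Fin l → ℝ → SphereQuotient k l
  | .inl _, r => SphereQuotient.proj (Circle.exp (s + r), x, y)
  | .inr (.inl a), r => SphereQuotient.proj (Circle.exp s, greatCircle x a r, y)
  | .inr (.inr b), r => SphereQuotient.proj (Circle.exp s, x, greatCircle y b r)

/-- The horizontal lifts to the unit sphere of `ℂⁿ⁺¹` of the images of the curves `frameCurve`. -/
def frameLift (δ s : ℝ) (x : UnitSphere k) (y : UnitSphere l) :
    Unit ⊕ Fin k ⊕ Fin l → ℝ → EuclideanSpace ℂ (Fin (k + l + 1 + 1))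
  | .inl _, r => hopfLift δ (s + r) x y
  | .inr (.inl a), r => hopfLift δ s (greatCircle x a r) y
  | .inr (.inr b), r => hopfLift δ s x (greatCircle y b r)

theorem frameCurve_zero (s : ℝ) (x : UnitSphere k) (y : UnitSphere l)
    (i : Unit ⊕ Fin k ⊕ Fin l) :
    frameCurve s x y i 0 = SphereQuotient.proj (Circle.exp s, x, y) := by
  rcases i with _ | a | b <;> simp [frameCurve, greatCircle_zero]

theorem frameLift_zero (δ s : ℝ) (x : UnitSphere k) (y : UnitSphere l)
    (i : Unit ⊕ Fin k ⊕ Fin l) : frameLift δ s x y i 0 = hopfLift δ s x y := by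
  rcases i with _ | a | b <;> simp [frameLift, greatCircle_zero]

theorem ofVec_frameLift (δ s : ℝ) (x : UnitSphere k) (y : UnitSphere l)
    (i : Unit ⊕ Fin k ⊕ Fin l) (r : ℝ) :
    CP.ofVec (frameLift δ s x y i r) = quotientEmbedding k l δ (frameCurve s x y i r) := by
  rcases i with _ | a | b <;> exact (quotientEmbedding_proj_exp δ _ _ _).symm

theorem contMDiff_frameCurve (s : ℝ) (x : UnitSphere k) (y : UnitSphere l)
    (i : Unit ⊕ Fin k ⊕ Fin l) :
    ContMDiff 𝓘(ℝ, ℝ) (sphereModel k l) ∞ (frameCurve s x y i) := by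
  have hexp : ContMDiff 𝓘(ℝ, ℝ) (𝓡 1) ∞ fun r : ℝ => Circle.exp (s + r) :=
    contMDiff_circleExp.comp (contDiff_const.add contDiff_id).contMDiff
  rcases i with _ | a | b
  · exact SphereQuotient.contMDiff_proj.comp
      (hexp.prodMk (contMDiff_const.prodMk contMDiff_const))
  · exact SphereQuotient.contMDiff_proj.comp
      (contMDiff_const.prodMk ((contMDiff_greatCircle x a).prodMk contMDiff_const))
  · exact SphereQuotient.contMDiff_proj.comp
      (contMDiff_const.prodMk (contMDiff_const.prodMk (contMDiff_greatCircle y b)))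

/-- The coefficient of the first component of `hopfLift`. -/
def amplLeft (δ s : ℝ) : ℂ := Real.cos δ * phase (s * Real.sin δ ^ 2)

/-- The coefficient of the second component of `hopfLift`. -/
def amplRight (δ s : ℝ) : ℂ := Real.sin δ * phase (-(s * Real.cos δ ^ 2))

theorem hopfLift_eq (δ s : ℝ) (x : UnitSphere k) (y : UnitSphere l) :
    hopfLift δ s x y = joinVec (amplLeft δ s) (amplRight δ s) x.1 y.1 :=
  hopfLift_eq_joinVec δ s x y

theorem conj_amplLeft_mul (δ s : ℝ) :
    (starRingEnd ℂ) (amplLeft δ s) * amplLeft δ s = (Real.cos δ : ℂ) ^ 2 := by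
  rw [amplLeft, map_mul, Complex.conj_ofReal]
  linear_combination (Real.cos δ : ℂ) ^ 2 * conj_phase_mul_phase (s * Real.sin δ ^ 2)

theorem conj_amplRight_mul (δ s : ℝ) :
    (starRingEnd ℂ) (amplRight δ s) * amplRight δ s = (Real.sin δ : ℂ) ^ 2 := by
  rw [amplRight, map_mul, Complex.conj_ofReal]
  linear_combination (Real.sin δ : ℂ) ^ 2 * conj_phase_mul_phase (-(s * Real.cos δ ^ 2))

theorem contDiff_phase : ContDiff ℝ ∞ phase :=
  Complex.contDiff_exp.comp (Complex.ofRealCLM.contDiff.mul contDiff_const)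

theorem hasDerivAt_phase (t : ℝ) : HasDerivAt phase (Complex.I * phase t) t := by
  have h := ((Complex.ofRealCLM.hasDerivAt (x := t)).mul_const Complex.I).cexp
  refine h.congr_deriv ?_
  simp [phase, mul_comm]

theorem contDiff_amplLeft (δ : ℝ) : ContDiff ℝ ∞ (amplLeft δ) :=
  contDiff_const.mul (contDiff_phase.comp (contDiff_id.mul contDiff_const))

theorem contDiff_amplRight (δ : ℝ) : ContDiff ℝ ∞ (amplRight δ) :=
  contDiff_const.mul (contDiff_phase.comp (contDiff_id.mul contDiff_const).neg)

theorem hasDerivAt_amplLeft (δ s : ℝ) :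
    HasDerivAt (amplLeft δ) (Complex.I * (Real.sin δ : ℂ) ^ 2 * amplLeft δ s) s := by
  have h := (((hasDerivAt_phase (s * Real.sin δ ^ 2)).scomp s
    ((hasDerivAt_id s).mul_const (Real.sin δ ^ 2))).const_mul (Real.cos δ : ℂ))
  refine h.congr_deriv ?_
  rw [amplLeft, Complex.real_smul]
  push_cast
  ring

theorem hasDerivAt_amplRight (δ s : ℝ) :
    HasDerivAt (amplRight δ) (-Complex.I * (Real.cos δ : ℂ) ^ 2 * amplRight δ s) s := by
  have h := (((hasDerivAt_phase (-(s * Real.cos δ ^ 2))).scomp s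
    ((hasDerivAt_id s).mul_const (Real.cos δ ^ 2)).neg).const_mul (Real.sin δ : ℂ))
  refine h.congr_deriv ?_
  rw [amplRight, Complex.real_smul]
  push_cast
  ring

theorem HasDerivAt.joinVec {α β : ℝ → ℂ} {α' β' : ℂ} {u : ℝ → EuclideanSpace ℝ (Fin (k + 1))}
    {v : ℝ → EuclideanSpace ℝ (Fin (l + 1))} {u' : EuclideanSpace ℝ (Fin (k + 1))}
    {v' : EuclideanSpace ℝ (Fin (l + 1))} {r : ℝ} (hα : HasDerivAt α α' r)
    (hβ : HasDerivAt β β' r) (hu : HasDerivAt u u' r) (hv : HasDerivAt v v' r) :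
    HasDerivAt (fun r => joinVec (α r) (β r) (u r) (v r))
      (joinVec α' β' (u r) (v r) + joinVec (α r) (β r) u' v') r := by
  have h1 := hα.smul ((inclLeft k l).hasFDerivAt.comp_hasDerivAt r hu)
  have h2 := hβ.smul ((inclRight k l).hasFDerivAt.comp_hasDerivAt r hv)
  refine (h1.add h2).congr_deriv ?_
  simp only [_root_.joinVec, Function.comp_apply]
  abel

theorem joinVec_zero_zero (u : EuclideanSpace ℝ (Fin (k + 1))) (v : EuclideanSpace ℝ (Fin (l + 1))) :
    joinVec 0 0 u v = 0 := by simp [joinVec]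

theorem joinVec_zero_zero' (α β : ℂ) :
    joinVec α β (0 : EuclideanSpace ℝ (Fin (k + 1))) (0 : EuclideanSpace ℝ (Fin (l + 1))) = 0 := by
  simp [joinVec]

/-- The derivative of `frameLift`. -/
def frameLiftDeriv (δ s : ℝ) (x : UnitSphere k) (y : UnitSphere l) :
    Unit ⊕ Fin k ⊕ Fin l → ℝ → EuclideanSpace ℂ (Fin (k + l + 1 + 1))
  | .inl _, r => joinVec (Complex.I * (Real.sin δ : ℂ) ^ 2 * amplLeft δ (s + r))
      (-Complex.I * (Real.cos δ : ℂ) ^ 2 * amplRight δ (s + r)) x.1 y.1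
  | .inr (.inl a), r => joinVec (amplLeft δ s) (amplRight δ s)
      (-Real.sin r • x.1 + Real.cos r • sphereFrame x a) 0
  | .inr (.inr b), r => joinVec (amplLeft δ s) (amplRight δ s) 0
      (-Real.sin r • y.1 + Real.cos r • sphereFrame y b)

/-- The second derivative at `0` of `frameLift`. -/
def frameLiftDeriv₂ (δ s : ℝ) (x : UnitSphere k) (y : UnitSphere l) :
    Unit ⊕ Fin k ⊕ Fin l → EuclideanSpace ℂ (Fin (k + l + 1 + 1))
  | .inl _ => joinVec (-(Real.sin δ : ℂ) ^ 4 * amplLeft δ s)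
      (-(Real.cos δ : ℂ) ^ 4 * amplRight δ s) x.1 y.1
  | .inr (.inl _) => joinVec (-amplLeft δ s) 0 x.1 y.1
  | .inr (.inr _) => joinVec 0 (-amplRight δ s) x.1 y.1

/-- The squared lengths of the velocities of `frameLift`. -/
def frameNormSq (δ : ℝ) : Unit ⊕ Fin k ⊕ Fin l → ℝ
  | .inl _ => Real.sin δ ^ 2 * Real.cos δ ^ 2
  | .inr (.inl _) => Real.cos δ ^ 2
  | .inr (.inr _) => Real.sin δ ^ 2

theorem hasDerivAt_cos_sin {F : Type*} [NormedAddCommGroup F] [NormedSpace ℝ F] (u v : F) (r : ℝ) :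
    HasDerivAt (fun r : ℝ => Real.cos r • u + Real.sin r • v)
      (-Real.sin r • u + Real.cos r • v) r :=
  ((Real.hasDerivAt_cos r).smul_const u).add ((Real.hasDerivAt_sin r).smul_const v)

theorem hasDerivAt_neg_sin_cos {F : Type*} [NormedAddCommGroup F] [NormedSpace ℝ F] (u v : F) :
    HasDerivAt (fun r : ℝ => -Real.sin r • u + Real.cos r • v) (-u) 0 := by
  refine (((Real.hasDerivAt_sin 0).neg.smul_const u).add
    ((Real.hasDerivAt_cos 0).smul_const v)).congr_deriv ?_
  simp

theorem hasDerivAt_frameLift (δ s : ℝ) (x : UnitSphere k) (y : UnitSphere l)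
    (i : Unit ⊕ Fin k ⊕ Fin l) (r : ℝ) :
    HasDerivAt (frameLift δ s x y i) (frameLiftDeriv δ s x y i r) r := by
  rcases i with _ | a | b
  · have h := ((hasDerivAt_amplLeft δ (s + r)).comp_const_add s r).joinVec
      ((hasDerivAt_amplRight δ (s + r)).comp_const_add s r)
      (hasDerivAt_const r x.1) (hasDerivAt_const r y.1)
    rw [joinVec_zero_zero', add_zero] at h
    have h2 : frameLift δ s x y (.inl ()) = fun r =>
        joinVec (amplLeft δ (s + r)) (amplRight δ (s + r)) x.1 y.1 :=
      funext fun r => hopfLift_eq δ (s + r) x y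
    rw [h2]
    exact h
  · have h := (hasDerivAt_const r (amplLeft δ s)).joinVec (hasDerivAt_const r (amplRight δ s))
      (hasDerivAt_cos_sin x.1 (sphereFrame x a) r) (hasDerivAt_const r y.1)
    rw [joinVec_zero_zero, zero_add] at h
    have h2 : frameLift δ s x y (.inr (.inl a)) = fun r =>
        joinVec (amplLeft δ s) (amplRight δ s) (greatCircle x a r).1 y.1 :=
      funext fun r => hopfLift_eq δ s (greatCircle x a r) y
    rw [h2]
    exact h
  · have h := (hasDerivAt_const r (amplLeft δ s)).joinVec (hasDerivAt_const r (amplRight δ s))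
      (hasDerivAt_const r x.1) (hasDerivAt_cos_sin y.1 (sphereFrame y b) r)
    rw [joinVec_zero_zero, zero_add] at h
    have h2 : frameLift δ s x y (.inr (.inr b)) = fun r =>
        joinVec (amplLeft δ s) (amplRight δ s) x.1 (greatCircle y b r).1 :=
      funext fun r => hopfLift_eq δ s x (greatCircle y b r)
    rw [h2]
    exact h

theorem hasDerivAt_frameLiftDeriv (δ s : ℝ) (x : UnitSphere k) (y : UnitSphere l)
    (i : Unit ⊕ Fin k ⊕ Fin l) :
    HasDerivAt (frameLiftDeriv δ s x y i) (frameLiftDeriv₂ δ s x y i) 0 := by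
  rcases i with _ | a | b
  · have h := (((hasDerivAt_amplLeft δ (s + 0)).comp_const_add s 0).const_mul
      (Complex.I * (Real.sin δ : ℂ) ^ 2)).joinVec
      (((hasDerivAt_amplRight δ (s + 0)).comp_const_add s 0).const_mul
        (-Complex.I * (Real.cos δ : ℂ) ^ 2)) (hasDerivAt_const 0 x.1) (hasDerivAt_const 0 y.1)
    rw [joinVec_zero_zero', add_zero] at h
    refine HasDerivAt.congr_deriv h ?_
    rw [frameLiftDeriv₂, add_zero]
    congr 1
    · linear_combination (Real.sin δ : ℂ) ^ 4 * amplLeft δ s * Complex.I_sq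
    · linear_combination (Real.cos δ : ℂ) ^ 4 * amplRight δ s * Complex.I_sq
  · have h := (hasDerivAt_const 0 (amplLeft δ s)).joinVec (hasDerivAt_const 0 (amplRight δ s))
      (hasDerivAt_neg_sin_cos x.1 (sphereFrame x a))
      (hasDerivAt_const 0 (0 : EuclideanSpace ℝ (Fin (l + 1))))
    rw [joinVec_zero_zero, zero_add] at h
    refine HasDerivAt.congr_deriv h ?_
    simp [frameLiftDeriv₂, joinVec]
  · have h := (hasDerivAt_const 0 (amplLeft δ s)).joinVec (hasDerivAt_const 0 (amplRight δ s))
      (hasDerivAt_const 0 (0 : EuclideanSpace ℝ (Fin (k + 1))))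
      (hasDerivAt_neg_sin_cos y.1 (sphereFrame y b))
    rw [joinVec_zero_zero, zero_add] at h
    refine HasDerivAt.congr_deriv h ?_
    simp [frameLiftDeriv₂, joinVec]

theorem ContDiff.joinVec {α β : ℝ → ℂ} {u : ℝ → EuclideanSpace ℝ (Fin (k + 1))}
    {v : ℝ → EuclideanSpace ℝ (Fin (l + 1))} (hα : ContDiff ℝ ∞ α) (hβ : ContDiff ℝ ∞ β)
    (hu : ContDiff ℝ ∞ u) (hv : ContDiff ℝ ∞ v) :
    ContDiff ℝ ∞ (fun r => joinVec (α r) (β r) (u r) (v r)) :=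
  contDiff_joinVec.comp ((hα.prodMk hβ).prodMk (hu.prodMk hv))

theorem contDiff_frameLift (δ s : ℝ) (x : UnitSphere k) (y : UnitSphere l)
    (i : Unit ⊕ Fin k ⊕ Fin l) : ContDiff ℝ ∞ (frameLift δ s x y i) := by
  have hgc : ∀ (m : ℕ) (u : UnitSphere m) (a : Fin m),
      ContDiff ℝ ∞ fun r => (greatCircle u a r).1 := fun m u a =>
    (Real.contDiff_cos.smul contDiff_const).add (Real.contDiff_sin.smul contDiff_const)
  rcases i with _ | a | b
  · have h2 : frameLift δ s x y (.inl ()) = fun r =>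
        joinVec (amplLeft δ (s + r)) (amplRight δ (s + r)) x.1 y.1 :=
      funext fun r => hopfLift_eq δ (s + r) x y
    rw [h2]
    exact ((contDiff_amplLeft δ).comp (contDiff_const.add contDiff_id)).joinVec
      ((contDiff_amplRight δ).comp (contDiff_const.add contDiff_id)) contDiff_const contDiff_const
  · have h2 : frameLift δ s x y (.inr (.inl a)) = fun r =>
        joinVec (amplLeft δ s) (amplRight δ s) (greatCircle x a r).1 y.1 :=
      funext fun r => hopfLift_eq δ s (greatCircle x a r) y
    rw [h2]
    exact contDiff_const.joinVec contDiff_const (hgc k x a) contDiff_const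
  · have h2 : frameLift δ s x y (.inr (.inr b)) = fun r =>
        joinVec (amplLeft δ s) (amplRight δ s) x.1 (greatCircle y b r).1 :=
      funext fun r => hopfLift_eq δ s x (greatCircle y b r)
    rw [h2]
    exact contDiff_const.joinVec contDiff_const contDiff_const (hgc l y b)

theorem norm_hopfLift (δ s : ℝ) (x : UnitSphere k) (y : UnitSphere l) :
    ‖hopfLift δ s x y‖ = 1 := by
  have h : inner ℂ (hopfLift δ s x y) (hopfLift δ s x y) = (1 : ℂ) := by
    rw [hopfLift_eq, inner_joinVec, conj_amplLeft_mul, conj_amplRight_mul, inner_self_unitSphere,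
      inner_self_unitSphere]
    have := Complex.cos_sq_add_sin_sq (δ : ℂ)
    push_cast
    linear_combination this
  rw [inner_self_eq_norm_sq_to_K] at h
  have h2 : ((‖hopfLift δ s x y‖ ^ 2 : ℝ) : ℂ) = 1 := by push_cast; exact h
  refine (sq_eq_sq₀ (norm_nonneg _) zero_le_one).1 ?_
  rw [one_pow]
  exact_mod_cast h2

theorem norm_frameLift (δ s : ℝ) (x : UnitSphere k) (y : UnitSphere l)
    (i : Unit ⊕ Fin k ⊕ Fin l) (r : ℝ) : ‖frameLift δ s x y i r‖ = 1 := by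
  rcases i with _ | a | b <;> exact norm_hopfLift δ _ _ _

theorem inner_greatCircle_deriv {m : ℕ} (x : UnitSphere m) (a : Fin m) (r : ℝ) :
    inner ℝ (greatCircle x a r).1 (-Real.sin r • x.1 + Real.cos r • sphereFrame x a) = 0 := by
  simp only [greatCircle, inner_add_left, inner_add_right, inner_smul_left, inner_smul_right,
    inner_self_unitSphere, inner_sphereFrame, inner_coe_sphereFrame, inner_sphereFrame_coe]
  simp
  ring

theorem inner_frameLift_deriv (δ s : ℝ) (x : UnitSphere k) (y : UnitSphere l)
    (i : Unit ⊕ Fin k ⊕ Fin l) (r : ℝ) :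
    inner ℂ (frameLift δ s x y i r) (frameLiftDeriv δ s x y i r) = 0 := by
  rcases i with _ | a | b
  · simp only [frameLift, frameLiftDeriv, hopfLift_eq, inner_joinVec, inner_self_unitSphere]
    push_cast
    have h1 := conj_amplLeft_mul δ (s + r)
    have h2 := conj_amplRight_mul δ (s + r)
    push_cast at h1 h2
    linear_combination (Complex.I * Complex.sin δ ^ 2) * h1 - (Complex.I * Complex.cos δ ^ 2) * h2
  · simp only [frameLift, frameLiftDeriv, hopfLift_eq, inner_joinVec, inner_greatCircle_deriv]
    simp
  · simp only [frameLift, frameLiftDeriv, hopfLift_eq, inner_joinVec, inner_greatCircle_deriv]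
    simp

theorem inner_frameLiftDeriv (δ s : ℝ) (x : UnitSphere k) (y : UnitSphere l)
    (i j : Unit ⊕ Fin k ⊕ Fin l) :
    inner ℂ (frameLiftDeriv δ s x y i 0) (frameLiftDeriv δ s x y j 0) =
      if i = j then ((frameNormSq δ i : ℝ) : ℂ) else 0 := by
  have h1 := conj_amplLeft_mul δ s
  have h2 := conj_amplRight_mul δ s
  have h3 := Complex.cos_sq_add_sin_sq (δ : ℂ)
  push_cast at h1 h2
  rcases i with _ | a | b <;> rcases j with _ | a' | b' <;>
    simp only [frameLiftDeriv, inner_joinVec, Real.sin_zero, Real.cos_zero, neg_zero, zero_smul,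
      one_smul, zero_add, add_zero, inner_self_unitSphere, inner_sphereFrame,
      inner_coe_sphereFrame, inner_sphereFrame_coe, inner_zero_left, inner_zero_right,
      frameNormSq, map_mul, map_neg, map_pow, Complex.conj_ofReal, Complex.conj_I, reduceCtorEq,
      if_false, Complex.ofReal_zero, mul_zero, Sum.inr.injEq, Sum.inl.injEq]
  · simp
    linear_combination (-Complex.I ^ 2 * Complex.sin δ ^ 4) * h1 -
      (Complex.I ^ 2 * Complex.cos δ ^ 4) * h2 +
      (-(Complex.sin δ ^ 4 * Complex.cos δ ^ 2 + Complex.sin δ ^ 2 * Complex.cos δ ^ 4)) *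
        Complex.I_sq + (Complex.sin δ ^ 2 * Complex.cos δ ^ 2) * h3
  · rw [h1]
    split_ifs <;> simp
  · rw [h2]
    split_ifs <;> simp

theorem joinVec_add_joinVec (α β α' β' : ℂ) (u : EuclideanSpace ℝ (Fin (k + 1)))
    (v : EuclideanSpace ℝ (Fin (l + 1))) :
    joinVec α β u v + joinVec α' β' u v = joinVec (α + α') (β + β') u v := by
  simp only [joinVec, add_smul]
  abel

/-- The mean curvature vector of the embedding is a constant multiple of `J ∂ₛ`. -/
theorem sum_frameLiftDeriv₂ {δ : ℝ} (hδ : δ ∈ Ioo 0 (Real.pi / 2)) (s : ℝ) (x : UnitSphere k)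
    (y : UnitSphere l) :
    ∑ i : Unit ⊕ Fin k ⊕ Fin l, ((1 / frameNormSq δ i : ℝ) : ℂ) •
      (frameLiftDeriv₂ δ s x y i + ((frameNormSq δ i : ℝ) : ℂ) • hopfLift δ s x y) =
        ((((1 + k) * Real.sin δ ^ 2 - (1 + l) * Real.cos δ ^ 2) /
          (Real.sin δ ^ 2 * Real.cos δ ^ 2) : ℝ) : ℂ) •
          (Complex.I • frameLiftDeriv δ s x y (.inl ()) 0) := by
  have hcos : Complex.cos δ ≠ 0 := by
    exact_mod_cast (Real.cos_pos_of_mem_Ioo ⟨by linarith [hδ.1, Real.pi_pos], hδ.2⟩).ne'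
  have hsin : Complex.sin δ ≠ 0 := by
    exact_mod_cast (Real.sin_pos_of_pos_of_lt_pi hδ.1 (by linarith [hδ.2, Real.pi_pos])).ne'
  have h1 := Complex.cos_sq_add_sin_sq (δ : ℂ)
  simp only [Fintype.sum_sum_type, frameLiftDeriv₂, frameLiftDeriv, frameNormSq, hopfLift_eq,
    smul_joinVec, joinVec_add_joinVec, Finset.sum_const, Finset.card_univ, Fintype.card_fin,
    Fintype.card_unit, ← Nat.cast_smul_eq_nsmul ℂ]
  push_cast
  rw [add_zero]
  congr 1
  · field_simp
    rw [Complex.I_sq]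
    linear_combination (k : ℂ) * h1 * Complex.sin δ ^ 2 * amplLeft δ s
  · field_simp
    rw [Complex.I_sq]
    linear_combination (l : ℂ) * h1 * Complex.cos δ ^ 2 * amplRight δ s

end Frame

noncomputable section ImmersionCriterion

variable {E E' F : Type*} [NormedAddCommGroup E] [NormedSpace ℝ E] [FiniteDimensional ℝ E]
  [NormedAddCommGroup E'] [NormedSpace ℝ E'] [FiniteDimensional ℝ E']
  [NormedAddCommGroup F] [NormedSpace ℝ F] [FiniteDimensional ℝ F]

/-- An injective linear map extends to an isomorphism onto a space of the right dimension. -/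
theorem ContinuousLinearMap.exists_equiv_coprod (A : E →L[ℝ] E') (hA : Function.Injective A)
    (hdim : Module.finrank ℝ E + Module.finrank ℝ F = Module.finrank ℝ E') :
    ∃ (C : F →L[ℝ] E') (L : (E × F) ≃L[ℝ] E'), (L : (E × F) →L[ℝ] E') = A.coprod C := by
  obtain ⟨K, hK⟩ := Submodule.exists_isCompl (LinearMap.range (A : E →ₗ[ℝ] E'))
  have h1 : Module.finrank ℝ (LinearMap.range (A : E →ₗ[ℝ] E')) = Module.finrank ℝ E :=
    LinearMap.finrank_range_of_inj hA
  have h2 := Submodule.finrank_add_eq_of_isCompl hK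
  let T : F ≃ₗ[ℝ] K := LinearEquiv.ofFinrankEq F K (by omega)
  let C : F →L[ℝ] E' := LinearMap.toContinuousLinearMap (K.subtype ∘ₗ T.toLinearMap)
  have hinj : Function.Injective (A.coprod C : (E × F) →ₗ[ℝ] E') := by
    rw [← LinearMap.ker_eq_bot, LinearMap.ker_eq_bot']
    rintro ⟨u, w⟩ h
    have h3 : A u + (T w : E') = 0 := h
    have h4 : A u ∈ LinearMap.range (A : E →ₗ[ℝ] E') ⊓ K :=
      ⟨⟨u, rfl⟩, by rw [eq_neg_of_add_eq_zero_left h3]; exact K.neg_mem (T w).2⟩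
    rw [hK.inf_eq_bot, Submodule.mem_bot] at h4
    rw [h4, zero_add] at h3
    have h5 : T w = 0 := Subtype.ext h3
    rw [LinearEquiv.map_eq_zero_iff] at h5
    exact Prod.ext (hA (h4.trans (map_zero A).symm)) h5
  let L : (E × F) ≃ₗ[ℝ] E' := LinearEquiv.ofInjectiveOfFinrankEq
    (A.coprod C : (E × F) →ₗ[ℝ] E') hinj (by rw [Module.finrank_prod, hdim])
  refine ⟨C, L.toContinuousLinearEquiv, ?_⟩
  ext q <;> rfl

variable {H : Type*} [TopologicalSpace H] {I : ModelWithCorners ℝ E H} [I.Boundaryless]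
  {M : Type*} [TopologicalSpace M] [ChartedSpace H M] [IsManifold I ∞ M]
  {N : Type*} [TopologicalSpace N] [ChartedSpace E' N] [IsManifold 𝓘(ℝ, E') ∞ N]

/-- A smooth map with injective differential at `x` is an immersion at `x`. -/
theorem isImmersionAtOfComplement_of_injective_mfderiv {f : M → N}
    (hf : ContMDiff I 𝓘(ℝ, E') ∞ f) {x : M}
    (hinj : Function.Injective (mfderiv I 𝓘(ℝ, E') f x))
    (hdim : Module.finrank ℝ E + Module.finrank ℝ F = Module.finrank ℝ E') :
    Manifold.IsImmersionAtOfComplement F I 𝓘(ℝ, E') ∞ f x := by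
  set φ := chartAt H x with hφ
  set ψ := chartAt E' (f x) with hψ
  have hφm : φ ∈ IsManifold.maximalAtlas I ∞ M := IsManifold.chart_mem_maximalAtlas x
  have hψm : ψ ∈ IsManifold.maximalAtlas 𝓘(ℝ, E') ∞ N := IsManifold.chart_mem_maximalAtlas (f x)
  have hx : x ∈ φ.source := mem_chart_source H x
  have hfx : f x ∈ ψ.source := mem_chart_source E' (f x)
  set y₀ : E := φ.extend I x with hy₀
  have hy₀t : y₀ ∈ (φ.extend I).target := (φ.extend I).map_source (by rwa [φ.extend_source])
  have hxy₀ : (φ.extend I).symm y₀ = x := φ.extend_left_inv hx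
  have hσ : ContMDiffOn 𝓘(ℝ, E) I ∞ (φ.extend I).symm (φ.extend I).target := by
    rw [φ.extend_target']; exact contMDiffOn_extend_symm hφm
  have hto : IsOpen (φ.extend I).target := φ.isOpen_extend_target
  let g : E → E' := fun y => ψ (f ((φ.extend I).symm y))
  set S : Set E := (φ.extend I).target ∩ (φ.extend I).symm ⁻¹' (f ⁻¹' ψ.source) with hS
  have hSo : IsOpen S :=
    hσ.continuousOn.isOpen_inter_preimage hto (ψ.open_source.preimage hf.continuous)
  have hy₀S : y₀ ∈ S := ⟨hy₀t, by rw [mem_preimage, hxy₀]; exact hfx⟩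
  have hg : ContDiffOn ℝ ∞ g S := by
    rw [← contMDiffOn_iff_contDiffOn]
    exact (contMDiffOn_of_mem_maximalAtlas hψm).comp
      (hf.comp_contMDiffOn (hσ.mono inter_subset_left)) (fun y hy => hy.2)
  have hgd : HasFDerivAt g (fderiv ℝ g y₀) y₀ :=
    ((hg.contDiffAt (hSo.mem_nhds hy₀S)).differentiableAt (by simp)).hasFDerivAt
  have hA : mfderiv I 𝓘(ℝ, E') f x = fderiv ℝ g y₀ := by
    have h1 := hf.contMDiffAt (x := x).mdifferentiableAt (by simp)
    rw [h1.mfderiv, I.range_eq_univ, fderivWithin_univ]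
    rfl
  rw [hA] at hinj
  obtain ⟨C, L, hL⟩ := (fderiv ℝ g y₀).exists_equiv_coprod (F := F) hinj hdim
  let G : E × F → E' := fun q => g q.1 + C q.2
  have hGs : ContDiffOn ℝ ∞ G (S ×ˢ univ) :=
    (hg.comp contDiffOn_fst fun q hq => hq.1).add (C.contDiff.comp contDiff_snd).contDiffOn
  have hSUo : IsOpen (S ×ˢ (univ : Set F)) := hSo.prod isOpen_univ
  have hGa : ∀ q ∈ S ×ˢ (univ : Set F), ContDiffAt ℝ ∞ G q := fun q hq =>
    hGs.contDiffAt (hSUo.mem_nhds hq)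
  have hq₀ : (y₀, (0 : F)) ∈ S ×ˢ (univ : Set F) := ⟨hy₀S, mem_univ _⟩
  have hGd : HasFDerivAt G (L : (E × F) →L[ℝ] E') (y₀, 0) := by
    rw [hL]
    refine ((HasFDerivAt.comp (g := g) (f := Prod.fst) (y₀, (0 : F)) hgd hasFDerivAt_fst).add
      (C.hasFDerivAt.comp (y₀, (0 : F)) hasFDerivAt_snd)).congr_fderiv ?_
    ext q <;> simp
  let Θ : OpenPartialHomeomorph (E × F) E' :=
    (hGa _ hq₀).toOpenPartialHomeomorph G hGd (by simp)
  have hΘ : (Θ : E × F → E') = G := rfl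
  have hΘs : (y₀, (0 : F)) ∈ Θ.source :=
    (hGa _ hq₀).mem_toOpenPartialHomeomorph_source hGd (by simp)
  have hinv : ∀ᶠ q in 𝓝 (y₀, (0 : F)),
      fderiv ℝ G q ∈ range ((↑) : ((E × F) ≃L[ℝ] E') → (E × F) →L[ℝ] E') := by
    have h1 : ContinuousAt (fderiv ℝ G) (y₀, 0) :=
      ((hGa _ hq₀).fderiv_right (m := 0) (by simp)).continuousAt
    refine h1.eventually ?_
    rw [hGd.fderiv]
    exact ContinuousLinearEquiv.nhds L
  obtain ⟨W, hW, hWo, hqW⟩ := mem_nhds_iff.1 (Filter.inter_mem (hSUo.mem_nhds hq₀) hinv)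
  let Θr : OpenPartialHomeomorph (E × F) E' := Θ.restrOpen W hWo
  have hΘrs : Θr.source = Θ.source ∩ W := rfl
  have hΘr : (Θr : E × F → E') = G := rfl
  have hsymm : ContDiffOn ℝ ∞ Θr.symm Θr.target := by
    intro z hz
    have hz' : Θr.symm z ∈ W := (Θr.map_target hz).2
    obtain ⟨T, hT⟩ := (hW hz').2
    refine (Θr.contDiffAt_symm (f₀' := T) hz ?_ ?_).contDiffWithinAt
    · rw [hT, hΘr]
      exact ((hGa _ (hW hz').1).differentiableAt (by simp)).hasFDerivAt
    · exact hGa _ (hW hz').1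
  let κ : OpenPartialHomeomorph N E' := ψ.trans (Θr.symm.trans L.toHomeomorph.toOpenPartialHomeomorph)
  have hκ : (κ : N → E') = fun p => L (Θr.symm (ψ p)) := rfl
  have hκ' : (κ.symm : E' → N) = fun z => ψ.symm (Θr (L.symm z)) := rfl
  have hκs : κ.source = ψ.source ∩ ψ ⁻¹' Θr.target := by
    simp [κ]
  have hκt : ∀ z ∈ κ.target, L.symm z ∈ Θr.source ∧ Θr (L.symm z) ∈ ψ.target := by
    intro z hz
    simpa [κ, OpenPartialHomeomorph.trans_target] using hz
  have hκm : κ ∈ IsManifold.maximalAtlas 𝓘(ℝ, E') ∞ N := by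
    refine κ.mem_maximalAtlas_of_contMDiffOn ?_ ?_
    · rw [hκ, hκs]
      exact L.contDiff.contMDiff.comp_contMDiffOn ((contMDiffOn_iff_contDiffOn.2 hsymm).comp
        ((contMDiffOn_of_mem_maximalAtlas hψm).mono inter_subset_left) fun p hp => hp.2)
    · rw [hκ']
      refine (contMDiffOn_symm_of_mem_maximalAtlas hψm).comp (g := ψ.symm)
        (f := fun z => Θr (L.symm z)) ?_ fun z hz => (hκt z hz).2
      rw [contMDiffOn_iff_contDiffOn]
      exact hGs.comp L.symm.contDiff.contDiffOn fun z hz => (hW (hκt z hz).1.2).1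
  let O : Set M := φ.source ∩ φ.extend I ⁻¹' {y | (y, (0 : F)) ∈ Θr.source}
  have hOo : IsOpen O := by
    have h1 : ContinuousOn (φ.extend I) φ.source := by
      simpa only [φ.extend_source] using φ.continuousOn_extend (I := I)
    exact h1.isOpen_inter_preimage φ.open_source
      (Θr.open_source.preimage (continuous_id.prodMk continuous_const))
  have hxO : x ∈ O := ⟨hx, hΘs, hqW⟩
  have hOint : interior O = O := hOo.interior_eq
  have hG0 : ∀ y, G (y, 0) = ψ (f ((φ.extend I).symm y)) := fun y => by simp [G, g]
  refine Manifold.IsImmersionAtOfComplement.mk_of_continuousAt hf.continuous.continuousAt L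
    (φ.restr O) κ ⟨hx, by rwa [hOint]⟩ ?_
    (restr_mem_maximalAtlas (contDiffGroupoid ∞ I) hφm hOo) hκm ?_
  · rw [hκs]
    refine ⟨hfx, ?_⟩
    have h1 := Θr.map_source (x := (y₀, (0 : F))) ⟨hΘs, hqW⟩
    rw [hΘr, hG0, hxy₀] at h1
    exact h1
  · intro y hy
    have hp : ((φ.restr O).extend I).symm y ∈ ((φ.restr O).extend I).source :=
      ((φ.restr O).extend I).map_target hy
    rw [OpenPartialHomeomorph.extend_source, OpenPartialHomeomorph.restr_source, hOint] at hp
    have hyy : φ.extend I ((φ.extend I).symm y) = y := ((φ.restr O).extend I).right_inv hy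
    have hys : (y, (0 : F)) ∈ Θr.source := by
      have h1 := hp.2.2
      rw [mem_preimage] at h1
      change (φ.extend I ((φ.extend I).symm y), (0 : F)) ∈ Θr.source at h1
      rwa [hyy] at h1
    change L (Θr.symm (ψ (f ((φ.extend I).symm y)))) = L (y, 0)
    rw [← hG0, ← hΘr, Θr.left_inv hys]

end ImmersionCriterion

noncomputable section InducedGeometry

variable {k l : ℕ}

/-- The model vector space of `S¹ × Sᵏ × Sˡ`. -/
abbrev SphereModelSpace (k l : ℕ) : Type :=
  EuclideanSpace ℝ (Fin 1) × EuclideanSpace ℝ (Fin k) × EuclideanSpace ℝ (Fin l)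

theorem finrank_sphereModelSpace (k l : ℕ) :
    Module.finrank ℝ (SphereModelSpace k l) = k + l + 1 := by
  simp
  omega

/-- The velocities at `proj (exp (i s), x, y)` of the curves `frameCurve`. -/
def frameVec (s : ℝ) (x : UnitSphere k) (y : UnitSphere l) (i : Unit ⊕ Fin k ⊕ Fin l) :
    SphereModelSpace k l :=
  mfderiv 𝓘(ℝ, ℝ) (sphereModel k l) (frameCurve s x y i) 0 (1 : ℝ)

/-- The differential of the embedding, on the model vector spaces. -/
def dEmbedding (δ : ℝ) (p : SphereQuotient k l) :
    SphereModelSpace k l →L[ℝ] EuclideanSpace ℂ (Fin (k + l + 1)) :=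
  mfderiv (sphereModel k l) 𝓘(ℝ, EuclideanSpace ℂ (Fin (k + l + 1))) (quotientEmbedding k l δ) p

/-- The metric induced by the embedding. -/
def embeddingMetric (δ : ℝ) (p : SphereQuotient k l) :
    LinearMap.BilinForm ℝ (SphereModelSpace k l) :=
  metricAt (sphereModel k l) (inducedMetric (sphereModel k l) (quotientEmbedding k l δ)) p

theorem SphereQuotient.exists_rep (p : SphereQuotient k l) :
    ∃ s x y, p = SphereQuotient.proj (Circle.exp s, x, y) := by
  induction p using Quotient.ind with | _ p =>
  obtain ⟨z, x, y⟩ := p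
  refine ⟨Complex.arg z, x, y, ?_⟩
  rw [Circle.exp_arg]
  rfl

theorem dEmbedding_frameVec (δ s : ℝ) (x : UnitSphere k) (y : UnitSphere l)
    (i : Unit ⊕ Fin k ⊕ Fin l) :
    dEmbedding δ (SphereQuotient.proj (Circle.exp s, x, y)) (frameVec s x y i) =
      CP.dofVec (hopfLift δ s x y) (frameLiftDeriv δ s x y i 0) := by
  have hd := hasDerivAt_frameLift δ s x y i 0
  have h : dEmbedding δ (frameCurve s x y i 0) (frameVec s x y i) =
      CP.dofVec (frameLift δ s x y i 0) (fderiv ℝ (frameLift δ s x y i) 0 1) :=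
    CP.mfderiv_apply_of_lift (sphereModel k l) (σ := frameCurve s x y i) (y := (0 : ℝ))
      ((contMDiff_quotientEmbedding δ).contMDiffAt.mdifferentiableAt (by simp))
      ((contMDiff_frameCurve s x y i).contMDiffAt.mdifferentiableAt (by simp))
      hd.differentiableAt (by rw [frameLift_zero]; exact hopfLift_ne_zero δ s x y)
      (Filter.Eventually.of_forall (ofVec_frameLift δ s x y i)) 1
  rw [frameCurve_zero, frameLift_zero, hd.hasFDerivAt.fderiv] at h
  simpa using h

theorem quotientEmbedding_eq_hopfLift (δ s : ℝ) (x : UnitSphere k) (y : UnitSphere l) :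
    quotientEmbedding k l δ (SphereQuotient.proj (Circle.exp s, x, y)) =
      CP.ofVec (hopfLift δ s x y) := quotientEmbedding_proj_exp δ s x y

theorem inner_hopfLift_frameLiftDeriv (δ s : ℝ) (x : UnitSphere k) (y : UnitSphere l)
    (i : Unit ⊕ Fin k ⊕ Fin l) :
    inner ℂ (hopfLift δ s x y) (frameLiftDeriv δ s x y i 0) = 0 := by
  rw [← frameLift_zero δ s x y i, inner_frameLift_deriv]

theorem embeddingMetric_frameVec (δ s : ℝ) (x : UnitSphere k) (y : UnitSphere l)
    (i j : Unit ⊕ Fin k ⊕ Fin l) :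
    embeddingMetric δ (SphereQuotient.proj (Circle.exp s, x, y)) (frameVec s x y i)
      (frameVec s x y j) = if i = j then frameNormSq δ i else 0 := by
  change fubiniStudy (quotientEmbedding k l δ (SphereQuotient.proj (Circle.exp s, x, y)))
    (dEmbedding δ (SphereQuotient.proj (Circle.exp s, x, y)) (frameVec s x y i))
    (dEmbedding δ (SphereQuotient.proj (Circle.exp s, x, y)) (frameVec s x y j)) = _
  rw [dEmbedding_frameVec, dEmbedding_frameVec,
    fubiniStudy_of_eq_ofVec (hopfLift_ne_zero δ s x y) (quotientEmbedding_eq_hopfLift δ s x y),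
    hopfForm_of_orthogonal (norm_hopfLift δ s x y) (inner_hopfLift_frameLiftDeriv δ s x y j),
    inner_frameLiftDeriv]
  split_ifs <;> simp

theorem frameNormSq_pos {δ : ℝ} (hδ : δ ∈ Ioo 0 (Real.pi / 2)) (i : Unit ⊕ Fin k ⊕ Fin l) :
    0 < frameNormSq δ i := by
  have hcos := Real.cos_pos_of_mem_Ioo ⟨by linarith [hδ.1, Real.pi_pos], hδ.2⟩
  have hsin := Real.sin_pos_of_pos_of_lt_pi hδ.1 (by linarith [hδ.2, Real.pi_pos])
  rcases i with _ | a | b <;> simp only [frameNormSq] <;> positivity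

theorem exists_basis_frameVec {δ : ℝ} (hδ : δ ∈ Ioo 0 (Real.pi / 2)) (s : ℝ) (x : UnitSphere k)
    (y : UnitSphere l) :
    ∃ b : Module.Basis (Unit ⊕ Fin k ⊕ Fin l) ℝ (SphereModelSpace k l),
      ∀ i, b i = frameVec s x y i := by
  have hli : LinearIndependent ℝ (frameVec s x y) := by
    refine LinearMap.linearIndependent_of_isOrthoᵢ
      (B := embeddingMetric δ (SphereQuotient.proj (Circle.exp s, x, y))) ?_ fun i h => ?_
    · intro i j hij
      rw [Function.onFun, embeddingMetric_frameVec, if_neg hij]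
    · rw [embeddingMetric_frameVec, if_pos rfl] at h
      exact (frameNormSq_pos hδ i).ne' h
  refine ⟨basisOfLinearIndependentOfCardEqFinrank hli ?_, fun i => by simp⟩
  rw [finrank_sphereModelSpace]
  simp
  omega

theorem gramDet_embeddingMetric_pos {δ : ℝ} (hδ : δ ∈ Ioo 0 (Real.pi / 2))
    (p : SphereQuotient k l) :
    0 < gramDet (embeddingMetric δ p) (Module.finBasis ℝ (SphereModelSpace k l)) := by
  obtain ⟨s, x, y, rfl⟩ := p.exists_rep
  obtain ⟨b, hb⟩ := exists_basis_frameVec hδ s x y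
  obtain ⟨c, hc, hB⟩ := gramDet_basis b (Module.finBasis ℝ (SphereModelSpace k l))
  rw [hB, gramDet_of_orthogonal fun i j hij => by
    rw [hb, hb, embeddingMetric_frameVec, if_neg hij]]
  have h1 : ∀ i, 0 < embeddingMetric δ (SphereQuotient.proj (Circle.exp s, x, y)) (b i) (b i) := by
    intro i
    rw [hb, embeddingMetric_frameVec, if_pos rfl]
    exact frameNormSq_pos hδ i
  have h2 := Finset.prod_pos fun i (_ : i ∈ Finset.univ) => h1 i
  positivity

theorem dEmbedding_injective {δ : ℝ} (hδ : δ ∈ Ioo 0 (Real.pi / 2)) (p : SphereQuotient k l) :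
    Function.Injective (dEmbedding δ p) := by
  obtain ⟨s, x, y, rfl⟩ := p.exists_rep
  obtain ⟨b, hb⟩ := exists_basis_frameVec hδ s x y
  rw [injective_iff_map_eq_zero]
  intro u hu
  have h1 : ∀ j, embeddingMetric δ (SphereQuotient.proj (Circle.exp s, x, y)) u
      (frameVec s x y j) = 0 := by
    intro j
    change fubiniStudy (quotientEmbedding k l δ (SphereQuotient.proj (Circle.exp s, x, y)))
      (dEmbedding δ (SphereQuotient.proj (Circle.exp s, x, y)) u)
      (dEmbedding δ (SphereQuotient.proj (Circle.exp s, x, y)) (frameVec s x y j)) = _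
    rw [hu]
    exact LinearMap.map_zero₂ (fubiniStudyForm _) _
  refine b.ext_elem fun j => ?_
  have h2 := h1 j
  rw [← b.sum_repr u, map_sum, LinearMap.sum_apply, Finset.sum_eq_single j] at h2
  · rw [map_smul, LinearMap.smul_apply, hb, embeddingMetric_frameVec, if_pos rfl, smul_eq_mul,
      mul_eq_zero] at h2
    rw [map_zero]
    exact h2.resolve_right (frameNormSq_pos hδ j).ne'
  · intro i _ hij
    rw [map_smul, LinearMap.smul_apply, hb, embeddingMetric_frameVec, if_neg hij, smul_zero]
  · simp

theorem isSmoothEmbedding_quotientEmbedding {δ : ℝ} (hδ : δ ∈ Ioo 0 (Real.pi / 2)) :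
    Manifold.IsSmoothEmbedding (sphereModel k l) 𝓘(ℝ, EuclideanSpace ℂ (Fin (k + l + 1))) ∞
      (quotientEmbedding k l δ) := by
  refine ⟨⟨SphereModelSpace k l, inferInstance, inferInstance, fun p => ?_⟩,
    quotientEmbedding_isEmbedding hδ⟩
  refine isImmersionAtOfComplement_of_injective_mfderiv (contMDiff_quotientEmbedding δ)
    (dEmbedding_injective hδ p) ?_
  rw [finrank_sphereModelSpace, finrank_real_of_complex, finrank_euclideanSpace_fin]
  omega

/-- The pull-back of the Kähler form by the embedding. -/
def pullbackKaehler (δ : ℝ) (p : SphereQuotient k l) :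
    LinearMap.BilinForm ℝ (SphereModelSpace k l) :=
  (fubiniStudyForm (chartAt (EuclideanSpace ℂ (Fin (k + l + 1))) (quotientEmbedding k l δ p)
    (quotientEmbedding k l δ p))).compl₁₂
    (((Complex.I • LinearMap.id : EuclideanSpace ℂ (Fin (k + l + 1)) →ₗ[ℂ]
      EuclideanSpace ℂ (Fin (k + l + 1))).restrictScalars ℝ) ∘ₗ (dEmbedding δ p).toLinearMap)
    (dEmbedding δ p).toLinearMap

theorem isLagrangian_quotientEmbedding {δ : ℝ} (hδ : δ ∈ Ioo 0 (Real.pi / 2)) :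
    IsLagrangian (sphereModel k l) (quotientEmbedding k l δ) := by
  refine ⟨finrank_sphereModelSpace k l, fun p u v => ?_⟩
  suffices h : pullbackKaehler δ p = 0 by
    exact congrArg (fun B : LinearMap.BilinForm ℝ (SphereModelSpace k l) => B u v) h
  obtain ⟨s, x, y, rfl⟩ := p.exists_rep
  obtain ⟨b, hb⟩ := exists_basis_frameVec hδ s x y
  refine LinearMap.BilinForm.ext_basis b fun i j => ?_
  rw [hb, hb]
  change fubiniStudy (quotientEmbedding k l δ (SphereQuotient.proj (Circle.exp s, x, y)))
    (complexStructure (p := quotientEmbedding k l δ (SphereQuotient.proj (Circle.exp s, x, y)))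
      (dEmbedding δ (SphereQuotient.proj (Circle.exp s, x, y)) (frameVec s x y i)))
    (dEmbedding δ (SphereQuotient.proj (Circle.exp s, x, y)) (frameVec s x y j)) = 0
  rw [dEmbedding_frameVec, dEmbedding_frameVec,
    complexStructure_of_eq_ofVec (hopfLift_ne_zero δ s x y) (quotientEmbedding_eq_hopfLift δ s x y),
    fubiniStudy_of_eq_ofVec (hopfLift_ne_zero δ s x y) (quotientEmbedding_eq_hopfLift δ s x y),
    hopfForm_of_orthogonal (norm_hopfLift δ s x y) (inner_hopfLift_frameLiftDeriv δ s x y j),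
    inner_smul_left, inner_frameLiftDeriv]
  split_ifs <;> simp

end InducedGeometry

noncomputable section Rotation

variable {k l : ℕ}

/-- The rotation of the first factor of `S¹ × Sᵏ × Sˡ`. -/
def SphereProduct.rotate (θ : ℝ) (p : SphereProduct k l) : SphereProduct k l :=
  (p.1 * Circle.exp θ, p.2)

theorem SphereProduct.rotate_smul (θ : ℝ) (ε : ℤˣ × ℤˣ) (p : SphereProduct k l) :
    SphereProduct.rotate θ (ε • p) = ε • SphereProduct.rotate θ p := by
  refine Prod.ext ?_ rfl
  change signAct (ε.1 * ε.2) p.1 * Circle.exp θ = signAct (ε.1 * ε.2) (p.1 * Circle.exp θ)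
  unfold signAct
  split_ifs
  · rfl
  · ext
    simp

theorem SphereProduct.contMDiff_rotate : ContMDiff (𝓘(ℝ, ℝ).prod (sphereModel k l))
    (sphereModel k l) ∞ (fun q : ℝ × SphereProduct k l => SphereProduct.rotate q.1 q.2) :=
  ((contMDiff_fst.comp contMDiff_snd).mul (contMDiff_circleExp.comp contMDiff_fst)).prodMk
    (contMDiff_snd.comp contMDiff_snd)

/-- The circle action on the quotient by rotation of the first factor. -/
def SphereQuotient.rotate (θ : ℝ) : SphereQuotient k l → SphereQuotient k l :=
  Quotient.lift (fun p : SphereProduct k l => SphereQuotient.proj (SphereProduct.rotate θ p)) (by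
    rintro p q ⟨ε, rfl⟩
    simp only [SphereProduct.rotate_smul]
    exact Quotient.sound ⟨ε, rfl⟩)

theorem SphereQuotient.rotate_proj (θ : ℝ) (p : SphereProduct k l) :
    SphereQuotient.rotate θ (SphereQuotient.proj p) =
      SphereQuotient.proj (SphereProduct.rotate θ p) := rfl

theorem SphereQuotient.rotate_proj_exp (θ s : ℝ) (x : UnitSphere k) (y : UnitSphere l) :
    SphereQuotient.rotate θ (SphereQuotient.proj (Circle.exp s, x, y)) =
      SphereQuotient.proj (Circle.exp (s + θ), x, y) := by
  rw [SphereQuotient.rotate_proj, SphereProduct.rotate, Circle.exp_add]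

theorem SphereQuotient.rotate_add (θ θ' : ℝ) (p : SphereQuotient k l) :
    SphereQuotient.rotate (θ + θ') p = SphereQuotient.rotate θ' (SphereQuotient.rotate θ p) := by
  obtain ⟨s, x, y, rfl⟩ := p.exists_rep
  simp only [SphereQuotient.rotate_proj_exp, add_assoc]

theorem SphereQuotient.rotate_zero (p : SphereQuotient k l) : SphereQuotient.rotate 0 p = p := by
  obtain ⟨s, x, y, rfl⟩ := p.exists_rep
  rw [SphereQuotient.rotate_proj_exp, add_zero]

theorem SphereQuotient.contMDiff_rotate (θ : ℝ) :
    ContMDiff (sphereModel k l) (sphereModel k l) ∞ (SphereQuotient.rotate (k := k) (l := l) θ) :=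
  contMDiff_of_comp_quotientMk (sphereModel k l) <| SphereQuotient.contMDiff_proj.comp <|
    SphereProduct.contMDiff_rotate.comp (contMDiff_const.prodMk contMDiff_id)

theorem SphereQuotient.contMDiff_rotate_left (p : SphereQuotient k l) :
    ContMDiff 𝓘(ℝ, ℝ) (sphereModel k l) ∞ (fun θ => SphereQuotient.rotate θ p) := by
  obtain ⟨s, x, y, rfl⟩ := p.exists_rep
  exact SphereQuotient.contMDiff_proj.comp <|
    SphereProduct.contMDiff_rotate.comp (contMDiff_id.prodMk contMDiff_const)

/-- The rotation by the angle `θ` as a diffeomorphism of the quotient. -/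
def SphereQuotient.rotateDiffeomorph (θ : ℝ) :
    Diffeomorph (sphereModel k l) (sphereModel k l) (SphereQuotient k l) (SphereQuotient k l) ∞ where
  toFun := SphereQuotient.rotate θ
  invFun := SphereQuotient.rotate (-θ)
  left_inv p := by rw [← SphereQuotient.rotate_add, add_neg_cancel, SphereQuotient.rotate_zero]
  right_inv p := by rw [← SphereQuotient.rotate_add, neg_add_cancel, SphereQuotient.rotate_zero]
  contMDiff_toFun := SphereQuotient.contMDiff_rotate θ
  contMDiff_invFun := SphereQuotient.contMDiff_rotate (-θ)

theorem SphereQuotient.rotate_comp_frameCurve (θ s : ℝ) (x : UnitSphere k) (y : UnitSphere l)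
    (i : Unit ⊕ Fin k ⊕ Fin l) :
    SphereQuotient.rotate θ ∘ frameCurve s x y i = frameCurve (s + θ) x y i := by
  funext r
  rcases i with _ | a | b <;>
    simp only [Function.comp_apply, frameCurve, SphereQuotient.rotate_proj_exp, add_right_comm]

/-- The differential of a rotation, on the model vector spaces. -/
def dRotate (θ : ℝ) (p : SphereQuotient k l) : SphereModelSpace k l →L[ℝ] SphereModelSpace k l :=
  mfderiv (sphereModel k l) (sphereModel k l) (SphereQuotient.rotate θ) p

theorem dRotate_frameVec (θ s : ℝ) (x : UnitSphere k) (y : UnitSphere l)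
    (i : Unit ⊕ Fin k ⊕ Fin l) :
    dRotate θ (SphereQuotient.proj (Circle.exp s, x, y)) (frameVec s x y i) =
      frameVec (s + θ) x y i := by
  have h := mfderiv_comp (I := 𝓘(ℝ, ℝ)) (I' := sphereModel k l) (I'' := sphereModel k l)
    (0 : ℝ) (g := SphereQuotient.rotate θ) (f := frameCurve s x y i)
    ((SphereQuotient.contMDiff_rotate θ).contMDiffAt.mdifferentiableAt (by simp))
    ((contMDiff_frameCurve s x y i).contMDiffAt.mdifferentiableAt (by simp))
  rw [SphereQuotient.rotate_comp_frameCurve] at h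
  have h' : frameVec (s + θ) x y i = dRotate θ (frameCurve s x y i 0) (frameVec s x y i) :=
    congrArg (fun A : ℝ →L[ℝ] SphereModelSpace k l => A 1) h
  rw [h', frameCurve_zero]

theorem embeddingMetric_dRotate {δ : ℝ} (hδ : δ ∈ Ioo 0 (Real.pi / 2)) (θ : ℝ)
    (p : SphereQuotient k l) (u v : SphereModelSpace k l) :
    embeddingMetric δ (SphereQuotient.rotate θ p) (dRotate θ p u) (dRotate θ p v) =
      embeddingMetric δ p u v := by
  obtain ⟨s, x, y, rfl⟩ := p.exists_rep
  obtain ⟨b, hb⟩ := exists_basis_frameVec hδ s x y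
  set p := SphereQuotient.proj (Circle.exp s, x, y)
  suffices h : (embeddingMetric δ (SphereQuotient.rotate θ p)).compl₁₂ (dRotate θ p).toLinearMap
      (dRotate θ p).toLinearMap = embeddingMetric δ p from
    congrArg (fun B : LinearMap.BilinForm ℝ (SphereModelSpace k l) => B u v) h
  refine LinearMap.BilinForm.ext_basis b fun i j => ?_
  rw [hb, hb, embeddingMetric_frameVec]
  change embeddingMetric δ (SphereQuotient.rotate θ p) (dRotate θ p (frameVec s x y i))
    (dRotate θ p (frameVec s x y j)) = _
  rw [dRotate_frameVec, dRotate_frameVec, SphereQuotient.rotate_proj_exp, embeddingMetric_frameVec]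

theorem map_rotate_eq [MeasurableSpace (SphereQuotient k l)] [BorelSpace (SphereQuotient k l)]
    {δ : ℝ} (hδ : δ ∈ Ioo 0 (Real.pi / 2)) {μ : Measure (SphereQuotient k l)}
    (hμ : IsRiemannianVolume (sphereModel k l)
      (inducedMetric (sphereModel k l) (quotientEmbedding k l δ)) μ) (θ : ℝ) :
    μ.map (SphereQuotient.rotate θ) = μ :=
  IsRiemannianVolume.ext (sphereModel k l)
    (hμ.map_diffeomorph (sphereModel k l) (SphereQuotient.rotateDiffeomorph θ) fun p u v =>
      embeddingMetric_dRotate hδ (-θ) p u v) hμ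

/-- The derivative of a function in the direction of the circle action. -/
def rotationDeriv (f : SphereQuotient k l → ℝ) (p : SphereQuotient k l) : ℝ :=
  deriv (fun θ => f (SphereQuotient.rotate θ p)) 0

theorem hasDerivAt_comp_rotate {f : SphereQuotient k l → ℝ}
    (hf : ContMDiff (sphereModel k l) 𝓘(ℝ, ℝ) ∞ f) (p : SphereQuotient k l) (θ : ℝ) :
    HasDerivAt (fun θ => f (SphereQuotient.rotate θ p))
      (rotationDeriv f (SphereQuotient.rotate θ p)) θ := by
  have hd : ∀ q, DifferentiableAt ℝ (fun θ => f (SphereQuotient.rotate θ q)) 0 := fun q =>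
    (contMDiff_iff_contDiff.1
      (hf.comp (SphereQuotient.contMDiff_rotate_left q))).differentiable (by simp) 0
  have h := (hd (SphereQuotient.rotate θ p)).hasDerivAt
  simp only [← SphereQuotient.rotate_add] at h
  have h1 := HasDerivAt.comp_sub_const (x := θ) (a := θ)
    (f := fun r => f (SphereQuotient.rotate (θ + r) p)) (by rwa [sub_self])
  simpa [rotationDeriv, SphereQuotient.rotate_add] using h1

theorem mfderiv_apply_one (g : ℝ → ℝ) (t : ℝ) :
    (mfderiv 𝓘(ℝ, ℝ) 𝓘(ℝ, ℝ) g t : ℝ →L[ℝ] ℝ) 1 = deriv g t :=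
  (congrArg (fun A : ℝ →L[ℝ] ℝ => A 1) mfderiv_eq_fderiv).trans fderiv_apply_one_eq_deriv

theorem continuous_rotationDeriv {f : SphereQuotient k l → ℝ}
    (hf : ContMDiff (sphereModel k l) 𝓘(ℝ, ℝ) ∞ f) : Continuous (rotationDeriv f) := by
  have hq : IsQuotientMap (SphereQuotient.proj (k := k) (l := l)) := isQuotientMap_quotient_mk'
  rw [hq.continuous_iff, continuous_iff_continuousAt]
  intro p
  set G : SphereProduct k l → ℝ → ℝ := fun p θ =>
    f (SphereQuotient.proj (SphereProduct.rotate θ p)) with hG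
  have h := ContMDiffAt.mfderiv (J := sphereModel k l) (I := 𝓘(ℝ, ℝ)) (I' := 𝓘(ℝ, ℝ))
    (x₀ := p) (n := ∞) (m := 0) G (fun _ => (0 : ℝ))
    ((hf.comp (SphereQuotient.contMDiff_proj.comp (SphereProduct.contMDiff_rotate.comp
      (contMDiff_snd.prodMk contMDiff_fst)))) (p, 0)) contMDiffAt_const (by simp)
  have h1 : ContinuousAt (fun q => (mfderiv 𝓘(ℝ, ℝ) 𝓘(ℝ, ℝ) (G q) 0 : ℝ →L[ℝ] ℝ)) p :=
    h.continuousAt.congr <| Filter.Eventually.of_forall <| congrFun <|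
      inTangentCoordinates_model_space (I := 𝓘(ℝ, ℝ)) (I' := 𝓘(ℝ, ℝ)) (fun _ => (0 : ℝ))
        (fun q => G q 0) (fun q => (mfderiv 𝓘(ℝ, ℝ) 𝓘(ℝ, ℝ) (G q) 0 : ℝ →L[ℝ] ℝ)) p
  have h2 := h1.clm_apply (continuousAt_const (y := (1 : ℝ)))
  refine h2.congr (Filter.Eventually.of_forall fun q => ?_)
  exact mfderiv_apply_one (G q) 0

theorem rotationDeriv_proj {f : SphereQuotient k l → ℝ}
    (hf : ContMDiff (sphereModel k l) 𝓘(ℝ, ℝ) ∞ f) (s : ℝ) (x : UnitSphere k)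
    (y : UnitSphere l) :
    rotationDeriv f (SphereQuotient.proj (Circle.exp s, x, y)) =
      (mfderiv (sphereModel k l) 𝓘(ℝ, ℝ) f (SphereQuotient.proj (Circle.exp s, x, y)) :
        SphereModelSpace k l →L[ℝ] ℝ) (frameVec s x y (.inl ())) := by
  have h := mfderiv_comp (I := 𝓘(ℝ, ℝ)) (I' := sphereModel k l) (I'' := 𝓘(ℝ, ℝ))
    (0 : ℝ) (g := f) (f := frameCurve s x y (.inl ()))
    (hf.contMDiffAt.mdifferentiableAt (by simp))
    ((contMDiff_frameCurve s x y _).contMDiffAt.mdifferentiableAt (by simp))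
  have h1 : rotationDeriv f (SphereQuotient.proj (Circle.exp s, x, y)) =
      deriv (f ∘ frameCurve s x y (.inl ())) 0 := by
    simp only [rotationDeriv, SphereQuotient.rotate_proj_exp]
    rfl
  have h2 : (mfderiv 𝓘(ℝ, ℝ) 𝓘(ℝ, ℝ) (f ∘ frameCurve s x y (.inl ())) 0 : ℝ →L[ℝ] ℝ) 1 =
      (mfderiv (sphereModel k l) 𝓘(ℝ, ℝ) f (frameCurve s x y (.inl ()) 0) :
        SphereModelSpace k l →L[ℝ] ℝ) (frameVec s x y (.inl ())) :=
    congrArg (fun A : ℝ →L[ℝ] ℝ => A 1) h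
  rw [h1, ← frameCurve_zero s x y (.inl ()), ← h2, mfderiv_apply_one]

theorem integral_rotationDeriv [MeasurableSpace (SphereQuotient k l)]
    [BorelSpace (SphereQuotient k l)] {f : SphereQuotient k l → ℝ}
    (hf : ContMDiff (sphereModel k l) 𝓘(ℝ, ℝ) ∞ f) {μ : Measure (SphereQuotient k l)}
    [IsFiniteMeasure μ] (hμ : ∀ θ, μ.map (SphereQuotient.rotate θ) = μ) :
    ∫ p, rotationDeriv f p ∂μ = 0 := by
  have hrot : ∀ θ, Continuous (SphereQuotient.rotate (k := k) (l := l) θ) := fun θ =>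
    (SphereQuotient.contMDiff_rotate θ).continuous
  have hconst : ∀ θ, ∫ p, f (SphereQuotient.rotate θ p) ∂μ = ∫ p, f p ∂μ := by
    intro θ
    conv_rhs => rw [← hμ θ]
    rw [integral_map (hrot θ).measurable.aemeasurable hf.continuous.aestronglyMeasurable]
  obtain ⟨C, hC⟩ := isCompact_univ.exists_bound_of_continuousOn
    (continuous_rotationDeriv hf).continuousOn
  obtain ⟨C', hC'⟩ := isCompact_univ.exists_bound_of_continuousOn hf.continuous.continuousOn
  have h := (hasDerivAt_integral_of_dominated_loc_of_deriv_le (μ := μ) (x₀ := (0 : ℝ))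
    (s := univ) (bound := fun _ => C) (F := fun θ p => f (SphereQuotient.rotate θ p))
    (F' := fun θ p => rotationDeriv f (SphereQuotient.rotate θ p)) Filter.univ_mem
    (Filter.Eventually.of_forall fun θ => (hf.continuous.comp (hrot θ)).aestronglyMeasurable)
    (Integrable.of_bound (hf.continuous.comp (hrot 0)).aestronglyMeasurable C'
      (Filter.Eventually.of_forall fun p => hC' _ (mem_univ _)))
    ((continuous_rotationDeriv hf).comp (hrot 0)).aestronglyMeasurable
    (Filter.Eventually.of_forall fun p θ _ => hC _ (mem_univ _)) (integrable_const C)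
    (Filter.Eventually.of_forall fun p θ _ => hasDerivAt_comp_rotate hf p θ)).2
  simp only [hconst, SphereQuotient.rotate_zero] at h
  exact h.unique (hasDerivAt_const _ _)

end Rotation

noncomputable section HamiltonianMinimality

theorem fubiniStudyForm_I_smul {n : ℕ} (w u v : EuclideanSpace ℂ (Fin n)) :
    fubiniStudyForm w (Complex.I • u) (Complex.I • v) = fubiniStudyForm w u v := by
  have h1 : inner ℂ (Complex.I • u) (Complex.I • v) = inner ℂ u v := by
    rw [inner_smul_left, inner_smul_right, ← mul_assoc, Complex.conj_I, neg_mul, Complex.I_mul_I,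
      neg_neg, one_mul]
  have h2 : inner ℂ (Complex.I • u) w * inner ℂ w (Complex.I • v) = inner ℂ u w * inner ℂ w v := by
    rw [inner_smul_left, inner_smul_right, Complex.conj_I]
    linear_combination -(inner ℂ u w * inner ℂ w v) * Complex.I_mul_I
  simp only [fubiniStudyForm, LinearMap.mk₂_apply, h1, h2]

variable {k l : ℕ}

/-- The mean curvature vector of the embedding is `meanCurvatureCoeff` times `J` applied to the
velocity of the circle action. -/
def meanCurvatureCoeff (k l : ℕ) (δ : ℝ) : ℝ :=
  ((1 + k) * Real.sin δ ^ 2 - (1 + l) * Real.cos δ ^ 2) / (Real.sin δ ^ 2 * Real.cos δ ^ 2)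

theorem hasDerivAt_volumeRatio_quotientEmbedding {δ : ℝ} (hδ : δ ∈ Ioo 0 (Real.pi / 2))
    {f : SphereQuotient k l → ℝ} {X : ∀ p : SphereQuotient k l, TangentSpace (sphereModel k l) p}
    {ε : ℝ} {Ψ : ℝ → SphereQuotient k l → CP (k + l + 1)}
    (hf : ContMDiff (sphereModel k l) 𝓘(ℝ, ℝ) ∞ f)
    (hX : IsGradient (sphereModel k l) (quotientEmbedding k l δ) f X)
    (hΨ : IsVariation (sphereModel k l) (quotientEmbedding k l δ) ε Ψ)
    (hV : ∀ p, variationField Ψ p = complexStructure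
      (mfderiv (sphereModel k l) 𝓘(ℝ, EuclideanSpace ℂ (Fin (k + l + 1))) (Ψ 0) p (X p)))
    (p : SphereQuotient k l) :
    HasDerivAt (fun t => volumeRatio (sphereModel k l) (inducedMetric (sphereModel k l) (Ψ 0))
      (inducedMetric (sphereModel k l) (Ψ t)) p)
      (2 * (-meanCurvatureCoeff k l δ * rotationDeriv f p)) 0 := by
  obtain ⟨s, x, y, rfl⟩ := p.exists_rep
  obtain ⟨b, hb⟩ := exists_basis_frameVec hδ s x y
  set p : SphereQuotient k l := SphereQuotient.proj (Circle.exp s, x, y) with hp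
  have hΨ0 : Ψ 0 = quotientEmbedding k l δ := hΨ.2.1
  have hm : metricAt (sphereModel k l) (inducedMetric (sphereModel k l) (Ψ 0)) p =
      embeddingMetric δ p := by
    rw [hΨ0]
    rfl
  set z := hopfLift δ s x y with hz
  set B : LinearMap.BilinForm ℝ (EuclideanSpace ℂ (Fin (k + l + 1))) :=
    fubiniStudyForm (chartAt (EuclideanSpace ℂ (Fin (k + l + 1))) (quotientEmbedding k l δ p)
      (quotientEmbedding k l δ p)) with hB
  set V : EuclideanSpace ℂ (Fin (k + l + 1)) := variationField Ψ p with hVdef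
  have hVp : V = Complex.I • dEmbedding δ p (X p) := by
    obtain ⟨A, hA⟩ : ∃ A : SphereModelSpace k l →L[ℝ] EuclideanSpace ℂ (Fin (k + l + 1)),
        A = mfderiv (sphereModel k l) 𝓘(ℝ, EuclideanSpace ℂ (Fin (k + l + 1))) (Ψ 0) p := ⟨_, rfl⟩
    have h1 : V = Complex.I • A (X p) := by
      rw [hA]
      exact hV p
    rw [hΨ0] at hA
    rw [h1, hA]
    rfl
  have hG : ∀ i, HasDerivAt (fun t => metricAt (sphereModel k l)
      (inducedMetric (sphereModel k l) (Ψ t)) p (b i) (b i))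
      (-2 * B V (CP.dofVec z (frameLiftDeriv₂ δ s x y i +
        ((frameNormSq δ i : ℝ) : ℂ) • z))) 0 := by
    intro i
    have h := hΨ.hasDerivAt_inducedMetric (isLagrangian_quotientEmbedding hδ) hV
      (contMDiff_frameCurve s x y i) (contDiff_frameLift δ s x y i)
      (hasDerivAt_frameLift δ s x y i) (hasDerivAt_frameLiftDeriv δ s x y i)
      (ofVec_frameLift δ s x y i) (norm_frameLift δ s x y i) (inner_frameLift_deriv δ s x y i)
    have hn : ‖frameLiftDeriv δ s x y i 0‖ ^ 2 = frameNormSq δ i := by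
      rw [← inner_self_eq_norm_sq (𝕜 := ℂ), inner_frameLiftDeriv, if_pos rfl]
      exact Complex.ofReal_re _
    rw [hn, frameLift_zero] at h
    have h' : HasDerivAt (fun t => metricAt (sphereModel k l)
        (inducedMetric (sphereModel k l) (Ψ t)) (frameCurve s x y i 0) (frameVec s x y i)
          (frameVec s x y i))
        (-2 * fubiniStudyForm (chartAt (EuclideanSpace ℂ (Fin (k + l + 1)))
          (Ψ 0 (frameCurve s x y i 0)) (Ψ 0 (frameCurve s x y i 0)))
          (variationField Ψ (frameCurve s x y i 0) : EuclideanSpace ℂ (Fin (k + l + 1)))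
          (CP.dofVec z (frameLiftDeriv₂ δ s x y i + ((frameNormSq δ i : ℝ) : ℂ) • z))) 0 := h
    rw [frameCurve_zero, hΨ0] at h'
    rw [hb]
    exact h'
  have hsum := hasDerivAt_volumeRatio (sphereModel k l)
    (h := fun t => inducedMetric (sphereModel k l) (Ψ t)) (p := p) b
    (fun i j hij => by rw [hm, hb, hb, embeddingMetric_frameVec, if_neg hij])
    (fun i => by
      rw [hm, hb, embeddingMetric_frameVec, if_pos rfl]
      exact (frameNormSq_pos hδ i).ne')
    (fun i j => hΨ.differentiableAt_inducedMetric p _ _) hG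
  convert hsum using 1
  have hterm : ∀ i, -2 * B V (CP.dofVec z (frameLiftDeriv₂ δ s x y i +
      ((frameNormSq δ i : ℝ) : ℂ) • z)) / metricAt (sphereModel k l)
        (inducedMetric (sphereModel k l) (Ψ 0)) p (b i) (b i) =
      -2 * B V (CP.dofVec z (((1 / frameNormSq δ i : ℝ) : ℂ) • (frameLiftDeriv₂ δ s x y i +
        ((frameNormSq δ i : ℝ) : ℂ) • z))) := by
    intro i
    rw [hm, hb, embeddingMetric_frameVec, if_pos rfl, Complex.coe_smul (1 / frameNormSq δ i : ℝ),
      map_smul, map_smul, smul_eq_mul]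
    ring
  simp only [hterm]
  rw [← Finset.mul_sum, ← map_sum, ← map_sum, sum_frameLiftDeriv₂ hδ]
  change _ = -2 * B V (CP.dofVec z (((meanCurvatureCoeff k l δ : ℝ) : ℂ) • _))
  rw [Complex.coe_smul, map_smul, map_smul, smul_eq_mul]
  have hJ : CP.dofVec z (Complex.I • frameLiftDeriv δ s x y (.inl ()) 0) =
      Complex.I • dEmbedding δ p (frameVec s x y (.inl ())) := by
    rw [dEmbedding_frameVec, ← complexStructure_of_eq_ofVec (hopfLift_ne_zero δ s x y)
      (quotientEmbedding_eq_hopfLift δ s x y)]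
    rfl
  rw [hJ, hVp, hB, fubiniStudyForm_I_smul]
  have hXp : fubiniStudyForm (chartAt (EuclideanSpace ℂ (Fin (k + l + 1)))
      (quotientEmbedding k l δ p) (quotientEmbedding k l δ p)) (dEmbedding δ p (X p))
      (dEmbedding δ p (frameVec s x y (.inl ()))) =
      rotationDeriv f p :=
    (hX p (frameVec s x y (.inl ()))).trans (rotationDeriv_proj hf s x y).symm
  rw [hXp]
  ring

theorem isHamiltonianMinimal_quotientEmbedding {δ : ℝ} (hδ : δ ∈ Ioo 0 (Real.pi / 2)) :
    IsHamiltonianMinimal (sphereModel k l) (quotientEmbedding k l δ) := by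
  intro f X ε Ψ hf hX hΨ hV
  let _ : MeasurableSpace (SphereQuotient k l) := borel _
  have : BorelSpace (SphereQuotient k l) := ⟨rfl⟩
  obtain ⟨μ, hμ⟩ := exists_isRiemannianVolume (sphereModel k l)
    (inducedMetric (sphereModel k l) (Ψ 0))
  have hsm : ∀ e ∈ IsManifold.maximalAtlas (sphereModel k l) ∞ (SphereQuotient k l),
      ∀ p ∈ e.source, ContDiffAt ℝ 1 (fun q : ℝ × SphereModelSpace k l =>
        (chartGram (sphereModel k l) (inducedMetric (sphereModel k l) (Ψ q.1)) e q.2).det)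
        (0, e.extend (sphereModel k l) p) := fun e he p hp => hΨ.contDiffAt_chartGram_det he hp
  have hfin : IsFiniteMeasure μ := by
    refine hμ.isFiniteMeasure (sphereModel k l) fun e he y hy => ?_
    have h := (hsm e he ((e.extend (sphereModel k l)).symm y) (by
      rw [← e.extend_source (I := sphereModel k l)]
      exact (e.extend (sphereModel k l)).map_target hy)).continuousAt
    rw [(e.extend (sphereModel k l)).right_inv hy] at h
    exact (h.comp (f := fun y : SphereModelSpace k l => ((0 : ℝ), y))
      (by fun_prop)).continuousWithinAt
  have hpos : ∀ p, 0 < gramDet (metricAt (sphereModel k l)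
      (inducedMetric (sphereModel k l) (Ψ 0)) p)
      (Module.finBasis ℝ (SphereModelSpace k l)) := by
    rw [hΨ.2.1]
    exact gramDet_embeddingMetric_pos hδ
  have h := hasDerivAt_totalVolume (sphereModel k l)
    (h := fun t => inducedMetric (sphereModel k l) (Ψ t)) hsm hpos hμ
    ((continuous_rotationDeriv hf).const_mul (-meanCurvatureCoeff k l δ)).measurable
    (hasDerivAt_volumeRatio_quotientEmbedding hδ hf hX hΨ hV)
  rw [hΨ.2.1] at hμ
  rwa [integral_const_mul, integral_rotationDeriv hf (map_rotate_eq hδ hμ), mul_zero] at h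

end HamiltonianMinimality

theorem corollary4 (n₁ n₂ : ℕ) (δ : ℝ) (hδ : δ ∈ Ioo 0 (Real.pi / 2)) :
    ∃ F : SphereQuotient n₁ n₂ → CP (n₁ + n₂ + 1),
      (∀ (s : ℝ) (x : UnitSphere n₁) (y : UnitSphere n₂),
        F (SphereQuotient.proj (Circle.exp s, x, y)) =
          Projectivization.mk ℂ (hopfLift δ s x y) (hopfLift_ne_zero δ s x y)) ∧
      Manifold.IsSmoothEmbedding (sphereModel n₁ n₂)
        𝓘(ℝ, EuclideanSpace ℂ (Fin (n₁ + n₂ + 1))) ∞ F ∧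
      IsLagrangian (sphereModel n₁ n₂) F ∧
      IsHamiltonianMinimal (sphereModel n₁ n₂) F :=
  ⟨quotientEmbedding n₁ n₂ δ,
    fun s x y => (quotientEmbedding_proj_exp δ s x y).trans
      (CP.ofVec_of_ne (hopfLift_ne_zero δ s x y)),
    isSmoothEmbedding_quotientEmbedding hδ, isLagrangian_quotientEmbedding hδ,
    isHamiltonianMinimal_quotientEmbedding hδ⟩
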